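/- Let $\mathcal O\subset\mathbb R^2$ be a bounded open set with connected complement and piecewise smooth boundary: $\partial\mathcal O$ is a finite union of regular compact $C^\infty$ arcs and, away from a finite set $C\subset\partial\mathcal O$ of corners, it is locally a smooth curve with $\mathcal O$ on one side. Let $\lambda\in\mathbb R\setminus\{0\}$, with $\sqrt\lambda>0$ for $\lambda>0$ and $\sqrt\lambda=i\sqrt{|\lambda|}$ for $\lambda<0$. For $\omega\in\mathbb S^1$ let $u(\lambda,\cdot,\omega)$ be the outgoing solution of $$(-\Delta-\lambda^2)u=0\ \text{ in }\mathbb R^2\setminus\overline{\mathcal O},\qquad u(\lambda,x,\omega)=-e^{i\lambda\langle x,\omega\rangle}\ \text{ for }x\in\partial\mathcal O .$$ That is, $u$ is continuous on $\mathbb R^2\setminus\mathcal O$, smooth on $\mathbb R^2\setminus\mathcal O$ (up to the boundary) away from $C$, $\nabla u$ is square integrable on bounded subsets of $\mathbb R^2\setminus\overline{\mathcal O}$, and there is $b(\lambda,\cdot,\omega)\in C^\infty(\mathbb S^1)$ such that, as $|x|\to\infty$, $$u(\lambda,x,\omega)=e^{-\pi i/4}\,\frac{\sqrt{2\pi/|x|}}{\sqrt\lambda}\,e^{i\lambda|x|}\,b(\lambda,x/|x|,\omega)+O(|x|^{-3/2}).$$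 Put $e(\lambda,x,\omega)=e^{i\lambda\langle x,\omega\rangle}+u(\lambda,x,\omega)$ and $A(\lambda,\theta,\omega)=b(\lambda,\theta,\omega)$. The scattering matrix is $S(\lambda)=I+A(\lambda)$ on $L^2(\mathbb S^1)$, where $A(\lambda)f(\theta)=\int_{\mathbb S^1}A(\lambda,\theta,\omega)f(\omega)\,d\omega$. Let $\nu$ be the unit normal to $\partial\mathcal O$ pointing out of $\mathcal O$, let $ds$ be the line measure on $\partial\mathcal O$, and let $\partial_\nu e$ be the normal derivative of $e$ taken from $\mathbb R^2\setminus\mathcal O$ (defined on $\partial\mathcal O\setminus C$). Then for all $\theta,\omega\in\mathbb S^1$ the function $x\mapsto e^{-i\lambda\langle x,\theta\rangle}\,\partial_\nu e(\lambda,x,\omega)$ is integrable on $\partial\mathcal O$ and $$A(\lambda,\theta,\omega)=\frac1{4\pi i}\int_{\partial\mathcal O}e^{-i\lambda\langle x,\theta\rangle}\,\partial_\nu e(\lambda,x,\omega)\,ds(x).$$ Consequently the right-hand side is an integral kernel of $S(\lambda)-I$. -/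

import Mathlib

open Complex Set Filter Topology MeasureTheory
open scoped Manifold RealInnerProductSpace Laplacian

noncomputable section

/-- The Euclidean plane `ℝ²`. -/
abbrev Plane : Type := EuclideanSpace ℝ (Fin 2)

/-- The unit circle `𝕊¹ ⊂ ℝ²`. -/
abbrev UnitCircle : Type := Metric.sphere (0 : Plane) 1

/-- Arc length `dω` on the unit circle (total mass `2π`). -/
abbrev circleMeasure : Measure UnitCircle := (volume : Measure Plane).toSphere

/-- `ρ` is a smooth defining function of `𝒪` on the open neighbourhood `U` of `x`:
`dρ ≠ 0` on `U` and `𝒪 ∩ U = {ρ < 0} ∩ U`. -/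
structure IsLocalDefiningFunction (𝒪 : Set Plane) (x : Plane) (U : Set Plane)
    (ρ : Plane → ℝ) : Prop where
  isOpen : IsOpen U
  mem : x ∈ U
  contDiffOn : ContDiffOn ℝ (⊤ : ℕ∞) ρ U
  gradient_ne_zero : ∀ y ∈ U, gradient ρ y ≠ 0
  mem_iff : ∀ y ∈ U, y ∈ 𝒪 ↔ ρ y < 0

/-- The boundary of `𝒪` is smooth near `x ∈ ∂𝒪`, with `𝒪` on one side of it. -/
def IsSmoothBoundaryPoint (𝒪 : Set Plane) (x : Plane) : Prop :=
  x ∈ frontier 𝒪 ∧ ∃ U ρ, IsLocalDefiningFunction 𝒪 x U ρ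

/-- The corners of `𝒪`: the boundary points near which `∂𝒪` is not smooth. -/
def corners (𝒪 : Set Plane) : Set Plane :=
  {x ∈ frontier 𝒪 | ¬ IsSmoothBoundaryPoint 𝒪 x}

/-- `n` is the unit normal to `∂𝒪` at `x`, pointing out of `𝒪`. -/
def IsOutwardUnitNormal (𝒪 : Set Plane) (x n : Plane) : Prop :=
  x ∈ frontier 𝒪 ∧ ∃ U ρ, IsLocalDefiningFunction 𝒪 x U ρ ∧
    n = (‖gradient ρ x‖)⁻¹ • gradient ρ x

/-- A planar obstacle: a bounded open set with connected complement and piecewise smooth boundary,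
that is, the boundary is a finite union of regular smooth compact arcs, and is smooth, with `𝒪` on
one side, away from finitely many corners. -/
structure IsObstacle (𝒪 : Set Plane) : Prop where
  isOpen : IsOpen 𝒪
  isBounded : Bornology.IsBounded 𝒪
  isConnected_compl : IsConnected 𝒪ᶜ
  exists_arcs : ∃ (m : ℕ) (γ : Fin m → ℝ → Plane),
    (∀ i, ContDiffOn ℝ (⊤ : ℕ∞) (γ i) (Icc 0 1)) ∧
    (∀ i, ∀ t ∈ Icc (0 : ℝ) 1, derivWithin (γ i) (Icc 0 1) t ≠ 0) ∧
    frontier 𝒪 = ⋃ i, γ i '' Icc 0 1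
  finite_corners : (corners 𝒪).Finite

/-- The plane wave `exp(iλ⟨x, ω⟩)`. -/
def planeWave (lam : ℝ) (ω x : Plane) : ℂ := exp (I * lam * (⟪x, ω⟫ : ℝ))

/-- The radial projection `x ↦ x / |x|` to the unit circle (with an arbitrary value at `0`). -/
def direction (x : Plane) : UnitCircle :=
  if h : x = 0 then ⟨EuclideanSpace.single 0 1, by simp⟩
  else ⟨(‖x‖)⁻¹ • x, by simp [norm_smul, h]⟩

/-- The leading term `exp(-πi/4) √(2π/(λ|x|)) exp(iλ|x|) b(x/|x|)` of an outgoing wave. Here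
`√λ = λ ^ (1/2)` is the branch with `arg λ = 0` for `λ > 0` and `arg λ = π` for `λ < 0`. -/
def outgoingLeadingTerm (lam : ℝ) (b : UnitCircle → ℂ) (x : Plane) : ℂ :=
  exp (-(Real.pi * I / 4)) * ((Real.sqrt (2 * Real.pi / ‖x‖) : ℝ) / (lam : ℂ) ^ (1 / 2 : ℂ)) *
    exp (I * lam * ‖x‖) * b (direction x)

/-- `u` is the outgoing solution of `(-Δ - λ²) u = 0` in `ℝ² ∖ 𝒪` with
`u = -exp(iλ⟨x, ω⟩)` on `∂𝒪`, and `b` is its outgoing amplitude. The values of `u` in `𝒪` are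
irrelevant. At the corners, where `u` need not be smooth, continuity and locally finite energy are
required; elsewhere `u` is smooth up to the boundary. -/
structure IsOutgoingSolution (𝒪 : Set Plane) (lam : ℝ) (ω : UnitCircle)
    (u : Plane → ℂ) (b : UnitCircle → ℂ) : Prop where
  continuousOn : ContinuousOn u 𝒪ᶜ
  contDiffOn : ContDiffOn ℝ (⊤ : ℕ∞) u (𝒪ᶜ \ corners 𝒪)
  finite_energy : ∀ R : ℝ,
    IntegrableOn (fun x => ‖fderiv ℝ u x‖ ^ 2) ((closure 𝒪)ᶜ ∩ Metric.ball 0 R) volume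
  helmholtz : ∀ x ∈ (closure 𝒪)ᶜ, -(Δ u) x - (lam : ℂ) ^ 2 * u x = 0
  boundary : ∀ x ∈ frontier 𝒪, u x = -planeWave lam ω x
  amplitude_smooth : ContMDiff (𝓡 1) 𝓘(ℝ, ℂ) (⊤ : ℕ∞) b
  outgoing : (fun x => u x - outgoingLeadingTerm lam b x)
    =O[Bornology.cobounded Plane] (fun x => ‖x‖ ^ (-(3 / 2) : ℝ))

/-- The perturbed plane wave `e = exp(iλ⟨x, ω⟩) + u`. -/
def perturbedPlaneWave (lam : ℝ) (ω : UnitCircle) (u : Plane → ℂ) (x : Plane) : ℂ :=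
  planeWave lam ω x + u x

/-- The derivative of `e` in the direction `n` at `x ∈ ∂𝒪`, taken from the exterior of `𝒪`. -/
def exteriorNormalDeriv (𝒪 : Set Plane) (e : Plane → ℂ) (x n : Plane) : ℂ :=
  fderivWithin ℝ e 𝒪ᶜ x n

/-- The integrand `exp(-iλ⟨x, θ⟩) ∂_ν e(λ, x, ω)`. -/
def boundaryIntegrand (𝒪 : Set Plane) (ν : Plane → Plane) (lam : ℝ)
    (u : UnitCircle → Plane → ℂ) (θ ω : UnitCircle) (x : Plane) : ℂ :=
  exp (-(I * lam * (⟪x, (θ : Plane)⟫ : ℝ))) *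
    exteriorNormalDeriv 𝒪 (perturbedPlaneWave lam ω (u ω)) x (ν x)

/-- The function `(1/(4πi)) ∫_{∂𝒪} exp(-iλ⟨x, θ⟩) ∂_ν e(λ, x, ω) ds(x)`, where `ds` is the
one-dimensional Hausdorff measure on `∂𝒪`. -/
def boundaryKernel (𝒪 : Set Plane) (ν : Plane → Plane) (lam : ℝ)
    (u : UnitCircle → Plane → ℂ) (θ ω : UnitCircle) : ℂ :=
  1 / (4 * Real.pi * I) *
    ∫ x in frontier 𝒪, boundaryIntegrand 𝒪 ν lam u θ ω x ∂(Measure.hausdorffMeasure 1)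

/-- `T : L²(𝕊¹) → L²(𝕊¹)` is the integral operator `(T f)(θ) = ∫ K(θ, ω) f(ω) dω`. -/
def HasIntegralKernel (T : Lp ℂ 2 circleMeasure →L[ℂ] Lp ℂ 2 circleMeasure)
    (K : UnitCircle → UnitCircle → ℂ) : Prop :=
  ∀ f : Lp ℂ 2 circleMeasure, ∀ᵐ θ ∂circleMeasure,
    Integrable (fun ω => K θ ω * f ω) circleMeasure ∧
      T f θ = ∫ ω, K θ ω * f ω ∂circleMeasure

end

/-! Test the total wave `e`, which vanishes on the boundary, against `exp(-iλ⟨x, θ⟩) m(x)`, where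
`m` is a cutoff equal to `1` near the obstacle. Green's formula turns the boundary integral of
`exp(-iλ⟨x, θ⟩) ∂_ν e` into the exterior integral of `e exp(-iλ⟨x, θ⟩) (Δ m - 2iλ ∂_θ m)`. The
incident plane wave contributes nothing, because it solves the Helmholtz equation in the whole
plane, so `e` may be replaced by `u` (`green_transport`).

The difficulty in Green's formula is the corners, near which the normal derivative is not known in
advance to be integrable. Kato's inequality settles this: formally `Δ|w| ≥ -λ²|w|`, so for `ψ ≥ 0`
the boundary integral of `ψ |∂_ν w|` is at most the exterior integral of `|w| (Δψ + λ²ψ)`. Inserting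
a cutoff which vanishes near a corner `c` at scale `1/t` changes `Δψ + λ²ψ` by `O(t²)` on a disc of
area `O(t⁻²)`, and `w` is continuous with `w(c) = 0`, so the exterior integral changes by `o(1)`.
Fatou's lemma then gives integrability, and dominated convergence gives Green's formula
(`IsDirichletSolution.greenHolds`). Away from the corners both statements are local. They come from
the divergence theorem in coordinates which straighten the boundary, applied to `f(w) dψ - ψ
d(f(w))` on the region at height at least `δ`, with `f` the identity or a smooth convex
approximation of `|·|`, and `δ → 0`.

To extract the amplitude, take for `m` the damping factor `exp(-ε|x|)`, modified near the obstacle,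
and let `ε → 0`. The modified region contributes `O(ε)`, and everything but the leading term of `u`
against `2iλε ⟨y, θ⟩/|y|` contributes `O(√ε)` (`tendsto_integral_leadingTerm`). In polar coordinates
around `θ` the radial integral is a Laplace transform, equal to `Γ(3/2) z^(-3/2)` at `z = ε - iλ(1 -
cos α)`. Multiplied by `ε`, this concentrates at `α = 0` on the scale `√ε`, and the constants
combine to `4πi` (`tendsto_integral_leadingTerm_mul_dampedKernel`). Uniqueness of limits gives the
formula for `A`. -/

theorem ContDiffAt.differentiableAt_fderiv {E F : Type*} [NormedAddCommGroup E] [NormedSpace ℝ E]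
    [NormedAddCommGroup F] [NormedSpace ℝ F] {f : E → F} {x : E} (hf : ContDiffAt ℝ 2 f x) :
    DifferentiableAt ℝ (fderiv ℝ f) x :=
  (hf.fderiv_right (m := 1) (by norm_num)).differentiableAt (by norm_num)

/-! ### The Laplacian in an orthonormal basis and the product rule. -/

section Laplacian

variable {E F : Type*} [NormedAddCommGroup E] [InnerProductSpace ℝ E] [FiniteDimensional ℝ E]
  [NormedAddCommGroup F] [NormedSpace ℝ F] {ι : Type*} [Fintype ι]

theorem laplacian_eq_sum_fderiv_fderiv (b : OrthonormalBasis ι ℝ E) (f : E → F) (x : E) :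
    (Δ f) x = ∑ i, fderiv ℝ (fderiv ℝ f) x (b i) (b i) := by
  rw [InnerProductSpace.laplacian_eq_iteratedFDeriv_orthonormalBasis f b]
  simp [iteratedFDeriv_two_apply]

theorem laplacian_mul {𝔸 : Type*} [RCLike 𝔸]
    (b : OrthonormalBasis ι ℝ E) {f g : E → 𝔸} {x : E}
    (hf : ContDiffAt ℝ 2 f x) (hg : ContDiffAt ℝ 2 g x) :
    (Δ (fun y => f y * g y)) x =
      f x * (Δ g) x + 2 * ∑ i, fderiv ℝ f x (b i) * fderiv ℝ g x (b i) + g x * (Δ f) x := by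
  simp only [laplacian_eq_sum_fderiv_fderiv b]
  have h1 : fderiv ℝ (fun y => f y * g y) =ᶠ[𝓝 x]
      fun y => f y • fderiv ℝ g y + g y • fderiv ℝ f y := by
    filter_upwards [hf.eventually (by simp), hg.eventually (by simp)] with y hy hy'
    exact fderiv_fun_mul (hy.differentiableAt (by norm_num)) (hy'.differentiableAt (by norm_num))
  have hf1 : DifferentiableAt ℝ f x := hf.differentiableAt (by norm_num)
  have hg1 : DifferentiableAt ℝ g x := hg.differentiableAt (by norm_num)
  have hf2 := hf.differentiableAt_fderiv
  have hg2 := hg.differentiableAt_fderiv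
  rw [h1.fderiv_eq, fderiv_fun_add (hf1.fun_smul hg2) (hg1.fun_smul hf2), fderiv_fun_smul hf1 hg2,
    fderiv_fun_smul hg1 hf2, Finset.mul_sum, Finset.mul_sum, Finset.mul_sum,
    ← Finset.sum_add_distrib, ← Finset.sum_add_distrib]
  refine Finset.sum_congr rfl fun i _ => ?_
  simp [smul_eq_mul]
  ring

end Laplacian

/-! ### The divergence theorem above a graph. -/

section Divergence

/-- Cartesian coordinates with origin `p` and axes `b 0`, `b 1`. -/
noncomputable def frameMap (b : OrthonormalBasis (Fin 2) ℝ Plane) (p : Plane) (z : ℝ × ℝ) : Plane :=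
  p + (z.1 • b 0 + z.2 • b 1)

/-- Coordinates in which the graph of `h` over the axis `b 0` is straightened. -/
noncomputable def graphMap (b : OrthonormalBasis (Fin 2) ℝ Plane) (p : Plane) (h : ℝ → ℝ) (z : ℝ × ℝ) : Plane :=
  frameMap b p (z.1, h z.1 + z.2)

variable {b : OrthonormalBasis (Fin 2) ℝ Plane} {p : Plane} {h : ℝ → ℝ}

theorem contDiff_frameMap {n : WithTop ℕ∞} : ContDiff ℝ n (frameMap b p) := by
  unfold frameMap
  fun_prop

theorem ContDiff.graphMap {n : WithTop ℕ∞} (hh : ContDiff ℝ n h) :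
    ContDiff ℝ n (graphMap b p h) := by
  unfold _root_.graphMap
  exact contDiff_frameMap.comp (by fun_prop)

theorem hasFDerivAt_graphMap (hh : Differentiable ℝ h) (z : ℝ × ℝ) :
    HasFDerivAt (graphMap b p h)
      ((ContinuousLinearMap.fst ℝ ℝ ℝ).smulRight (b 0 + deriv h z.1 • b 1) +
        (ContinuousLinearMap.snd ℝ ℝ ℝ).smulRight (b 1)) z := by
  have h1 : HasFDerivAt (fun z : ℝ × ℝ => h z.1 + z.2)
      ((deriv h z.1) • ContinuousLinearMap.fst ℝ ℝ ℝ + ContinuousLinearMap.snd ℝ ℝ ℝ) z :=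
    ((hh z.1).hasDerivAt.comp_hasFDerivAt z hasFDerivAt_fst).add hasFDerivAt_snd
  have h2 := (((hasFDerivAt_fst (𝕜 := ℝ) (p := z)).smul_const (b 0)).add
    (h1.smul_const (b 1))).const_add p
  refine h2.congr_fderiv ?_
  ext <;> simp

/-- The divergence theorem above a graph, for a covector field which vanishes on three sides of a
box in straightened coordinates. -/
theorem integral_div_graphMap (hh : ContDiff ℝ 2 h) {U : Set Plane} (hU : IsOpen U)
    {X : Plane → Plane →L[ℝ] ℝ} (hX : ContDiffOn ℝ 1 X U) {a c d : ℝ} (ha : 0 ≤ a) (hcd : c ≤ d)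
    (hbox : ∀ z ∈ Icc (-a, c) (a, d), graphMap b p h z ∈ U)
    (hside : ∀ z ∈ Icc (-a, c) (a, d), z.1 = -a ∨ z.1 = a ∨ z.2 = d → X (graphMap b p h z) = 0) :
    ∫ z in Icc (-a, c) (a, d), ∑ i, fderiv ℝ X (graphMap b p h z) (b i) (b i) =
      -∫ x in (-a)..a, X (graphMap b p h (x, c)) (b 1 - deriv h x • b 0) := by
  have hΦ : ContDiff ℝ 2 (graphMap b p h) := hh.graphMap
  have hd : Differentiable ℝ h := hh.differentiable (by norm_num)
  have hd' : ContDiff ℝ 1 (deriv h) := by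
    have : ContDiff ℝ (1 + 1) h := by norm_num; exact hh
    exact (contDiff_succ_iff_deriv.1 this).2.2
  have hXd : ∀ z, graphMap b p h z ∈ U → HasFDerivAt (fun z => X (graphMap b p h z))
      ((fderiv ℝ X (graphMap b p h z)).comp
      ((ContinuousLinearMap.fst ℝ ℝ ℝ).smulRight (b 0 + deriv h z.1 • b 1) +
        (ContinuousLinearMap.snd ℝ ℝ ℝ).smulRight (b 1))) z := fun z hz =>
    (((hX.contDiffAt (hU.mem_nhds hz)).differentiableAt (by norm_num)).hasFDerivAt).comp z
      (hasFDerivAt_graphMap hd z)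
  have hXc : ContinuousOn (fun z => X (graphMap b p h z)) (Icc (-a, c) (a, d)) :=
    hX.continuousOn.comp hΦ.continuous.continuousOn hbox
  have hDXc : ContinuousOn (fun z => fderiv ℝ X (graphMap b p h z)) (Icc (-a, c) (a, d)) :=
    (hX.continuousOn_fderiv_of_isOpen hU le_rfl).comp hΦ.continuous.continuousOn hbox
  have hsub : Ioo (-a) a ×ˢ Ioo c d ⊆ Icc (-a, c) (a, d) := by
    rintro ⟨x, y⟩ ⟨hx, hy⟩
    exact ⟨⟨hx.1.le, hy.1.le⟩, ⟨hx.2.le, hy.2.le⟩⟩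
  -- The straightening map is a shear with unit Jacobian. In its coordinates the field has
  -- components `X(b 0)` and `X(b 1) - h' X(b 0)`, and its divergence is unchanged (`hdiv` below):
  -- the terms with `h'' X(b 0)` do not appear because `h` depends on the first coordinate only.
  have key := integral_divergence_prod_Icc_of_hasFDerivAt_of_le
    (fun z => X (graphMap b p h z) (b 0))
    (fun z => X (graphMap b p h z) (b 1) - deriv h z.1 * X (graphMap b p h z) (b 0))
    (fun z => (ContinuousLinearMap.apply ℝ ℝ (b 0)).comp
      ((fderiv ℝ X (graphMap b p h z)).comp
      ((ContinuousLinearMap.fst ℝ ℝ ℝ).smulRight (b 0 + deriv h z.1 • b 1) +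
        (ContinuousLinearMap.snd ℝ ℝ ℝ).smulRight (b 1))))
    (fun z => (ContinuousLinearMap.apply ℝ ℝ (b 1)).comp
      ((fderiv ℝ X (graphMap b p h z)).comp
      ((ContinuousLinearMap.fst ℝ ℝ ℝ).smulRight (b 0 + deriv h z.1 • b 1) +
        (ContinuousLinearMap.snd ℝ ℝ ℝ).smulRight (b 1))) -
      (deriv h z.1 • (ContinuousLinearMap.apply ℝ ℝ (b 0)).comp
      ((fderiv ℝ X (graphMap b p h z)).comp
      ((ContinuousLinearMap.fst ℝ ℝ ℝ).smulRight (b 0 + deriv h z.1 • b 1) +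
        (ContinuousLinearMap.snd ℝ ℝ ℝ).smulRight (b 1))) +
       X (graphMap b p h z) (b 0) •
        (deriv (deriv h) z.1 • ContinuousLinearMap.fst ℝ ℝ ℝ)))
    (-a, c) (a, d) ⟨by simpa using ha, hcd⟩
    (hXc.clm_apply continuousOn_const)
    ((hXc.clm_apply continuousOn_const).sub
      ((hd'.continuous.comp continuous_fst).continuousOn.mul (hXc.clm_apply continuousOn_const)))
    (fun z hz => (ContinuousLinearMap.apply ℝ ℝ (b 0)).hasFDerivAt.comp z
      (hXd z (hbox z (hsub hz))))
    (fun z hz => ((ContinuousLinearMap.apply ℝ ℝ (b 1)).hasFDerivAt.comp z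
      (hXd z (hbox z (hsub hz)))).sub
      ((((hd'.differentiable (by norm_num)) z.1).hasDerivAt.comp_hasFDerivAt z
        hasFDerivAt_fst).mul ((ContinuousLinearMap.apply ℝ ℝ (b 0)).hasFDerivAt.comp z
      (hXd z (hbox z (hsub hz))))))
  have hdiv : ∀ z : ℝ × ℝ, (∑ i, fderiv ℝ X (graphMap b p h z) (b i) (b i)) = 
      (fderiv ℝ X (graphMap b p h z)) (b 0 + deriv h z.1 • b 1) (b 0) +
      ((fderiv ℝ X (graphMap b p h z)) (b 1) (b 1) -
        deriv h z.1 * (fderiv ℝ X (graphMap b p h z)) (b 1) (b 0)) := by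
    intro z
    simp [Fin.sum_univ_two]
  have hint : IntegrableOn (fun z => ∑ i, fderiv ℝ X (graphMap b p h z) (b i) (b i))
      (Icc (-a, c) (a, d)) :=
    (continuousOn_finsetSum _ fun i _ => (hDXc.clm_apply continuousOn_const).clm_apply
      continuousOn_const).integrableOn_compact isCompact_Icc
  simp only [ContinuousLinearMap.comp_apply, sub_apply,
    add_apply, smul_apply,
    ContinuousLinearMap.smulRight_apply, ContinuousLinearMap.apply_apply,
    ContinuousLinearMap.coe_fst', ContinuousLinearMap.coe_snd', one_smul, zero_smul, add_zero,
    zero_add, smul_eq_mul, mul_zero] at key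
  rw [setIntegral_congr_fun measurableSet_Icc fun z _ => hdiv z, key (by
    simpa only [hdiv] using hint)]
  have e1 : ∫ x in (-a)..a, (X (graphMap b p h (x, d)) (b 1) -
      deriv h x * X (graphMap b p h (x, d)) (b 0)) = 0 := by
    rw [intervalIntegral.integral_congr (g := fun _ => 0), intervalIntegral.integral_zero]
    intro x hx
    rw [uIcc_of_le (by linarith)] at hx
    simp [hside (x, d) ⟨⟨hx.1, hcd⟩, ⟨hx.2, le_rfl⟩⟩ (by simp)]
  have e2 : ∫ y in c..d, X (graphMap b p h (a, y)) (b 0) = 0 := by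
    rw [intervalIntegral.integral_congr (g := fun _ => 0), intervalIntegral.integral_zero]
    intro x hx
    rw [uIcc_of_le hcd] at hx
    simp [hside (a, x) ⟨⟨by simpa using ha, hx.1⟩, ⟨le_rfl, hx.2⟩⟩ (by simp)]
  have e3 : ∫ y in c..d, X (graphMap b p h (-a, y)) (b 0) = 0 := by
    rw [intervalIntegral.integral_congr (g := fun _ => 0), intervalIntegral.integral_zero]
    intro x hx
    rw [uIcc_of_le hcd] at hx
    simp [hside (-a, x) ⟨⟨le_rfl, hx.1⟩, ⟨by simpa using ha, hx.2⟩⟩ (by simp)]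
  rw [e1, e2, e3]
  simp

end Divergence


/-! ### Green's identity for a function of a solution. -/

section Green

variable {b : OrthonormalBasis (Fin 2) ℝ Plane} {p : Plane} {h : ℝ → ℝ}

/-- The covector field `f(w) dψ - ψ d(f(w))`. -/
noncomputable def greenField (f : ℝ → ℝ) (w ψ : Plane → ℝ) (y : Plane) : Plane →L[ℝ] ℝ :=
  f (w y) • fderiv ℝ ψ y - (ψ y * deriv f (w y)) • fderiv ℝ w y

/-- The divergence of `greenField f w ψ`. -/
noncomputable def greenDiv (b : OrthonormalBasis (Fin 2) ℝ Plane) (f : ℝ → ℝ) (w ψ : Plane → ℝ)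
    (y : Plane) : ℝ :=
  f (w y) * (Δ ψ) y - ψ y * (deriv f (w y) * (Δ w) y +
    deriv (deriv f) (w y) * ∑ i, (fderiv ℝ w y (b i)) ^ 2)

theorem ContDiff.deriv_one {f : ℝ → ℝ} (hf : ContDiff ℝ 2 f) : ContDiff ℝ 1 (deriv f) := by
  have : ContDiff ℝ (1 + 1) f := by norm_num; exact hf
  exact (contDiff_succ_iff_deriv.1 this).2.2

theorem contDiffOn_greenField {f : ℝ → ℝ} (hf : ContDiff ℝ 2 f) {w ψ : Plane → ℝ} {U : Set Plane}
    (hU : IsOpen U) (hw : ContDiffOn ℝ 2 w U) (hψ : ContDiff ℝ 2 ψ) :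
    ContDiffOn ℝ 1 (greenField f w ψ) U := by
  have h1 : ContDiffOn ℝ 1 (fun y => f (w y)) U :=
    (hf.comp_contDiffOn hw).of_le (by norm_num)
  have h2 : ContDiffOn ℝ 1 (fun y => deriv f (w y)) U :=
    hf.deriv_one.comp_contDiffOn (hw.of_le (by norm_num))
  exact (h1.smul (hψ.fderiv_right (m := 1) (by norm_num)).contDiffOn).sub
    ((((hψ.of_le (by norm_num)).contDiffOn).mul h2).smul
      (hw.fderiv_of_isOpen hU (by norm_num)))

/-- The mixed terms `f'(w) ⟨∇w, ∇ψ⟩` from the two halves of the field cancel. The second derivative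
of `f` survives only as `-ψ f''(w) |∇w|²`, which has a sign when `f` is convex and `ψ ≥ 0`. -/
theorem sum_fderiv_greenField {f : ℝ → ℝ} (hf : ContDiff ℝ 2 f) {w ψ : Plane → ℝ} {y : Plane}
    (hw : ContDiffAt ℝ 2 w y) (hψ : ContDiff ℝ 2 ψ) :
    ∑ i, fderiv ℝ (greenField f w ψ) y (b i) (b i) = greenDiv b f w ψ y := by
  have hw1 := (hw.differentiableAt (by norm_num)).hasFDerivAt
  have hψ1 := ((hψ.differentiable (by norm_num)) y).hasFDerivAt
  have hw2 := hw.differentiableAt_fderiv.hasFDerivAt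
  have hψ2 := hψ.contDiffAt.differentiableAt_fderiv (x := y) |>.hasFDerivAt
  have hf1 := ((hf.differentiable (by norm_num)) (w y)).hasDerivAt
  have hf2 := ((hf.deriv_one.differentiable (by norm_num)) (w y)).hasDerivAt
  have key := ((hf1.comp_hasFDerivAt y hw1).smul hψ2).sub
    ((hψ1.mul (hf2.comp_hasFDerivAt y hw1)).smul hw2)
  have e : fderiv ℝ (greenField f w ψ) y = _ := key.fderiv
  rw [e, greenDiv, laplacian_eq_sum_fderiv_fderiv b, laplacian_eq_sum_fderiv_fderiv b]
  simp [Fin.sum_univ_two]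
  ring

/-- Green's identity above a graph. -/
theorem integral_greenDiv_graphMap (hh : ContDiff ℝ 2 h) {U : Set Plane} (hU : IsOpen U)
    {f : ℝ → ℝ} (hf : ContDiff ℝ 2 f) {w ψ : Plane → ℝ} (hw : ContDiffOn ℝ 2 w U)
    (hψ : ContDiff ℝ 2 ψ) {a c d : ℝ} (ha : 0 ≤ a) (hcd : c ≤ d)
    (hbox : ∀ z ∈ Icc (-a, c) (a, d), graphMap b p h z ∈ U)
    (hside : ∀ z ∈ Icc (-a, c) (a, d), z.1 = -a ∨ z.1 = a ∨ z.2 = d →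
      graphMap b p h z ∉ tsupport ψ) :
    ∫ z in Icc (-a, c) (a, d), greenDiv b f w ψ (graphMap b p h z) =
      -∫ x in (-a)..a, greenField f w ψ (graphMap b p h (x, c)) (b 1 - deriv h x • b 0) := by
  rw [← integral_div_graphMap hh hU (contDiffOn_greenField hf hU hw hψ) ha hcd hbox]
  · refine setIntegral_congr_fun measurableSet_Icc fun z hz => ?_
    exact (sum_fderiv_greenField hf (hw.contDiffAt (hU.mem_nhds (hbox z hz))) hψ).symm
  · intro z hz hz'
    have h1 := hside z hz hz'
    rw [notMem_tsupport_iff_eventuallyEq] at h1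
    have h2 : fderiv ℝ ψ (graphMap b p h z) = 0 := by
      rw [h1.fderiv_eq]; simp
    simp [greenField, h1.eq_of_nhds, h2]

end Green

/-! ### The straightening map as a measure preserving homeomorphism. -/

section Coordinates

variable {b : OrthonormalBasis (Fin 2) ℝ Plane} {p : Plane} {h : ℝ → ℝ}

/-- The inverse of `graphMap b p h`. -/
noncomputable def graphCoord (b : OrthonormalBasis (Fin 2) ℝ Plane) (p : Plane) (h : ℝ → ℝ)
    (y : Plane) : ℝ × ℝ :=
  (⟪b 0, y - p⟫, ⟪b 1, y - p⟫ - h ⟪b 0, y - p⟫)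

theorem graphCoord_graphMap (z : ℝ × ℝ) : graphCoord b p h (graphMap b p h z) = z := by
  have h0 : ⟪b 0, b 0⟫ = 1 := by simp
  have h1 : ⟪b 1, b 1⟫ = 1 := by simp
  have h01 : ⟪b 0, b 1⟫ = 0 := b.orthonormal.2 (by decide)
  have h10 : ⟪b 1, b 0⟫ = 0 := b.orthonormal.2 (by decide)
  ext <;> simp only [graphCoord, graphMap, frameMap, add_sub_cancel_left, inner_add_right,
    inner_smul_right, h0, h1, h01, h10] <;> simp

theorem graphMap_graphCoord (y : Plane) : graphMap b p h (graphCoord b p h y) = y := by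
  simp only [graphCoord, graphMap, frameMap]
  have := b.sum_repr' (y - p)
  rw [Fin.sum_univ_two] at this
  simp only [add_sub_cancel]
  rw [this]
  simp

theorem continuous_graphCoord (hh : Continuous h) : Continuous (graphCoord b p h) := by
  unfold graphCoord
  fun_prop

theorem graphMap_injective : Function.Injective (graphMap b p h) :=
  Function.LeftInverse.injective graphCoord_graphMap

/-- `graphMap` as a homeomorphism. -/
noncomputable def graphHomeomorph (b : OrthonormalBasis (Fin 2) ℝ Plane) (p : Plane) {h : ℝ → ℝ}
    (hh : ContDiff ℝ 2 h) : (ℝ × ℝ) ≃ₜ Plane where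
  toFun := graphMap b p h
  invFun := graphCoord b p h
  left_inv := graphCoord_graphMap
  right_inv := graphMap_graphCoord
  continuous_toFun := hh.graphMap.continuous
  continuous_invFun := continuous_graphCoord hh.continuous

theorem measurePreserving_frameMap : MeasurePreserving (frameMap b p) := by
  have h1 := (volume_preserving_finTwoArrow ℝ).symm
  have h3 := b.measurePreserving_repr_symm
  have h4 := measurePreserving_add_left (volume : Measure Plane) p
  have e : frameMap b p = (fun x => p + x) ∘ (b.repr.symm ∘
      (WithLp.toLp 2 ∘ (MeasurableEquiv.finTwoArrow (α := ℝ)).symm)) := by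
    ext1 z
    simp only [Function.comp_apply, frameMap, ← b.sum_repr_symm, Fin.sum_univ_two]
    rfl
  rw [e]
  exact h4.comp (h3.comp ((PiLp.volume_preserving_toLp (Fin 2)).comp h1))

/-- A shear translates each vertical line, so it is a skew product of measure preserving maps; the
frame map that follows is an isometry. -/
theorem measurePreserving_graphMap (hh : Continuous h) : MeasurePreserving (graphMap b p h) := by
  have h1 : MeasurePreserving (fun z : ℝ × ℝ => (z.1, h z.1 + z.2))
      (volume.prod volume) (volume.prod volume) :=
    (MeasurePreserving.id volume).skew_product (by fun_prop)
      (ae_of_all _ fun x => (measurePreserving_add_left volume (h x)).map_eq)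
  exact measurePreserving_frameMap.comp h1

end Coordinates


/-! ### Boundary charts from a defining function. -/

section Chart

/-- In the coordinates `graphMap b p h`, the set `𝒪` is the lower part of the box
`[-a, a] × [-r, r]`. -/
structure IsGraphChart (𝒪 : Set Plane) (b : OrthonormalBasis (Fin 2) ℝ Plane) (p : Plane)
    (h : ℝ → ℝ) (a r : ℝ) : Prop where
  contDiff : ContDiff ℝ 2 h
  a_pos : 0 < a
  r_pos : 0 < r
  mem_iff : ∀ z : ℝ × ℝ, |z.1| ≤ a → |z.2| ≤ r → (graphMap b p h z ∈ 𝒪 ↔ z.2 < 0)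

/-- Multiply by a bump function supported where `f` is smooth. This makes the implicit function,
which is regular only near the origin, into a function on the whole line, so that graph coordinates
are global. -/
theorem exists_contDiff_eventuallyEq {E F : Type*} [NormedAddCommGroup E] [NormedSpace ℝ E]
    [HasContDiffBump E] [NormedAddCommGroup F] [NormedSpace ℝ F] {f : E → F} {x : E} {n : ℕ}
    (hf : ContDiffAt ℝ n f x) : ∃ g : E → F, ContDiff ℝ n g ∧ g =ᶠ[𝓝 x] f := by
  obtain ⟨s, hs, hfs⟩ := Metric.eventually_nhds_iff_ball.1 (hf.eventually (by simp))
  let η : ContDiffBump x := ⟨s / 4, s / 2, by positivity, by linarith⟩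
  refine ⟨fun y => η y • f y, ?_, ?_⟩
  · rw [contDiff_iff_contDiffAt]
    intro y
    by_cases hy : y ∈ Metric.ball x s
    · exact η.contDiff.contDiffAt.smul (hfs y hy)
    · have hy' : y ∉ tsupport η := fun hy' => hy (by
        rw [η.tsupport_eq] at hy'
        exact Metric.closedBall_subset_ball (by simp only [η]; linarith) hy')
      refine contDiffAt_const (c := (0 : F)).congr_of_eventuallyEq ?_
      filter_upwards [notMem_tsupport_iff_eventuallyEq.1 hy'] with z hz
      simp [hz]
  · filter_upwards [η.eventuallyEq_one] with y hy
    simp [hy]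

/-- A boundary point is outside the open set `𝒪`, hence `ρ ≥ 0` there; if `ρ` were positive it would
be so nearby, and `𝒪` could not accumulate at the point. -/
theorem IsLocalDefiningFunction.eq_zero {𝒪 U : Set Plane} {x y : Plane} {ρ : Plane → ℝ}
    (hρ : IsLocalDefiningFunction 𝒪 x U ρ) (hO : IsOpen 𝒪) (hy : y ∈ U) (hyf : y ∈ frontier 𝒪) :
    ρ y = 0 := by
  have h1 : y ∉ 𝒪 := fun h => by
    rw [hO.frontier_eq] at hyf; exact hyf.2 h
  have h2 : 0 ≤ ρ y := not_lt.1 fun h => h1 ((hρ.mem_iff y hy).2 h)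
  refine le_antisymm (not_lt.1 fun h => ?_) h2
  have h3 : ∀ᶠ z in 𝓝 y, 0 < ρ z ∧ z ∈ U :=
    (((hρ.contDiffOn.continuousOn.continuousAt (hρ.isOpen.mem_nhds hy)).eventually
      (lt_mem_nhds h))).and (hρ.isOpen.mem_nhds hy)
  obtain ⟨z, hz, hz'⟩ := (mem_closure_iff_frequently.1 hyf.1).and_eventually h3 |>.exists
  exact absurd ((hρ.mem_iff z hz'.2).1 hz) (not_lt.2 hz'.1.le)

/-- Take the second axis along the gradient of `ρ`. The implicit function theorem writes `ρ = 0` as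
a graph, and `ρ` is strictly increasing along that axis in a small box, so its sign is the sign of
the height above the graph. -/
theorem exists_isGraphChart {𝒪 U : Set Plane} {p : Plane} {ρ : Plane → ℝ}
    (hO : IsOpen 𝒪) (hp : p ∈ frontier 𝒪) (hρ : IsLocalDefiningFunction 𝒪 p U ρ) :
    ∃ b h a r, IsGraphChart 𝒪 b p h a r ∧ h 0 = 0 ∧
      ∀ z : ℝ × ℝ, |z.1| ≤ a → |z.2| ≤ r → graphMap b p h z ∈ U := by
  have hU := hρ.isOpen
  have hg : gradient ρ p ≠ 0 := hρ.gradient_ne_zero p hρ.mem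
  have hρc : ContDiffOn ℝ 2 ρ U := hρ.contDiffOn.of_le (WithTop.coe_le_coe.2 (le_top : (2 : ℕ∞) ≤ ⊤))
  have hp0 : ρ p = 0 := hρ.eq_zero hO hρ.mem hp
  -- the frame
  obtain ⟨b, hb⟩ : ∃ b : OrthonormalBasis (Fin 2) ℝ Plane,
      b 1 = (‖gradient ρ p‖)⁻¹ • gradient ρ p := by
    obtain ⟨b, hb⟩ := Orthonormal.exists_orthonormalBasis_extension_of_card_eq (𝕜 := ℝ)
      (E := Plane) (ι := Fin 2) (by simp) (v := fun _ => (‖gradient ρ p‖)⁻¹ • gradient ρ p)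
      (s := {1}) (by
        refine ⟨fun i => ?_, fun i j hij => (hij (Subsingleton.elim i j)).elim⟩
        simp [norm_smul, hg])
    exact ⟨b, hb 1 rfl⟩
  set R : ℝ × ℝ → ℝ := fun z => ρ (frameMap b p z) with hR
  have hfr0 : frameMap b p 0 = p := by simp [frameMap]
  have hRc : ContDiffOn ℝ 2 R (frameMap b p ⁻¹' U) :=
    hρc.comp contDiff_frameMap.contDiffOn fun _ h => h
  have hU' : IsOpen (frameMap b p ⁻¹' U) :=
    hU.preimage (contDiff_frameMap (n := 0)).continuous
  have h0U' : (0 : ℝ × ℝ) ∈ frameMap b p ⁻¹' U := by simp [hfr0, hρ.mem]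
  have hRc0 : ContDiffAt ℝ 2 R 0 := hRc.contDiffAt (hU'.mem_nhds h0U')
  have hdR : ∀ z ∈ frameMap b p ⁻¹' U, ∀ v : ℝ × ℝ,
      fderiv ℝ R z v = fderiv ℝ ρ (frameMap b p z) (v.1 • b 0 + v.2 • b 1) := by
    intro z hz v
    have h1 : HasFDerivAt (frameMap b p) ((ContinuousLinearMap.fst ℝ ℝ ℝ).smulRight (b 0) +
        (ContinuousLinearMap.snd ℝ ℝ ℝ).smulRight (b 1)) z :=
      ((hasFDerivAt_fst.smul_const (b 0)).add (hasFDerivAt_snd.smul_const (b 1))).const_add p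
    have h2 := ((hρc.contDiffAt (hU.mem_nhds hz)).differentiableAt (by norm_num)).hasFDerivAt
    have h3 : fderiv ℝ R z = _ := (h2.comp z h1).fderiv
    rw [h3]
    simp
  have hpos : 0 < fderiv ℝ R 0 (0, 1) := by
    rw [hdR 0 h0U', hfr0]
    have : fderiv ℝ ρ p (b 1) = ‖gradient ρ p‖ := by
      rw [← inner_gradient_left, hb, inner_smul_right, real_inner_self_eq_norm_sq]
      have : ‖gradient ρ p‖ ≠ 0 := norm_ne_zero_iff.2 hg
      field_simp
    simp only [zero_smul, one_smul, zero_add, this]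
    exact norm_pos_iff.2 hg
  have hinv : (fderiv ℝ R 0 ∘L .inr ℝ ℝ ℝ).IsInvertible := by
    refine ⟨ContinuousLinearEquiv.unitsEquivAut ℝ (Units.mk0 _ hpos.ne'), ?_⟩
    ext
    simp
  have hn : (2 : WithTop ℕ∞) ≠ 0 := by norm_num
  set h0 := hRc0.implicitFunction hn hinv with hh0
  have hh0c : ContDiffAt ℝ 2 h0 0 := hRc0.contDiffAt_implicitFunction hn hinv
  have hh00 : h0 0 = 0 := hRc0.implicitFunction_apply_self hn hinv
  have hh0e : ∀ᶠ x in 𝓝 (0 : ℝ), R (x, h0 x) = R 0 :=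
    hRc0.eventually_apply_implicitFunction hn hinv
  obtain ⟨h, hhc, hhe⟩ := exists_contDiff_eventuallyEq (n := 2) (by exact_mod_cast hh0c)
  have hR0 : R 0 = 0 := by simp [hR, hfr0, hp0]
  have hh0' : h 0 = 0 := by rw [hhe.eq_of_nhds, hh00]
  have hhR : ∀ᶠ x in 𝓝 (0 : ℝ), R (x, h x) = 0 := by
    filter_upwards [hh0e, hhe] with x h1 h2
    rw [h2, h1, hR0]
  -- positivity of the vertical derivative near the origin
  have hposn : ∀ᶠ z in 𝓝 (0 : ℝ × ℝ), z ∈ frameMap b p ⁻¹' U ∧ 0 < fderiv ℝ R z (0, 1) := by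
    refine Filter.Eventually.and (hU'.mem_nhds h0U') ?_
    have : ContinuousAt (fun z => fderiv ℝ R z (0, 1)) 0 :=
      (hRc0.fderiv_right (m := 1) (by norm_num)).continuousAt.clm_apply continuousAt_const
    exact this.eventually (lt_mem_nhds hpos)
  obtain ⟨s, hs, hball⟩ := Metric.eventually_nhds_iff_ball.1 hposn
  have hcont : ∀ᶠ x in 𝓝 (0 : ℝ), |h x| < s / 2 := by
    have : ContinuousAt (fun x => |h x|) 0 := (continuous_abs.comp hhc.continuous).continuousAt
    refine this.eventually (gt_mem_nhds ?_)
    simp [hh0', hs]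
  obtain ⟨a0, ha0, hball'⟩ := Metric.eventually_nhds_iff_ball.1 (hhR.and hcont)
  have ha : 0 < min (a0 / 2) (s / 2) := by positivity
  -- The vertical coordinate is at most `|h x| + |y| < s/2 + s/4`, so the whole box stays in the
  -- ball where the vertical derivative of `R` is positive.
  have hin : ∀ x y : ℝ, |x| ≤ min (a0 / 2) (s / 2) → |y| ≤ s / 4 →
      (x, h x + y) ∈ Metric.ball (0 : ℝ × ℝ) s := by
    intro x y hx hy
    have h1 := (hball' x (by
      rw [Metric.mem_ball, dist_zero_right, Real.norm_eq_abs]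
      have := hx.trans (min_le_left _ _); linarith)).2
    have h2 := hx.trans (min_le_right _ _)
    rw [Metric.mem_ball, dist_zero_right, Prod.norm_mk, max_lt_iff, Real.norm_eq_abs,
      Real.norm_eq_abs]
    exact ⟨by linarith, (abs_add_le _ _).trans_lt (by linarith)⟩
  refine ⟨b, h, min (a0 / 2) (s / 2), s / 4, ⟨by exact_mod_cast hhc, ha, by positivity, ?_⟩, hh0',
    fun z h1 h2 => (hball _ (hin z.1 z.2 h1 h2)).1⟩
  rintro ⟨x, t⟩ hx ht
  simp only at hx ht ⊢
  have hmem := (hball _ (hin x t hx ht)).1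
  rw [graphMap, hρ.mem_iff _ hmem]
  have hmono : StrictMonoOn (fun y => R (x, h x + y)) (Icc (-(s / 4)) (s / 4)) := by
    have hder : ∀ y ∈ Icc (-(s / 4)) (s / 4), HasDerivAt (fun y => R (x, h x + y))
        (fderiv ℝ R (x, h x + y) (0, 1)) y := by
      intro y hy
      have h1 := (hball _ (hin x y hx (abs_le.2 hy))).1
      have h2 := ((hRc.contDiffAt (hU'.mem_nhds h1)).differentiableAt (by norm_num)).hasFDerivAt
      have h3 : HasDerivAt (fun y : ℝ => (x, h x + y)) ((0 : ℝ), (1 : ℝ)) y :=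
        (hasDerivAt_const y x).prodMk ((hasDerivAt_id y).const_add (h x))
      exact h2.comp_hasDerivAt y h3
    refine strictMonoOn_of_deriv_pos (convex_Icc _ _)
      (fun y hy => (hder y hy).continuousAt.continuousWithinAt) fun y hy => ?_
    rw [interior_Icc] at hy
    rw [(hder y (Ioo_subset_Icc_self hy)).deriv]
    exact (hball _ (hin x y hx (abs_le.2 (Ioo_subset_Icc_self hy)))).2
  have hx0 : R (x, h x + 0) = 0 := by
    rw [add_zero]
    refine (hball' x ?_).1
    rw [Metric.mem_ball, dist_zero_right, Real.norm_eq_abs]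
    have := hx.trans (min_le_left _ _); linarith
  have := hmono.lt_iff_lt (abs_le.1 ht) (b := 0) ⟨by linarith, by linarith⟩
  simp only [hx0] at this
  exact this

end Chart


/-! ### Exterior, frontier, one-sided derivatives and normals in a chart. -/

section ChartConsequences

/-- The image under `graphMap b p h` of the open box `(-a, a) × (-r, r)`. -/
def chartBox (b : OrthonormalBasis (Fin 2) ℝ Plane) (p : Plane) (h : ℝ → ℝ) (a r : ℝ) :
    Set Plane :=
  graphCoord b p h ⁻¹' (Ioo (-a) a ×ˢ Ioo (-r) r)

variable {𝒪 : Set Plane} {b : OrthonormalBasis (Fin 2) ℝ Plane} {p : Plane} {h : ℝ → ℝ} {a r : ℝ}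

theorem graphMap_mem_chartBox {z : ℝ × ℝ} :
    graphMap b p h z ∈ chartBox b p h a r ↔ |z.1| < a ∧ |z.2| < r := by
  rw [chartBox, mem_preimage, graphCoord_graphMap, abs_lt, abs_lt]
  rfl

namespace IsGraphChart

theorem isOpen_chartBox (hc : IsGraphChart 𝒪 b p h a r) : IsOpen (chartBox b p h a r) :=
  (isOpen_Ioo.prod isOpen_Ioo).preimage (continuous_graphCoord hc.contDiff.continuous)

theorem graphMap_mem_compl (hc : IsGraphChart 𝒪 b p h a r) {z : ℝ × ℝ} (h1 : |z.1| ≤ a)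
    (h2 : 0 ≤ z.2) (h3 : z.2 ≤ r) : graphMap b p h z ∈ 𝒪ᶜ := by
  rw [mem_compl_iff, hc.mem_iff z h1 (abs_le.2 ⟨by linarith [hc.r_pos], h3⟩)]
  linarith

theorem graphMap_mem_exterior (hc : IsGraphChart 𝒪 b p h a r) {z : ℝ × ℝ} (h1 : |z.1| < a)
    (h2 : 0 < z.2) (h3 : z.2 < r) : graphMap b p h z ∈ (closure 𝒪)ᶜ := by
  rw [← interior_compl, mem_interior]
  refine ⟨graphCoord b p h ⁻¹' (Ioo (-a) a ×ˢ Ioo 0 r), fun y hy => ?_,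
    (isOpen_Ioo.prod isOpen_Ioo).preimage (continuous_graphCoord hc.contDiff.continuous), ?_⟩
  · rw [← graphMap_graphCoord (b := b) (p := p) (h := h) y]
    exact hc.graphMap_mem_compl (abs_le.2 ⟨hy.1.1.le, hy.1.2.le⟩) hy.2.1.le hy.2.2.le
  · rw [mem_preimage, graphCoord_graphMap]
    exact ⟨abs_lt.1 h1, h2, h3⟩

theorem graphMap_mem_frontier (hc : IsGraphChart 𝒪 b p h a r) (hO : IsOpen 𝒪) {x : ℝ}
    (hx : |x| < a) : graphMap b p h (x, 0) ∈ frontier 𝒪 := by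
  rw [hO.frontier_eq]
  refine ⟨?_, hc.graphMap_mem_compl hx.le le_rfl hc.r_pos.le⟩
  have hcont : Continuous fun t : ℝ => graphMap b p h (x, t) :=
    hc.contDiff.graphMap.continuous.comp (by fun_prop)
  refine mem_closure_of_tendsto (b := 𝓝[<] (0 : ℝ))
    (hcont.continuousAt.tendsto.mono_left nhdsWithin_le_nhds) ?_
  have h1 : ∀ᶠ t in 𝓝[<] (0 : ℝ), t ∈ Ioo (-r) 0 := Ioo_mem_nhdsLT (by linarith [hc.r_pos])
  filter_upwards [h1] with t ht
  exact (hc.mem_iff (x, t) hx.le (abs_le.2 ⟨ht.1.le, by linarith [hc.r_pos, ht.2]⟩)).2 ht.2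

theorem graphMap_mem_frontier_iff (hc : IsGraphChart 𝒪 b p h a r) (hO : IsOpen 𝒪) {z : ℝ × ℝ}
    (h1 : |z.1| < a) (h2 : |z.2| < r) : graphMap b p h z ∈ frontier 𝒪 ↔ z.2 = 0 := by
  refine ⟨fun hz => ?_, fun hz => ?_⟩
  · rcases lt_trichotomy z.2 0 with h3 | h3 | h3
    · rw [hO.frontier_eq] at hz
      exact absurd ((hc.mem_iff z h1.le h2.le).2 h3) hz.2
    · exact h3
    · exact absurd hz.1 (hc.graphMap_mem_exterior h1 h3 (abs_lt.1 h2).2)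
  · have : z = (z.1, 0) := by ext <;> simp [hz]
    rw [this]
    exact hc.graphMap_mem_frontier hO h1

theorem image_box (hc : IsGraphChart 𝒪 b p h a r) :
    graphMap b p h '' (Ioo (-a) a ×ˢ Ico 0 r) = chartBox b p h a r ∩ 𝒪ᶜ := by
  ext y
  constructor
  · rintro ⟨z, ⟨h1, h2⟩, rfl⟩
    exact ⟨graphMap_mem_chartBox.2 ⟨abs_lt.2 h1, abs_lt.2 ⟨by linarith [h2.1, hc.r_pos], h2.2⟩⟩,
      hc.graphMap_mem_compl (abs_lt.2 h1).le h2.1 h2.2.le⟩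
  · rintro ⟨h1, h2⟩
    refine ⟨graphCoord b p h y, ⟨h1.1, ?_, h1.2.2⟩, graphMap_graphCoord y⟩
    have h3 := hc.mem_iff (graphCoord b p h y) (abs_lt.2 h1.1).le (abs_lt.2 h1.2).le
    rw [graphMap_graphCoord] at h3
    exact not_lt.1 fun h4 => h2 (h3.2 h4)

/-- In coordinates the set is a half-open box, and the straightening map has surjective derivative.
Hence the derivative from the exterior is well determined on the boundary, and it is continuous up
to the boundary for `C¹` functions. -/
theorem uniqueDiffOn (hc : IsGraphChart 𝒪 b p h a r) :
    UniqueDiffOn ℝ (chartBox b p h a r ∩ 𝒪ᶜ) := by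
  rw [← hc.image_box]
  rintro _ ⟨z, hz, rfl⟩
  refine (hasFDerivAt_graphMap (hc.contDiff.differentiable (by norm_num)) z).hasFDerivWithinAt
    |>.uniqueDiffWithinAt ((isOpen_Ioo.uniqueDiffOn.prod (uniqueDiffOn_Ico 0 r)) z hz) ?_
  refine Function.Surjective.denseRange fun v => ?_
  refine ⟨(⟪b 0, v⟫, ⟪b 1, v⟫ - deriv h z.1 * ⟪b 0, v⟫), ?_⟩
  have := b.sum_repr' v
  rw [Fin.sum_univ_two] at this
  conv_rhs => rw [← this]
  simp only [add_apply, ContinuousLinearMap.smulRight_apply,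
    ContinuousLinearMap.coe_fst', ContinuousLinearMap.coe_snd']
  module

theorem fderivWithin_inter (hc : IsGraphChart 𝒪 b p h a r) {F : Type*} [NormedAddCommGroup F]
    [NormedSpace ℝ F] (w : Plane → F) {y : Plane} (hy : y ∈ chartBox b p h a r) :
    fderivWithin ℝ w (chartBox b p h a r ∩ 𝒪ᶜ) y = fderivWithin ℝ w 𝒪ᶜ y := by
  rw [inter_comm]
  exact _root_.fderivWithin_inter (hc.isOpen_chartBox.mem_nhds hy)

theorem uniqueDiffWithinAt (hc : IsGraphChart 𝒪 b p h a r) {y : Plane}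
    (hy : y ∈ chartBox b p h a r) (hy' : y ∈ 𝒪ᶜ) : UniqueDiffWithinAt ℝ 𝒪ᶜ y :=
  (hc.uniqueDiffOn y ⟨hy, hy'⟩).mono inter_subset_right

theorem continuousOn_fderivWithin (hc : IsGraphChart 𝒪 b p h a r) {F : Type*}
    [NormedAddCommGroup F] [NormedSpace ℝ F] {w : Plane → F}
    (hw : ContDiffOn ℝ 1 w (chartBox b p h a r ∩ 𝒪ᶜ)) :
    ContinuousOn (fderivWithin ℝ w 𝒪ᶜ) (chartBox b p h a r ∩ 𝒪ᶜ) :=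
  (hw.continuousOn_fderivWithin hc.uniqueDiffOn le_rfl).congr fun _ hy =>
    (hc.fderivWithin_inter w hy.1).symm

/-- Any defining function vanishes along the graph, so its gradient is orthogonal to the tangent `b
0 + h' b 1`; it is negative below the graph, so the gradient is a positive multiple of `b 1 - h' b
0`. The outward normal is therefore independent of the defining function. -/
theorem eq_of_isOutwardUnitNormal (hc : IsGraphChart 𝒪 b p h a r) (hO : IsOpen 𝒪) {x : ℝ}
    (hx : |x| < a) {n : Plane} (hn : IsOutwardUnitNormal 𝒪 (graphMap b p h (x, 0)) n) :
    n = (√(1 + deriv h x ^ 2))⁻¹ • (b 1 - deriv h x • b 0) := by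
  obtain ⟨_, U, ρ, hρ, rfl⟩ := hn
  set y := graphMap b p h (x, 0) with hy
  have hd := (hρ.contDiffOn.contDiffAt (hρ.isOpen.mem_nhds hρ.mem)).differentiableAt
    (by simp) |>.hasFDerivAt
  have hd' := hd.comp (x, (0 : ℝ))
    (hasFDerivAt_graphMap (b := b) (p := p) (hc.contDiff.differentiable (by norm_num)) (x, 0))
  set α := fderiv ℝ ρ y (b 1) with hα
  have hcont := hc.contDiff.graphMap (b := b) (p := p) |>.continuous
  have hnear : ∀ᶠ z in 𝓝 (x, (0 : ℝ)), graphMap b p h z ∈ U :=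
    hcont.continuousAt (hρ.isOpen.mem_nhds hρ.mem)
  have htan : fderiv ℝ ρ y (b 0 + deriv h x • b 1) = 0 := by
    have h1 : HasDerivAt (fun x' : ℝ => (x', (0 : ℝ))) ((1 : ℝ), (0 : ℝ)) x :=
      (hasDerivAt_id x).prodMk (hasDerivAt_const x 0)
    have h2 := hd'.comp_hasDerivAt x h1
    have h3 : (fun x' : ℝ => ρ (graphMap b p h (x', 0))) =ᶠ[𝓝 x] fun _ => 0 := by
      have e1 : ∀ᶠ x' in 𝓝 x, |x'| < a := (continuous_abs.continuousAt).eventually (gt_mem_nhds hx)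
      have e2 : ContinuousAt (fun x' : ℝ => (x', (0 : ℝ))) x := h1.continuousAt
      filter_upwards [e1, e2.eventually hnear] with x' h4 h5
      exact hρ.eq_zero hO h5 (hc.graphMap_mem_frontier hO h4)
    have h4 := (hasDerivAt_const x (0 : ℝ)).congr_of_eventuallyEq h3
    have := h2.unique h4
    simpa using this
  have hα0 : 0 ≤ α := by
    have h1 : HasDerivAt (fun t : ℝ => (x, t)) ((0 : ℝ), (1 : ℝ)) 0 :=
      (hasDerivAt_const 0 x).prodMk (hasDerivAt_id 0)
    have h2 : HasDerivAt (fun t : ℝ => ρ (graphMap b p h (x, t))) α 0 := by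
      refine (hd'.comp_hasDerivAt 0 h1).congr_deriv ?_
      simp [hα]
    have h3 := (hasDerivAt_iff_tendsto_slope.1 h2).mono_left
      (nhdsWithin_mono (0 : ℝ)
      (fun t (ht : t ∈ Iio (0 : ℝ)) => (mem_Iio.1 ht).ne : Iio (0 : ℝ) ⊆ {0}ᶜ))
    refine ge_of_tendsto h3 ?_
    have e1 : ∀ᶠ t in 𝓝[<] (0 : ℝ), t ∈ Ioo (-r) 0 := Ioo_mem_nhdsLT (by linarith [hc.r_pos])
    have e2 := (h1.continuousAt.eventually hnear).filter_mono (nhdsWithin_le_nhds (s := Iio 0))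
    filter_upwards [e1, e2] with t ht ht'
    have h4 := (hρ.mem_iff _ ht').1 ((hc.mem_iff (x, t) hx.le
      (abs_le.2 ⟨ht.1.le, by linarith [hc.r_pos, ht.2]⟩)).2 ht.2)
    have h5 : ρ (graphMap b p h (x, 0)) = 0 := hρ.eq_zero hO hρ.mem (hc.graphMap_mem_frontier hO hx)
    rw [slope_def_field, h5, sub_zero, sub_zero]
    exact div_nonneg_of_nonpos h4.le ht.2.le
  have hg : gradient ρ y = α • (b 1 - deriv h x • b 0) := by
    have h0 : ⟪b 0, gradient ρ y⟫ = fderiv ℝ ρ y (b 0) := inner_gradient_right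
    have h1 : ⟪b 1, gradient ρ y⟫ = fderiv ℝ ρ y (b 1) := inner_gradient_right
    have := b.sum_repr' (gradient ρ y)
    rw [Fin.sum_univ_two, h0, h1] at this
    rw [← this]
    have h2 : fderiv ℝ ρ y (b 0) = -(deriv h x * α) := by
      simp only [map_add, map_smul, smul_eq_mul] at htan
      linarith
    rw [h2]
    module
  have hne := hρ.gradient_ne_zero y hρ.mem
  have hαpos : 0 < α := lt_of_le_of_ne hα0 fun h0 => hne (by rw [hg, ← h0, zero_smul])
  have hN : ‖b 1 - deriv h x • b 0‖ = √(1 + deriv h x ^ 2) := by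
    rw [norm_eq_sqrt_real_inner]
    congr 1
    have h0 : ⟪b 0, b 0⟫ = 1 := by simp
    have h1 : ⟪b 1, b 1⟫ = 1 := by simp
    have h01 : ⟪b 0, b 1⟫ = 0 := b.orthonormal.2 (by decide)
    have h10 : ⟪b 1, b 0⟫ = 0 := b.orthonormal.2 (by decide)
    simp only [inner_sub_left, inner_sub_right, inner_smul_left, inner_smul_right, h0, h1, h01,
      h10]
    simp
    ring
  rw [hg, norm_smul, hN, Real.norm_of_nonneg hαpos.le, smul_smul]
  congr 1
  field_simp

end IsGraphChart

end ChartConsequences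


/-! ### One-dimensional Hausdorff measure along a regular curve. -/

section ArcLength

/-- Countably many of the neighbourhoods cover the space; make them disjoint and use countable
additivity. -/
theorem measure_le_of_locally_le {X : Type*} [TopologicalSpace X] [SecondCountableTopology X]
    [MeasurableSpace X] [OpensMeasurableSpace X] {μ ν : Measure X}
    (h : ∀ x, ∃ J ∈ 𝓝 x, ∀ B ⊆ J, MeasurableSet B → μ B ≤ ν B) : μ ≤ ν := by
  choose J hJ hB using h
  obtain ⟨s, hs, hsu⟩ := TopologicalSpace.countable_cover_nhds (f := fun x => interior (J x))
    fun x => interior_mem_nhds.2 (hJ x)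
  rcases s.eq_empty_or_nonempty with rfl | hne
  · have : (univ : Set X) = ∅ := by simpa using hsu.symm
    refine Measure.le_iff.2 fun B _ => ?_
    have hBe : B = ∅ := subset_empty_iff.1 (this ▸ subset_univ B)
    simp [hBe]
  obtain ⟨f, rfl⟩ := hs.exists_eq_range hne
  have hcov : ⋃ n, interior (J (f n)) = univ := by simpa using hsu
  have hm : ∀ n, MeasurableSet (disjointed (fun n => interior (J (f n))) n) := fun n =>
    MeasurableSet.disjointed (fun n => isOpen_interior.measurableSet) n
  refine Measure.le_iff.2 fun B hBm => ?_
  have e : B = ⋃ n, B ∩ disjointed (fun n => interior (J (f n))) n := by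
    rw [← inter_iUnion, iUnion_disjointed, hcov, inter_univ]
  have hd : Pairwise (Function.onFun Disjoint
      fun n => B ∩ disjointed (fun n => interior (J (f n))) n) := fun i j hij =>
    ((disjoint_disjointed _) hij).mono inter_subset_right inter_subset_right
  rw [e, measure_iUnion hd fun n => hBm.inter (hm n), measure_iUnion hd fun n => hBm.inter (hm n)]
  refine ENNReal.tsum_le_tsum fun n => hB (f n) _ ?_ (hBm.inter (hm n))
  exact inter_subset_right.trans ((disjointed_subset _ n).trans interior_subset)

/-- By strict differentiability, `γ x - γ y` differs from `(x - y) γ'(t)` by a small multiple of `|x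
- y|`; the multiple is taken below the gaps between `|γ'(t)|` and both bounds. -/
theorem exists_nhds_lipschitz_bounds {E : Type*} [NormedAddCommGroup E] [NormedSpace ℝ E]
    {γ : ℝ → E} (hγ : ContDiff ℝ 1 γ) {t : ℝ} {k₁ k₂ : NNReal}
    (h1 : (k₁ : ℝ) < ‖deriv γ t‖) (h2 : ‖deriv γ t‖ < k₂) :
    ∃ J ∈ 𝓝 t, (∀ x ∈ J, ∀ y ∈ J, k₁ * dist x y ≤ dist (γ x) (γ y) ∧
      dist (γ x) (γ y) ≤ k₂ * dist x y) ∧ ∀ x ∈ J, (k₁ : ℝ) ≤ ‖deriv γ x‖ ∧ ‖deriv γ x‖ ≤ k₂ := by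
  set c := ‖deriv γ t‖
  have hstrict := (hγ.contDiffAt (x := t)).hasStrictDerivAt (by norm_num) |>.hasStrictFDerivAt
  have hδ : 0 < min (c - k₁) (k₂ - c) := lt_min (by linarith) (by linarith)
  obtain ⟨s, hs, happ⟩ := hstrict.approximates_deriv_on_nhds
    (c := ⟨min (c - k₁) (k₂ - c), hδ.le⟩) (Or.inr hδ)
  have hcont : Continuous fun x => ‖deriv γ x‖ := (hγ.continuous_deriv le_rfl).norm
  have hev : ∀ᶠ x in 𝓝 t, (k₁ : ℝ) ≤ ‖deriv γ x‖ ∧ ‖deriv γ x‖ ≤ k₂ :=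
    ((hcont.continuousAt.eventually (lt_mem_nhds h1)).and
      (hcont.continuousAt.eventually (gt_mem_nhds h2))).mono fun x hx => ⟨hx.1.le, hx.2.le⟩
  refine ⟨s ∩ {x | (k₁ : ℝ) ≤ ‖deriv γ x‖ ∧ ‖deriv γ x‖ ≤ k₂}, inter_mem hs hev, ?_,
    fun x hx => hx.2⟩
  intro x hx y hy
  have h3 := happ x hx.1 y hy.1
  simp only [ContinuousLinearMap.toSpanSingleton_apply] at h3
  change ‖γ x - γ y - (x - y) • deriv γ t‖ ≤ min (c - k₁) (k₂ - c) * ‖x - y‖ at h3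
  rw [dist_eq_norm, dist_eq_norm]
  have h4 : ‖(x - y) • deriv γ t‖ = c * ‖x - y‖ := by rw [norm_smul, mul_comm]
  have h5 := norm_sub_norm_le (γ x - γ y) ((x - y) • deriv γ t)
  have h6 := norm_sub_norm_le ((x - y) • deriv γ t) (γ x - γ y)
  rw [norm_sub_rev ((x - y) • deriv γ t)] at h6
  have h7 := mul_le_mul_of_nonneg_right (min_le_left (c - k₁) (k₂ - c)) (norm_nonneg (x - y))
  have h8 := mul_le_mul_of_nonneg_right (min_le_right (c - k₁) (k₂ - c)) (norm_nonneg (x - y))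
  constructor <;> nlinarith

/-- Near each parameter the curve is bi-Lipschitz with constants `k₁ < |γ'| < k₂` of ratio at most
`1 + ε`. On small sets both measures lie between `k₁` and `k₂` times Lebesgue measure, so they agree
locally, hence globally, up to a factor `1 + ε`; then `ε → 0`. -/
theorem comap_hausdorffMeasure_curve {E : Type*} [NormedAddCommGroup E] [NormedSpace ℝ E]
    [MeasurableSpace E] [BorelSpace E] {γ : ℝ → E} (hγ : ContDiff ℝ 1 γ)
    (hinj : Function.Injective γ) (hne : ∀ t, deriv γ t ≠ 0) :
    (Measure.hausdorffMeasure 1 : Measure E).comap γ =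
      volume.withDensity fun t => ‖deriv γ t‖ₑ := by
  have hemb : MeasurableEmbedding γ := hγ.continuous.measurableEmbedding hinj
  set ν : Measure ℝ := volume.withDensity fun t => ‖deriv γ t‖ₑ with hν
  -- local comparison
  have key : ∀ t : ℝ, ∀ ε : NNReal, 0 < ε → ∃ J ∈ 𝓝 t, ∀ B ⊆ J, MeasurableSet B →
      (Measure.hausdorffMeasure 1 : Measure E).comap γ B ≤ (1 + ε) * ν B ∧
      ν B ≤ (1 + ε) * (Measure.hausdorffMeasure 1 : Measure E).comap γ B := by
    intro t ε hε
    have hc : 0 < ‖deriv γ t‖₊ := by simpa using hne t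
    obtain ⟨k₁, k₂, h1, h2, h3⟩ : ∃ k₁ k₂ : NNReal, k₁ < ‖deriv γ t‖₊ ∧ ‖deriv γ t‖₊ < k₂ ∧
        k₂ ≤ (1 + ε) * k₁ ∧ 0 < k₁ := by
      -- These constants lie strictly on either side of `‖γ'(t)‖` and have ratio exactly `1 + ε`.
      refine ⟨(1 + ε / 2) / (1 + ε) * ‖deriv γ t‖₊, (1 + ε / 2) * ‖deriv γ t‖₊, ?_, ?_, ?_, ?_⟩
      · refine mul_lt_of_lt_one_left hc ?_
        rw [div_lt_one (by positivity)]
        simpa using hε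
      · exact lt_mul_of_one_lt_left hc (by simpa using hε)
      · refine le_of_eq ?_
        field_simp
      · positivity
    obtain ⟨J, hJ, hJ1, hJ2⟩ := exists_nhds_lipschitz_bounds hγ (t := t) (k₁ := k₁) (k₂ := k₂)
      (by exact_mod_cast h1) (by exact_mod_cast h2)
    refine ⟨J, hJ, fun B hBJ hB => ?_⟩
    have h33 : (k₂ : ENNReal) ≤ (1 + ε) * k₁ := by exact_mod_cast h3.1
    have hvol : (Measure.hausdorffMeasure 1 : Measure ℝ) B = volume B := by
      rw [hausdorffMeasure_real]
    have a1 : (Measure.hausdorffMeasure 1 : Measure E) (γ '' B) ≤ k₂ * volume B := by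
      have : LipschitzOnWith k₂ γ B := LipschitzOnWith.of_dist_le_mul
        fun x hx y hy => (hJ1 x (hBJ hx) y (hBJ hy)).2
      have := this.hausdorffMeasure_image_le (d := 1) (by norm_num)
      simpa [hvol] using this
    have a2 : k₁ * volume B ≤ (Measure.hausdorffMeasure 1 : Measure E) (γ '' B) := by
      have hL : LipschitzOnWith k₁⁻¹ (Function.invFun γ) (γ '' B) := by
        refine LipschitzOnWith.of_dist_le_mul ?_
        rintro _ ⟨x, hx, rfl⟩ _ ⟨y, hy, rfl⟩
        rw [Function.leftInverse_invFun hinj x, Function.leftInverse_invFun hinj y]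
        have := (hJ1 x (hBJ hx) y (hBJ hy)).1
        have hk : (0 : ℝ) < k₁ := h3.2
        rw [NNReal.coe_inv, inv_mul_eq_div, le_div_iff₀ hk]
        linarith
      have h4 := hL.hausdorffMeasure_image_le (d := 1) (by norm_num)
      have h5 : Function.invFun γ '' (γ '' B) = B := by
        rw [image_image]
        simp [Function.leftInverse_invFun hinj _]
      rw [h5, hvol, ENNReal.rpow_one, ENNReal.coe_inv h3.2.ne'] at h4
      calc k₁ * volume B ≤ k₁ * ((k₁ : ENNReal)⁻¹ * _) := by gcongr
        _ = _ := by
          rw [← mul_assoc, ENNReal.mul_inv_cancel (by simpa using h3.2.ne') (by simp), one_mul]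
    have a3 : ν B ≤ k₂ * volume B := by
      rw [hν, withDensity_apply _ hB, ← setLIntegral_const]
      refine setLIntegral_mono measurable_const fun x hx => ?_
      have := (hJ2 x (hBJ hx)).2
      rw [enorm_eq_nnnorm]
      exact_mod_cast this
    have a4 : k₁ * volume B ≤ ν B := by
      rw [hν, withDensity_apply _ hB, ← setLIntegral_const]
      refine setLIntegral_mono (hγ.continuous_deriv le_rfl).enorm.measurable fun x hx => ?_
      have := (hJ2 x (hBJ hx)).1
      rw [enorm_eq_nnnorm]
      exact_mod_cast this
    rw [hemb.comap_apply]
    constructor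
    · calc _ ≤ k₂ * volume B := a1
        _ ≤ (1 + ε) * k₁ * volume B := by gcongr
        _ ≤ _ := by rw [mul_assoc]; gcongr
    · calc _ ≤ k₂ * volume B := a3
        _ ≤ (1 + ε) * k₁ * volume B := by gcongr
        _ ≤ _ := by rw [mul_assoc]; gcongr
  have lim : ∀ m n : ENNReal, (∀ ε : NNReal, 0 < ε → m ≤ (1 + ε) * n) → m ≤ n := by
    intro m n hmn
    have h0 : Tendsto (fun k : ℕ => (1 + ((1 / ((k : NNReal) + 1) : NNReal) : ENNReal)) * n) atTop
        (𝓝 ((1 + ((0 : NNReal) : ENNReal)) * n)) := by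
      refine ENNReal.Tendsto.mul_const ?_ (Or.inl (by simp))
      exact tendsto_const_nhds.add
        (ENNReal.tendsto_coe.2 tendsto_one_div_add_atTop_nhds_zero_nat)
    simp only [ENNReal.coe_zero, add_zero, one_mul] at h0
    exact ge_of_tendsto' h0 fun k => hmn _ (by positivity)
  refine le_antisymm ?_ ?_
  · refine Measure.le_iff.2 fun B _ => lim _ _ fun ε hε => ?_
    have : (Measure.hausdorffMeasure 1 : Measure E).comap γ ≤ (1 + (ε : ENNReal)) • ν :=
      measure_le_of_locally_le fun t => by
        obtain ⟨J, hJ, h⟩ := key t ε hε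
        exact ⟨J, hJ, fun B h1 h2 => (h B h1 h2).1⟩
    exact this B
  · refine Measure.le_iff.2 fun B _ => lim _ _ fun ε hε => ?_
    have : ν ≤ (1 + (ε : ENNReal)) • (Measure.hausdorffMeasure 1 : Measure E).comap γ :=
      measure_le_of_locally_le fun t => by
        obtain ⟨J, hJ, h⟩ := key t ε hε
        exact ⟨J, hJ, fun B h1 h2 => (h B h1 h2).2⟩
    exact this B

end ArcLength


/-! ### Boundary integrals in a chart. -/

section BoundaryIntegral

variable {𝒪 : Set Plane} {b : OrthonormalBasis (Fin 2) ℝ Plane} {p : Plane} {h : ℝ → ℝ} {a r : ℝ}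

theorem norm_frame_sq (b : OrthonormalBasis (Fin 2) ℝ Plane) (s t : ℝ) :
    ‖s • b 0 + t • b 1‖ = √(s ^ 2 + t ^ 2) := by
  rw [norm_eq_sqrt_real_inner]
  congr 1
  have h0 : ⟪b 0, b 0⟫ = 1 := by simp
  have h1 : ⟪b 1, b 1⟫ = 1 := by simp
  have h01 : ⟪b 0, b 1⟫ = 0 := b.orthonormal.2 (by decide)
  have h10 : ⟪b 1, b 0⟫ = 0 := b.orthonormal.2 (by decide)
  simp only [inner_add_left, inner_add_right, inner_smul_left, inner_smul_right, h0, h1, h01, h10]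
  simp
  ring

theorem hasDerivAt_graphMap_fst (hh : Differentiable ℝ h) (x : ℝ) :
    HasDerivAt (fun x : ℝ => graphMap b p h (x, 0)) (b 0 + deriv h x • b 1) x := by
  have h1 : HasDerivAt (fun x' : ℝ => (x', (0 : ℝ))) ((1 : ℝ), (0 : ℝ)) x :=
    (hasDerivAt_id x).prodMk (hasDerivAt_const x 0)
  refine ((hasFDerivAt_graphMap (b := b) (p := p) hh (x, 0)).comp_hasDerivAt x h1).congr_deriv ?_
  simp

theorem restrict_hausdorffMeasure_graph (hh : ContDiff ℝ 2 h) :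
    (Measure.hausdorffMeasure 1 : Measure Plane).restrict (range fun x => graphMap b p h (x, 0)) =
      (volume.withDensity fun x => ((√(1 + deriv h x ^ 2)).toNNReal : ENNReal)).map
        fun x => graphMap b p h (x, 0) := by
  have hd := hh.differentiable (by norm_num)
  have hder : ∀ x, deriv (fun x : ℝ => graphMap b p h (x, 0)) x = (1 : ℝ) • b 0 + deriv h x • b 1 :=
    fun x => by rw [(hasDerivAt_graphMap_fst hd x).deriv, one_smul]
  have hinj : Function.Injective fun x : ℝ => graphMap b p h (x, 0) := fun x y hxy =>
    congrArg Prod.fst (graphMap_injective hxy)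
  have hγ : ContDiff ℝ 1 fun x : ℝ => graphMap b p h (x, 0) :=
    (hh.graphMap.comp (by fun_prop : ContDiff ℝ 2 fun x : ℝ => (x, (0 : ℝ)))).of_le (by norm_num)
  have hnorm : ∀ x, ‖deriv (fun x : ℝ => graphMap b p h (x, 0)) x‖ = √(1 + deriv h x ^ 2) :=
    fun x => by rw [hder, norm_frame_sq, one_pow]
  have key := comap_hausdorffMeasure_curve hγ hinj fun x hx => by
    have := hnorm x
    rw [hx, norm_zero] at this
    have h2 : 0 < √(1 + deriv h x ^ 2) := by positivity
    linarith
  rw [← (hγ.continuous.measurableEmbedding hinj).map_comap, key]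
  congr 2
  ext1 x
  rw [enorm_eq_nnnorm]
  congr 1
  ext
  rw [coe_nnnorm, hnorm, Real.coe_toNNReal _ (Real.sqrt_nonneg _)]

theorem IsGraphChart.image_Ioo (hc : IsGraphChart 𝒪 b p h a r) (hO : IsOpen 𝒪) :
    frontier 𝒪 ∩ chartBox b p h a r =
      (range fun x => graphMap b p h (x, 0)) ∩ chartBox b p h a r := by
  ext y
  constructor
  · rintro ⟨h1, h2⟩
    refine ⟨⟨(graphCoord b p h y).1, ?_⟩, h2⟩
    rw [← graphMap_graphCoord (b := b) (p := p) (h := h) y,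
      hc.graphMap_mem_frontier_iff hO (abs_lt.2 h2.1) (abs_lt.2 h2.2)] at h1
    simp only
    conv_rhs => rw [← graphMap_graphCoord (b := b) (p := p) (h := h) y]
    congr 1
    ext <;> simp [h1]
  · rintro ⟨⟨x, rfl⟩, h2⟩
    exact ⟨hc.graphMap_mem_frontier hO (graphMap_mem_chartBox.1 h2).1, h2⟩

/-- Inside the chart the frontier is the graph of `h`, on which arc length is `√(1 + h'²) dx`. -/
theorem IsGraphChart.integrableOn_frontier (hc : IsGraphChart 𝒪 b p h a r) (hO : IsOpen 𝒪) {k : Plane → ℝ}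
    (hk : Function.support k ⊆ chartBox b p h a r)
    (hint : IntegrableOn (fun x => √(1 + deriv h x ^ 2) * k (graphMap b p h (x, 0)))
      (Ioo (-a) a)) :
    IntegrableOn k (frontier 𝒪) (Measure.hausdorffMeasure 1) ∧
      ∫ y in frontier 𝒪, k y ∂(Measure.hausdorffMeasure 1) =
        ∫ x in (-a)..a, √(1 + deriv h x ^ 2) * k (graphMap b p h (x, 0)) := by
  have hbox : MeasurableSet (chartBox b p h a r) := hc.isOpen_chartBox.measurableSet
  have hcont : Continuous fun x : ℝ => graphMap b p h (x, 0) :=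
    hc.contDiff.graphMap.continuous.comp (by fun_prop)
  have hemb := hcont.measurableEmbedding fun x y hxy => congrArg Prod.fst (graphMap_injective hxy)
  have hpre : (fun x : ℝ => graphMap b p h (x, 0)) ⁻¹' chartBox b p h a r = Ioo (-a) a := by
    ext x
    rw [mem_preimage, graphMap_mem_chartBox]
    simp [hc.r_pos, abs_lt]
  have hm : Measurable fun x => (√(1 + deriv h x ^ 2)).toNNReal := by
    have := (hc.contDiff.deriv_one.continuous)
    fun_prop
  have hres : (Measure.hausdorffMeasure 1 : Measure Plane).restrict
      (frontier 𝒪 ∩ chartBox b p h a r) = ((volume.restrict (Ioo (-a) a)).withDensity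
        fun x => ((√(1 + deriv h x ^ 2)).toNNReal : ENNReal)).map
        fun x => graphMap b p h (x, 0) := by
    rw [hc.image_Ioo hO, inter_comm, ← Measure.restrict_restrict hbox,
      restrict_hausdorffMeasure_graph hc.contDiff, hemb.restrict_map, hpre,
      restrict_withDensity measurableSet_Ioo]
  have hfun : (fun x => √(1 + deriv h x ^ 2) * k (graphMap b p h (x, 0))) =
      fun x => (√(1 + deriv h x ^ 2)).toNNReal • k (graphMap b p h (x, 0)) := by
    ext x
    rw [NNReal.smul_def, Real.coe_toNNReal _ (Real.sqrt_nonneg _), smul_eq_mul]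
  constructor
  · have h1 : IntegrableOn k (frontier 𝒪 ∩ chartBox b p h a r)
        (Measure.hausdorffMeasure 1) := by
      rw [IntegrableOn, hres, hemb.integrable_map_iff, integrable_withDensity_iff_integrable_smul hm]
      rw [hfun] at hint
      exact hint
    exact h1.of_forall_sdiff_eq_zero isClosed_frontier.measurableSet fun y hy => by
      by_contra hne
      exact hy.2 ⟨hy.1, hk hne⟩
  · rw [setIntegral_eq_of_subset_of_forall_sdiff_eq_zero isClosed_frontier.measurableSet
      (inter_subset_left (t := chartBox b p h a r)) fun y hy => by
        by_contra hne
        exact hy.2 ⟨hy.1, hk hne⟩, hres, hemb.integral_map,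
      integral_withDensity_eq_integral_smul hm, intervalIntegral.integral_of_le
        (by linarith [hc.a_pos]), integral_Ioc_eq_integral_Ioo, hfun]

end BoundaryIntegral


/-- A real solution of `(-Δ - λ²) w = 0` outside `𝒪`, smooth up to the boundary away from the
corners, continuous, and vanishing on the boundary. -/
structure IsDirichletSolution (𝒪 : Set Plane) (lam : ℝ) (w : Plane → ℝ) : Prop where
  continuousOn : ContinuousOn w 𝒪ᶜ
  contDiffOn : ContDiffOn ℝ 2 w (𝒪ᶜ \ corners 𝒪)
  helmholtz : ∀ x ∈ (closure 𝒪)ᶜ, (Δ w) x = -(lam ^ 2 * w x)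
  boundary : ∀ x ∈ frontier 𝒪, w x = 0

/-! ### Smooth approximations of the identity and of the absolute value. -/

section Regularization

/-- A family of `C²` functions `f δ` which converges to `f₀` as `δ → 0`. -/
structure IsRegularization (f : ℝ → ℝ → ℝ) (f₀ : ℝ → ℝ) : Prop where
  contDiff : ∀ δ, 0 < δ → ContDiff ℝ 2 (f δ)
  continuous : Continuous f₀
  zero : f₀ 0 = 0
  abs_sub_le : ∀ δ, 0 < δ → δ ≤ 1 → ∀ t, |f δ t - f₀ t| ≤ δ
  abs_deriv_le : ∀ δ, 0 < δ → δ ≤ 1 → ∀ t, |deriv (f δ) t| ≤ 1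
  abs_mul_deriv_sub_le : ∀ δ, 0 < δ → δ ≤ 1 → ∀ t, |t * deriv (f δ) t - f₀ t| ≤ δ

/-- The identity leads to Green's formula and `smoothAbs` to Kato's inequality. The common interface
allows the limit `δ → 0` to be taken once for both. -/
theorem isRegularization_id : IsRegularization (fun _ t => t) fun t => t where
  contDiff _ _ := contDiff_id
  continuous := continuous_id
  zero := rfl
  abs_sub_le δ hδ _ t := by simpa using hδ.le
  abs_deriv_le δ hδ _ t := by simp
  abs_mul_deriv_sub_le δ hδ _ t := by simpa using hδ.le

/-- A smooth convex approximation of the absolute value. -/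
noncomputable def smoothAbs (δ t : ℝ) : ℝ := √(t ^ 2 + δ ^ 4)

theorem contDiff_smoothAbs {δ : ℝ} (hδ : 0 < δ) {n : WithTop ℕ∞} : ContDiff ℝ n (smoothAbs δ) := by
  unfold smoothAbs
  exact ContDiff.sqrt (by fun_prop) fun t => by positivity

theorem hasDerivAt_smoothAbs {δ : ℝ} (hδ : 0 < δ) (t : ℝ) :
    HasDerivAt (smoothAbs δ) (t / smoothAbs δ t) t := by
  have h1 : HasDerivAt (fun t : ℝ => t ^ 2 + δ ^ 4) (2 * t) t := by
    simpa using ((hasDerivAt_id t).pow 2).add_const (δ ^ 4)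
  have h2 := h1.sqrt (by positivity)
  refine h2.congr_deriv ?_
  unfold smoothAbs
  have : 0 < √(t ^ 2 + δ ^ 4) := by positivity
  field_simp

/-- The second derivative is `δ⁴ / (t² + δ⁴)^(3/2)`. Its sign is what allows the gradient term of
Green's identity to be dropped in Kato's inequality. -/
theorem deriv_deriv_smoothAbs_nonneg {δ : ℝ} (hδ : 0 < δ) (t : ℝ) :
    0 ≤ deriv (deriv (smoothAbs δ)) t := by
  have h1 : deriv (smoothAbs δ) = fun t => t / smoothAbs δ t :=
    funext fun t => (hasDerivAt_smoothAbs hδ t).deriv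
  have h0 : 0 < smoothAbs δ t := by unfold smoothAbs; positivity
  have hsq : smoothAbs δ t ^ 2 = t ^ 2 + δ ^ 4 := Real.sq_sqrt (by positivity)
  have h2 : HasDerivAt (fun t => t / smoothAbs δ t) _ t :=
    (hasDerivAt_id t).div (hasDerivAt_smoothAbs hδ t) h0.ne'
  rw [h1, h2.deriv]
  have : 1 * smoothAbs δ t - id t * (t / smoothAbs δ t) = δ ^ 4 / smoothAbs δ t := by
    simp only [id]
    field_simp
    linarith
  rw [this]
  positivity

theorem isRegularization_smoothAbs : IsRegularization smoothAbs fun t => |t| where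
  contDiff _ hδ := contDiff_smoothAbs hδ
  continuous := continuous_abs
  zero := abs_zero
  abs_sub_le δ hδ hδ1 t := by
    have h1 : |t| ≤ smoothAbs δ t := Real.abs_le_sqrt (by linarith [pow_pos hδ 4])
    have h2 : smoothAbs δ t ≤ |t| + δ := by
      refine Real.sqrt_le_iff.2 ⟨by positivity, ?_⟩
      have : δ ^ 4 ≤ δ ^ 2 := pow_le_pow_of_le_one hδ.le hδ1 (by norm_num)
      nlinarith [sq_abs t, mul_nonneg (abs_nonneg t) hδ.le]
    rw [abs_le]
    constructor <;> linarith
  abs_deriv_le δ hδ hδ1 t := by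
    have h1 : |t| ≤ smoothAbs δ t := Real.abs_le_sqrt (by linarith [pow_pos hδ 4])
    have h0 : 0 < smoothAbs δ t := by unfold smoothAbs; positivity
    rw [(hasDerivAt_smoothAbs hδ t).deriv, abs_div, abs_of_pos h0]
    exact (div_le_one h0).2 h1
  abs_mul_deriv_sub_le δ hδ hδ1 t := by
    have h1 : |t| ≤ smoothAbs δ t := Real.abs_le_sqrt (by linarith [pow_pos hδ 4])
    have h0 : 0 < smoothAbs δ t := by unfold smoothAbs; positivity
    have h2 : smoothAbs δ t ≤ |t| + δ := by
      refine Real.sqrt_le_iff.2 ⟨by positivity, ?_⟩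
      have : δ ^ 4 ≤ δ ^ 2 := pow_le_pow_of_le_one hδ.le hδ1 (by norm_num)
      nlinarith [sq_abs t, mul_nonneg (abs_nonneg t) hδ.le]
    have h3 : t * (t / smoothAbs δ t) = |t| * (|t| / smoothAbs δ t) := by
      rw [← mul_div_assoc, ← mul_div_assoc, ← sq, ← sq, sq_abs]
    have h4 : |t| / smoothAbs δ t ≤ 1 := (div_le_one h0).2 h1
    have h5 : |t| - |t| * (|t| / smoothAbs δ t) = |t| / smoothAbs δ t * (smoothAbs δ t - |t|) := by
      field_simp
    rw [(hasDerivAt_smoothAbs hδ t).deriv, h3, abs_sub_comm, h5, abs_of_nonneg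
      (mul_nonneg (by positivity) (by linarith))]
    calc _ ≤ 1 * (smoothAbs δ t - |t|) := by
          refine mul_le_mul_of_nonneg_right h4 (by linarith)
      _ ≤ δ := by linarith

end Regularization

/-! ### The limit of the volume term at the boundary. -/

section Limits

variable {𝒪 : Set Plane} {b : OrthonormalBasis (Fin 2) ℝ Plane} {p : Plane} {h : ℝ → ℝ}
  {a r a₁ r₁ lam : ℝ} {w ψ : Plane → ℝ} {f : ℝ → ℝ → ℝ} {f₀ : ℝ → ℝ}

/-- The part of `greenDiv` which does not contain the second derivative of `f`. -/
noncomputable def reducedDiv (lam : ℝ) (f : ℝ → ℝ) (w ψ : Plane → ℝ) (y : Plane) : ℝ :=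
  f (w y) * (Δ ψ) y + lam ^ 2 * ψ y * (w y * deriv f (w y))

/-- Both `f_δ(w)` and `w f_δ'(w)` are within `δ` of `f₀(w)`, uniformly in `w`. The bound is thus
independent of `w` and serves both for pointwise convergence and for domination. -/
theorem abs_reducedDiv_sub_le (hf : IsRegularization f f₀) {δ : ℝ} (hδ : 0 < δ) (hδ1 : δ ≤ 1)
    (y : Plane) : |reducedDiv lam (f δ) w ψ y - f₀ (w y) * ((Δ ψ) y + lam ^ 2 * ψ y)| ≤
      δ * (|(Δ ψ) y| + lam ^ 2 * |ψ y|) := by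
  have e : reducedDiv lam (f δ) w ψ y - f₀ (w y) * ((Δ ψ) y + lam ^ 2 * ψ y) =
      (f δ (w y) - f₀ (w y)) * (Δ ψ) y +
        (w y * deriv (f δ) (w y) - f₀ (w y)) * (lam ^ 2 * ψ y) := by
    unfold reducedDiv; ring
  rw [e, mul_add]
  refine (abs_add_le _ _).trans (add_le_add ?_ ?_)
  · rw [abs_mul]
    exact mul_le_mul_of_nonneg_right (hf.abs_sub_le δ hδ hδ1 _) (abs_nonneg _)
  · rw [abs_mul, abs_mul, abs_of_nonneg (sq_nonneg lam)]
    exact mul_le_mul_of_nonneg_right (hf.abs_mul_deriv_sub_le δ hδ hδ1 _) (by positivity)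

theorem continuous_laplacian {ψ : Plane → ℝ} (hψ : ContDiff ℝ 2 ψ) : Continuous (Δ ψ) := by
  have e : Δ ψ = fun x => ∑ i, fderiv ℝ (fderiv ℝ ψ) x (stdOrthonormalBasis ℝ Plane i)
      (stdOrthonormalBasis ℝ Plane i) :=
    funext fun x => laplacian_eq_sum_fderiv_fderiv _ ψ x
  rw [e]
  have : Continuous (fderiv ℝ (fderiv ℝ ψ)) :=
    (hψ.fderiv_right (m := 1) (by norm_num)).continuous_fderiv (by norm_num)
  fun_prop

theorem greenDiv_eq_reducedDiv {g : ℝ → ℝ} {y : Plane} (hw : (Δ w) y = -(lam ^ 2 * w y)) :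
    greenDiv b g w ψ y = reducedDiv lam g w ψ y -
      ψ y * (deriv (deriv g) (w y) * ∑ i, (fderiv ℝ w y (b i)) ^ 2) := by
  rw [greenDiv, reducedDiv, hw]
  ring

theorem laplacian_eq_zero_of_notMem_tsupport {F : Type*} [NormedAddCommGroup F] [NormedSpace ℝ F]
    {ψ : Plane → F} {y : Plane} (hy : y ∉ tsupport ψ) : (Δ ψ) y = 0 := by
  rw [notMem_tsupport_iff_eventuallyEq] at hy
  rw [InnerProductSpace.laplacian_congr_nhds hy |>.eq_of_nhds, laplacian_eq_sum_fderiv_fderiv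
    (stdOrthonormalBasis ℝ Plane)]
  have : fderiv ℝ (0 : Plane → F) = 0 := by
    ext1 x; simp
  simp [this]

/-- The volume term of Green's identity in a boundary chart. -/
theorem IsGraphChart.tendsto_integral_reducedDiv (hc : IsGraphChart 𝒪 b p h a r)
    (haa : a₁ < a) (hr₁ : 0 < r₁) (hrr : r₁ < r)
    (hwc : ContinuousOn w 𝒪ᶜ) (hw0 : ∀ y ∈ frontier 𝒪, w y = 0) (hO : IsOpen 𝒪)
    (hψ : ContDiff ℝ 2 ψ) (hsupp : tsupport ψ ⊆ chartBox b p h a₁ r₁)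
    (hf : IsRegularization f f₀) :
    Tendsto (fun δ => ∫ z in Icc (-a₁, δ) (a₁, r₁),
        reducedDiv lam (f δ) w ψ (graphMap b p h z)) (𝓝[>] 0)
      (𝓝 (∫ y in (closure 𝒪)ᶜ, f₀ (w y) * ((Δ ψ) y + lam ^ 2 * ψ y))) := by
  set Φ := graphMap b p h with hΦ
  have hΦc : Continuous Φ := hc.contDiff.graphMap.continuous
  set K : Set (ℝ × ℝ) := Icc (-a₁, 0) (a₁, r₁) with hK
  have hKmem : ∀ z ∈ K, Φ z ∈ 𝒪ᶜ := fun z hz =>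
    hc.graphMap_mem_compl (abs_le.2 ⟨by linarith [hz.1.1], by linarith [hz.2.1]⟩) hz.1.2
      (hz.2.2.trans hrr.le)
  have hwK : ContinuousOn (fun z => w (Φ z)) K := hwc.comp hΦc.continuousOn hKmem
  have hψc := hψ.continuous
  have hΔc := continuous_laplacian hψ
  set q₀ : ℝ × ℝ → ℝ := fun z => f₀ (w (Φ z)) * ((Δ ψ) (Φ z) + lam ^ 2 * ψ (Φ z)) with hq₀
  have hq₀c : ContinuousOn q₀ K :=
    (hf.continuous.comp_continuousOn hwK).mul (by fun_prop : Continuous _).continuousOn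
  set B : ℝ × ℝ → ℝ := fun z => |(Δ ψ) (Φ z)| + lam ^ 2 * |ψ (Φ z)| with hB
  have hBc : Continuous B := by fun_prop
  have hΩ : ∫ y in (closure 𝒪)ᶜ, f₀ (w y) * ((Δ ψ) y + lam ^ 2 * ψ y) = ∫ z in K, q₀ z := by
    have hbox : IsOpen (chartBox b p h a₁ r₁) :=
      (isOpen_Ioo.prod isOpen_Ioo).preimage (continuous_graphCoord hc.contDiff.continuous)
    have hQ : ∀ y, y ∉ chartBox b p h a₁ r₁ → f₀ (w y) * ((Δ ψ) y + lam ^ 2 * ψ y) = 0 := by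
      intro y hy
      have h1 : y ∉ tsupport ψ := fun h => hy (hsupp h)
      rw [laplacian_eq_zero_of_notMem_tsupport h1, image_eq_zero_of_notMem_tsupport h1]
      simp
    rw [setIntegral_eq_of_subset_of_forall_sdiff_eq_zero isClosed_closure.isOpen_compl.measurableSet
      (inter_subset_left (t := chartBox b p h a₁ r₁)) fun y hy => hQ y fun h => hy.2 ⟨hy.1, h⟩]
    rw [← (measurePreserving_graphMap (b := b) (p := p) hc.contDiff.continuous).setIntegral_preimage_emb
      (graphHomeomorph b p hc.contDiff).measurableEmbedding]
    symm
    refine setIntegral_eq_of_subset_of_forall_sdiff_eq_zero measurableSet_Icc ?_ ?_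
    · rintro z ⟨h1, h2⟩
      have h3 := graphMap_mem_chartBox.1 h2
      have h4 : 0 ≤ z.2 := by
        refine not_lt.1 fun h4 => h1 (subset_closure ?_)
        exact (hc.mem_iff z (h3.1.le.trans haa.le) (h3.2.le.trans hrr.le)).2 h4
      exact ⟨⟨(abs_lt.1 h3.1).1.le, h4⟩, ⟨(abs_lt.1 h3.1).2.le, (abs_lt.1 h3.2).2.le⟩⟩
    · rintro z ⟨h1, h2⟩
      by_cases h3 : Φ z ∈ chartBox b p h a₁ r₁
      · have h4 := graphMap_mem_chartBox.1 h3
        have h5 : z.2 = 0 := by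
          refine le_antisymm (not_lt.1 fun h5 => h2 ⟨?_, h3⟩) h1.1.2
          exact hc.graphMap_mem_exterior (h4.1.trans haa) h5 ((abs_lt.1 h4.2).2.trans hrr)
        have h6 := hw0 _ ((hc.graphMap_mem_frontier_iff hO (h4.1.trans haa)
          (h4.2.trans hrr)).2 h5)
        simp only [hq₀, hΦ, h6, hf.zero, zero_mul]
      · exact hQ _ h3
  rw [hΩ]
  have hev : ∀ᶠ δ in 𝓝[>] (0 : ℝ), δ ∈ Ioo 0 (min 1 r₁) := Ioo_mem_nhdsGT (by positivity)
  have hsub : ∀ δ ∈ Ioo 0 (min 1 r₁), Icc (-a₁, δ) (a₁, r₁) ⊆ K := fun δ hδ z hz =>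
    ⟨⟨hz.1.1, hδ.1.le.trans hz.1.2⟩, hz.2⟩
  -- The domain shrinks with `δ`; indicators move this dependence into the integrand, so that
  -- dominated convergence applies on the fixed box `K`.
  have key : Tendsto (fun δ => ∫ z in K, (Icc (-a₁, δ) (a₁, r₁)).indicator
      (fun z => reducedDiv lam (f δ) w ψ (Φ z)) z) (𝓝[>] 0) (𝓝 (∫ z in K, q₀ z)) := by
    refine tendsto_integral_filter_of_dominated_convergence (fun z => |q₀ z| + B z) ?_ ?_ ?_ ?_
    · filter_upwards [hev] with δ hδ
      refine AEStronglyMeasurable.indicator ?_ measurableSet_Icc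
      have : ContinuousOn (fun z => reducedDiv lam (f δ) w ψ (Φ z)) K := by
        have h1 := (hf.contDiff δ hδ.1).continuous.comp_continuousOn hwK
        have h2 := (hf.contDiff δ hδ.1).deriv_one.continuous.comp_continuousOn hwK
        exact (h1.mul (hΔc.comp hΦc).continuousOn).add
          ((continuous_const.mul (hψc.comp hΦc)).continuousOn.mul (hwK.mul h2))
      exact this.aestronglyMeasurable measurableSet_Icc
    · filter_upwards [hev] with δ hδ
      refine ae_of_all _ fun z => ?_
      have h1 := abs_reducedDiv_sub_le (lam := lam) (w := w) (ψ := ψ) hf hδ.1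
        (hδ.2.le.trans (min_le_left _ _)) (Φ z)
      have h2 : δ * B z ≤ 1 * B z := mul_le_mul_of_nonneg_right (hδ.2.le.trans (min_le_left _ _))
        (by positivity)
      refine (norm_indicator_le_norm_self _ _).trans ?_
      rw [Real.norm_eq_abs]
      have h3 := abs_sub_abs_le_abs_sub (reducedDiv lam (f δ) w ψ (Φ z)) (q₀ z)
      have h4 : |reducedDiv lam (f δ) w ψ (Φ z) - q₀ z| ≤ δ * B z := h1
      linarith
    · exact (hq₀c.abs.add hBc.continuousOn).integrableOn_compact isCompact_Icc
    · refine (ae_restrict_iff' measurableSet_Icc).2 (ae_of_all _ fun z hz => ?_)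
      -- Points on the bottom edge are never in the domain for `δ > 0`, and the limit vanishes there
      -- because `w = 0` and `f₀ 0 = 0`.
      rcases hz.1.2.eq_or_lt with h0 | h0
      · have h0' : z.2 = 0 := h0.symm
        have hzf : w (Φ z) = 0 := hw0 _ <| by
          have : z = (z.1, 0) := by ext <;> simp [h0']
          rw [this]
          exact hc.graphMap_mem_frontier hO (abs_lt.2 ⟨by linarith [hz.1.1], by linarith [hz.2.1]⟩)
        have : q₀ z = 0 := by simp only [hq₀, hzf, hf.zero, zero_mul]
        rw [this]
        refine tendsto_const_nhds.congr' ?_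
        filter_upwards [hev] with δ hδ
        rw [indicator_of_notMem]
        exact fun h => absurd h.1.2 (by simpa [h0'] using hδ.1)
      · have h1 : ∀ᶠ δ in 𝓝[>] (0 : ℝ), δ ∈ Ioo 0 z.2 := Ioo_mem_nhdsGT h0
        have h2 : Tendsto (fun δ => reducedDiv lam (f δ) w ψ (Φ z)) (𝓝[>] 0) (𝓝 (q₀ z)) := by
          rw [tendsto_iff_norm_sub_tendsto_zero]
          have h3 : Tendsto (fun δ : ℝ => δ * B z) (𝓝[>] 0) (𝓝 0) := by
            have : Tendsto (fun δ : ℝ => δ * B z) (𝓝 0) (𝓝 (0 * B z)) :=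
              (continuous_id.mul continuous_const).tendsto 0
            rw [zero_mul] at this
            exact this.mono_left nhdsWithin_le_nhds
          refine squeeze_zero' (Eventually.of_forall fun _ => norm_nonneg _) ?_ h3
          filter_upwards [hev] with δ hδ
          exact abs_reducedDiv_sub_le hf hδ.1 (hδ.2.le.trans (min_le_left _ _)) (Φ z)
        refine h2.congr' ?_
        filter_upwards [h1] with δ hδ
        rw [indicator_of_mem]
        exact ⟨⟨hz.1.1, hδ.2.le⟩, hz.2⟩
  refine key.congr' ?_
  filter_upwards [hev] with δ hδ
  rw [setIntegral_indicator measurableSet_Icc, inter_eq_right.2 (hsub δ hδ)]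

end Limits


/-! ### The limit of the boundary term. -/

section LocalGreen

variable {𝒪 : Set Plane} {b : OrthonormalBasis (Fin 2) ℝ Plane} {p : Plane} {h : ℝ → ℝ}
  {a r a₁ r₁ lam : ℝ} {w ψ : Plane → ℝ} {f : ℝ → ℝ → ℝ} {f₀ : ℝ → ℝ}

theorem IsDirichletSolution.contDiffOn_exterior (hw : IsDirichletSolution 𝒪 lam w) :
    ContDiffOn ℝ 2 w (closure 𝒪)ᶜ :=
  hw.contDiffOn.mono fun _ hy => ⟨fun h => hy (subset_closure h), fun h => hy h.1.1⟩

theorem fderivWithin_compl_eq_fderiv {F : Type*} [NormedAddCommGroup F] [NormedSpace ℝ F]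
    {w : Plane → F} {y : Plane} (hy : y ∈ (closure 𝒪)ᶜ) :
    fderivWithin ℝ w 𝒪ᶜ y = fderiv ℝ w y :=
  fderivWithin_of_mem_nhds <| Filter.mem_of_superset (isClosed_closure.isOpen_compl.mem_nhds hy)
    (compl_subset_compl.2 subset_closure)

/-- The boundary term of Green's identity in a boundary chart. -/
theorem IsGraphChart.tendsto_integral_greenField (hc : IsGraphChart 𝒪 b p h a r) (hO : IsOpen 𝒪)
    (hcorner : Disjoint (chartBox b p h a r) (corners 𝒪)) (hw : IsDirichletSolution 𝒪 lam w)
    (ha₁ : 0 < a₁) (haa : a₁ < a) (hr₁ : 0 < r₁) (hrr : r₁ < r)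
    (hψ : ContDiff ℝ 2 ψ) (hf : IsRegularization f f₀) {L : ℝ → ℝ}
    (hL : ∀ x ∈ Icc (-a₁) a₁, Tendsto (fun δ => deriv (f δ) (w (graphMap b p h (x, δ))) *
      fderivWithin ℝ w 𝒪ᶜ (graphMap b p h (x, δ)) (b 1 - deriv h x • b 0)) (𝓝[>] 0) (𝓝 (L x))) :
    Tendsto (fun δ => ∫ x in (-a₁)..a₁,
        greenField (f δ) w ψ (graphMap b p h (x, δ)) (b 1 - deriv h x • b 0)) (𝓝[>] 0)
      (𝓝 (-∫ x in (-a₁)..a₁, ψ (graphMap b p h (x, 0)) * L x)) := by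
  set Φ := graphMap b p h with hΦ
  have hΦc : Continuous Φ := hc.contDiff.graphMap.continuous
  set N : ℝ → Plane := fun x => b 1 - deriv h x • b 0 with hN
  have hNc : Continuous N := by
    have := hc.contDiff.deriv_one.continuous
    fun_prop
  set D := fderivWithin ℝ w 𝒪ᶜ with hD
  set K : Set (ℝ × ℝ) := Icc (-a₁, 0) (a₁, r₁) with hK
  have hKmem : MapsTo Φ K (chartBox b p h a r ∩ 𝒪ᶜ) := fun z hz => by
    have h1 : |z.1| < a := abs_lt.2 ⟨by linarith [hz.1.1], by linarith [hz.2.1]⟩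
    have h2 : |z.2| < r := abs_lt.2 ⟨by linarith [hz.1.2], by linarith [hz.2.2]⟩
    exact ⟨graphMap_mem_chartBox.2 ⟨h1, h2⟩,
      hc.graphMap_mem_compl h1.le hz.1.2 (abs_lt.1 h2).2.le⟩
  have hwK : ContinuousOn (fun z => w (Φ z)) K :=
    hw.continuousOn.comp hΦc.continuousOn fun z hz => (hKmem hz).2
  have hDK : ContinuousOn (fun z => D (Φ z)) K := by
    refine ContinuousOn.comp (hc.continuousOn_fderivWithin ?_) hΦc.continuousOn hKmem
    exact (hw.contDiffOn.mono fun y hy =>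
      ⟨hy.2, fun h => hcorner.le_bot ⟨hy.1, h⟩⟩).of_le (by norm_num)
  have hψc := hψ.continuous
  have hdψc : Continuous (fderiv ℝ ψ) := hψ.continuous_fderiv (by norm_num)
  set H : ℝ × ℝ → ℝ := fun z => (|f₀ (w (Φ z))| + 1) * |fderiv ℝ ψ (Φ z) (N z.1)| +
    |ψ (Φ z)| * |D (Φ z) (N z.1)| with hH
  have hHc : ContinuousOn H K := by
    refine ContinuousOn.add (ContinuousOn.mul ((hf.continuous.comp_continuousOn hwK).abs.add
      continuousOn_const) ?_) (ContinuousOn.mul ?_ ?_)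
    · exact Continuous.continuousOn (by fun_prop)
    · exact Continuous.continuousOn (by fun_prop)
    · exact (hDK.clm_apply (Continuous.continuousOn (by fun_prop))).abs
  obtain ⟨C, hC⟩ := isCompact_Icc.exists_bound_of_continuousOn hHc
  have hev : ∀ᶠ δ in 𝓝[>] (0 : ℝ), δ ∈ Ioo 0 (min 1 r₁) := Ioo_mem_nhdsGT (by positivity)
  have hmemK : ∀ δ ∈ Ioo 0 (min 1 r₁), ∀ x ∈ Icc (-a₁) a₁, (x, δ) ∈ K := fun δ hδ x hx =>
    ⟨⟨hx.1, hδ.1.le⟩, ⟨hx.2, hδ.2.le.trans (min_le_right _ _)⟩⟩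
  have hext : ∀ δ ∈ Ioo 0 (min 1 r₁), ∀ x ∈ Icc (-a₁) a₁, Φ (x, δ) ∈ (closure 𝒪)ᶜ :=
    fun δ hδ x hx => hc.graphMap_mem_exterior (z := (x, δ))
      (abs_lt.2 ⟨by linarith [hx.1], by linarith [hx.2]⟩) hδ.1
      ((hδ.2.trans_le (min_le_right _ _)).trans hrr)
  have huIcc : ∀ x ∈ uIoc (-a₁) a₁, x ∈ Icc (-a₁) a₁ := fun x hx => by
    rw [uIoc_of_le (by linarith)] at hx
    exact Ioc_subset_Icc_self hx
  rw [← intervalIntegral.integral_neg]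
  refine intervalIntegral.tendsto_integral_filter_of_dominated_convergence (fun _ => C) ?_ ?_
    (by simp) ?_
  · filter_upwards [hev] with δ hδ
    rw [uIoc_of_le (by linarith)]
    refine (ContinuousOn.aestronglyMeasurable (s := Icc (-a₁) a₁) ?_ measurableSet_Icc).mono_set
      Ioc_subset_Icc_self
    refine ContinuousOn.clm_apply ?_ hNc.continuousOn
    exact ((contDiffOn_greenField (hf.contDiff δ hδ.1) isClosed_closure.isOpen_compl
      hw.contDiffOn_exterior hψ).continuousOn).comp (by fun_prop : Continuous _).continuousOn
      (hext δ hδ)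
  · filter_upwards [hev] with δ hδ
    refine ae_of_all _ fun x hx => ?_
    have hx' := huIcc x hx
    refine le_trans ?_ ((Real.le_norm_self _).trans (hC (x, δ) (hmemK δ hδ x hx')))
    have h1 := hf.abs_sub_le δ hδ.1 (hδ.2.le.trans (min_le_left _ _)) (w (Φ (x, δ)))
    have h2 := hf.abs_deriv_le δ hδ.1 (hδ.2.le.trans (min_le_left _ _)) (w (Φ (x, δ)))
    have h3 := abs_sub_abs_le_abs_sub (f δ (w (Φ (x, δ)))) (f₀ (w (Φ (x, δ))))
    have h4 : δ ≤ 1 := hδ.2.le.trans (min_le_left _ _)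
    have e : greenField (f δ) w ψ (Φ (x, δ)) (N x) =
        f δ (w (Φ (x, δ))) * fderiv ℝ ψ (Φ (x, δ)) (N x) -
          ψ (Φ (x, δ)) * (deriv (f δ) (w (Φ (x, δ))) * D (Φ (x, δ)) (N x)) := by
      rw [hD, fderivWithin_compl_eq_fderiv (hext δ hδ x hx')]
      simp [greenField]
      ring
    rw [e, Real.norm_eq_abs]
    refine (abs_sub _ _).trans (add_le_add ?_ ?_)
    · rw [abs_mul]
      exact mul_le_mul_of_nonneg_right (by linarith) (abs_nonneg _)
    · rw [abs_mul, abs_mul]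
      refine mul_le_mul_of_nonneg_left ?_ (abs_nonneg _)
      exact mul_le_of_le_one_left (abs_nonneg _) h2
  · refine ae_of_all _ fun x hx => ?_
    have hx' := huIcc x hx
    have hline : Tendsto (fun δ : ℝ => (x, δ)) (𝓝[>] 0) (𝓝[K] (x, 0)) := by
      refine tendsto_nhdsWithin_iff.2 ⟨?_, hev.mono fun δ hδ => hmemK δ hδ x hx'⟩
      exact ((by fun_prop : Continuous fun δ : ℝ => (x, δ)).tendsto 0).mono_left
        nhdsWithin_le_nhds
    have hx0 : (x, (0 : ℝ)) ∈ K := ⟨⟨hx'.1, le_rfl⟩, ⟨hx'.2, hr₁.le⟩⟩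
    have hw00 : w (Φ (x, 0)) = 0 := hw.boundary _ (hc.graphMap_mem_frontier hO
      (abs_lt.2 ⟨by linarith [hx'.1], by linarith [hx'.2]⟩))
    -- By the Dirichlet condition the half `f(w) dψ` of the field disappears in the limit; only the
    -- normal derivative of `w` remains.
    have t1 : Tendsto (fun δ => f δ (w (Φ (x, δ)))) (𝓝[>] 0) (𝓝 0) := by
      have h1 : Tendsto (fun δ => f₀ (w (Φ (x, δ)))) (𝓝[>] 0) (𝓝 0) := by
        have := ((hf.continuous.comp_continuousOn hwK) (x, 0) hx0).tendsto.comp hline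
        simpa [hw00, hf.zero, Function.comp_def] using this
      have h2 : Tendsto (fun δ => f δ (w (Φ (x, δ))) - f₀ (w (Φ (x, δ)))) (𝓝[>] 0) (𝓝 0) := by
        refine squeeze_zero_norm' (a := fun δ : ℝ => δ) ?_ (tendsto_id.mono_left nhdsWithin_le_nhds)
        filter_upwards [hev] with δ hδ
        exact hf.abs_sub_le δ hδ.1 (hδ.2.le.trans (min_le_left _ _)) _
      simpa using h2.add h1
    have hΦline : Tendsto (fun δ : ℝ => Φ (x, δ)) (𝓝[>] 0) (𝓝 (Φ (x, 0))) :=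
      (hΦc.tendsto (x, 0)).comp (hline.mono_right nhdsWithin_le_nhds)
    have t2 : Tendsto (fun δ => fderiv ℝ ψ (Φ (x, δ)) (N x)) (𝓝[>] 0)
        (𝓝 (fderiv ℝ ψ (Φ (x, 0)) (N x))) :=
      ((hdψc.clm_apply continuous_const).tendsto (Φ (x, 0))).comp hΦline
    have t3 : Tendsto (fun δ => ψ (Φ (x, δ))) (𝓝[>] 0) (𝓝 (ψ (Φ (x, 0)))) :=
      (hψc.tendsto (Φ (x, 0))).comp hΦline
    have t := (t1.mul t2).sub (t3.mul (hL x hx'))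
    rw [zero_mul, zero_sub] at t
    refine t.congr' ?_
    filter_upwards [hev] with δ hδ
    rw [hD, fderivWithin_compl_eq_fderiv (hext δ hδ x hx')]
    simp [greenField, hN]
    ring

end LocalGreen


/-! ### Green's formula and Kato's inequality near a smooth boundary point. -/

section LocalGreen

variable {𝒪 : Set Plane} {b : OrthonormalBasis (Fin 2) ℝ Plane} {p : Plane} {h : ℝ → ℝ}
  {a r a₁ r₁ lam : ℝ} {w ψ : Plane → ℝ} {ν : Plane → Plane}

/-- Green's formula for the test function `ψ`, and Kato's inequality when `ψ ≥ 0`. -/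
structure GreenHolds (𝒪 : Set Plane) (ν : Plane → Plane) (lam : ℝ) (w ψ : Plane → ℝ) : Prop where
  integrableOn : IntegrableOn (fun y => ψ y * fderivWithin ℝ w 𝒪ᶜ y (ν y)) (frontier 𝒪)
    (Measure.hausdorffMeasure 1)
  integral_eq : ∫ y in frontier 𝒪, ψ y * fderivWithin ℝ w 𝒪ᶜ y (ν y)
    ∂(Measure.hausdorffMeasure 1) = ∫ y in (closure 𝒪)ᶜ, w y * ((Δ ψ) y + lam ^ 2 * ψ y)
  integral_abs_le : (∀ y, 0 ≤ ψ y) → ∫ y in frontier 𝒪, ψ y * |fderivWithin ℝ w 𝒪ᶜ y (ν y)|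
    ∂(Measure.hausdorffMeasure 1) ≤ ∫ y in (closure 𝒪)ᶜ, |w y| * ((Δ ψ) y + lam ^ 2 * ψ y)

theorem IsGraphChart.mono (hc : IsGraphChart 𝒪 b p h a r) (ha₁ : 0 < a₁) (haa : a₁ ≤ a)
    (hr₁ : 0 < r₁) (hrr : r₁ ≤ r) : IsGraphChart 𝒪 b p h a₁ r₁ :=
  ⟨hc.contDiff, ha₁, hr₁, fun z h1 h2 => hc.mem_iff z (h1.trans haa) (h2.trans hrr)⟩

/-- The same `δ` is the height above the boundary and the regularization parameter. Since `v(δ) ≈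
αδ`, the square `v(δ)²` dominates `δ⁴`, and `v/√(v² + δ⁴)` tends to the sign of `α`. This is the
reason for the fourth power in `smoothAbs`. -/
theorem tendsto_deriv_smoothAbs {v : ℝ → ℝ} {α : ℝ} (hα : α ≠ 0)
    (hv : Tendsto (fun t => v t / t) (𝓝[>] 0) (𝓝 α)) :
    Tendsto (fun δ => deriv (smoothAbs δ) (v δ)) (𝓝[>] 0) (𝓝 (α / |α|)) := by
  have h1 : Tendsto (fun δ : ℝ => δ ^ 2) (𝓝[>] 0) (𝓝 0) := by
    have := ((continuous_pow 2).tendsto (0 : ℝ)).mono_left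
      (nhdsWithin_le_nhds (s := Ioi 0))
    simpa using this
  have h2 : Tendsto (fun δ => v δ / δ / √((v δ / δ) ^ 2 + δ ^ 2)) (𝓝[>] 0)
      (𝓝 (α / √(α ^ 2 + 0))) := by
    refine hv.div (((hv.pow 2).add h1).sqrt) ?_
    rw [add_zero, Real.sqrt_sq_eq_abs]
    exact abs_ne_zero.2 hα
  rw [add_zero, Real.sqrt_sq_eq_abs] at h2
  refine h2.congr' ?_
  filter_upwards [self_mem_nhdsWithin] with δ hδ
  have hδ : 0 < δ := hδ
  rw [(hasDerivAt_smoothAbs hδ (v δ)).deriv, smoothAbs]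
  have e : v δ ^ 2 + δ ^ 4 = δ ^ 2 * ((v δ / δ) ^ 2 + δ ^ 2) := by field_simp
  rw [e, Real.sqrt_mul (by positivity), Real.sqrt_sq hδ.le, div_div]

/-- Along the boundary the derivative of a Dirichlet solution is normal. -/
theorem IsGraphChart.fderivWithin_normal (hc : IsGraphChart 𝒪 b p h a r) (hO : IsOpen 𝒪)
    (hw0 : ∀ y ∈ frontier 𝒪, w y = 0) {x : ℝ} (hx : |x| < a)
    (hd : DifferentiableWithinAt ℝ w 𝒪ᶜ (graphMap b p h (x, 0))) :
    fderivWithin ℝ w 𝒪ᶜ (graphMap b p h (x, 0)) (b 1 - deriv h x • b 0) =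
      (1 + deriv h x ^ 2) * fderivWithin ℝ w 𝒪ᶜ (graphMap b p h (x, 0)) (b 1) ∧
    Tendsto (fun t => w (graphMap b p h (x, t)) / t) (𝓝[>] 0)
      (𝓝 (fderivWithin ℝ w 𝒪ᶜ (graphMap b p h (x, 0)) (b 1))) := by
  have hdh := hc.contDiff.differentiable (by norm_num)
  have hD := hd.hasFDerivWithinAt
  set D := fderivWithin ℝ w 𝒪ᶜ (graphMap b p h (x, 0))
  constructor
  · have h1 := (hasDerivAt_graphMap_fst (b := b) (p := p) hdh x).hasDerivWithinAt
      (s := Ioo (-a) a)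
    have h2 := hD.comp_hasDerivWithinAt x h1 fun x' hx' =>
      hc.graphMap_mem_compl (z := (x', 0)) (abs_lt.2 hx').le le_rfl hc.r_pos.le
    have h3 := h2.hasDerivAt (isOpen_Ioo.mem_nhds (abs_lt.1 hx))
    have h4 : (w ∘ fun x => graphMap b p h (x, 0)) =ᶠ[𝓝 x] fun _ => 0 := by
      filter_upwards [isOpen_Ioo.mem_nhds (abs_lt.1 hx)] with x' hx'
      exact hw0 _ (hc.graphMap_mem_frontier hO (abs_lt.2 hx'))
    have h5 := h3.unique ((hasDerivAt_const x (0 : ℝ)).congr_of_eventuallyEq h4)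
    simp only [map_add, map_sub, map_smul, smul_eq_mul] at h5 ⊢
    have : D (b 0) = -(deriv h x * D (b 1)) := by linarith
    rw [this]
    ring
  · have h1 : HasDerivAt (fun t : ℝ => graphMap b p h (x, t)) (b 1) 0 := by
      have h1 : HasDerivAt (fun t : ℝ => (x, t)) ((0 : ℝ), (1 : ℝ)) 0 :=
        (hasDerivAt_const 0 x).prodMk (hasDerivAt_id 0)
      refine ((hasFDerivAt_graphMap (b := b) (p := p) hdh (x, 0)).comp_hasDerivAt 0 h1).congr_deriv
        ?_
      simp
    have h2 := hD.comp_hasDerivWithinAt (0 : ℝ) (h1.hasDerivWithinAt (s := Ico 0 r)) fun t ht =>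
      hc.graphMap_mem_compl (z := (x, t)) hx.le ht.1 ht.2.le
    have h3 := (hasDerivWithinAt_iff_tendsto_slope.1 h2)
    have h4 : 𝓝[Ico 0 r \ {(0 : ℝ)}] (0 : ℝ) = 𝓝[>] 0 := by
      have : Ico 0 r \ {(0 : ℝ)} = Ioo 0 r := by
        ext t
        simp only [Set.mem_sdiff, mem_Ico, mem_singleton_iff, mem_Ioo]
        constructor
        · rintro ⟨⟨h1, h2⟩, h3⟩
          exact ⟨lt_of_le_of_ne h1 (Ne.symm h3), h2⟩
        · rintro ⟨h1, h2⟩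
          exact ⟨⟨h1.le, h2⟩, h1.ne'⟩
      rw [this, nhdsWithin_Ioo_eq_nhdsGT hc.r_pos]
    rw [h4] at h3
    refine h3.congr fun t => ?_
    rw [slope_def_field, Function.comp_apply, Function.comp_apply,
      hw0 _ (hc.graphMap_mem_frontier hO hx), sub_zero, sub_zero]

/-- Above the level `δ` the solution is `C²` on a neighbourhood, so the divergence theorem applies,
and the side and top faces miss the support of `ψ`. Let `δ → 0`, with `f` the identity for the
equality and `f = smoothAbs δ` for the inequality. -/
theorem IsGraphChart.greenHolds (hc : IsGraphChart 𝒪 b p h a r) (hO : IsOpen 𝒪)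
    (hcorner : Disjoint (chartBox b p h a r) (corners 𝒪)) (hw : IsDirichletSolution 𝒪 lam w)
    (hν : ∀ x ∈ frontier 𝒪 \ corners 𝒪, IsOutwardUnitNormal 𝒪 x (ν x))
    (ha₁ : 0 < a₁) (haa : a₁ < a) (hr₁ : 0 < r₁) (hrr : r₁ < r)
    (hψ : ContDiff ℝ 2 ψ) (hsupp : tsupport ψ ⊆ chartBox b p h a₁ r₁) :
    GreenHolds 𝒪 ν lam w ψ := by
  set Φ := graphMap b p h with hΦ
  have hΦc : Continuous Φ := hc.contDiff.graphMap.continuous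
  set N : ℝ → Plane := fun x => b 1 - deriv h x • b 0 with hN
  have hNc : Continuous N := by
    have := hc.contDiff.deriv_one.continuous
    fun_prop
  set D := fderivWithin ℝ w 𝒪ᶜ with hD
  have habs : ∀ x ∈ Icc (-a₁) a₁, |x| < a := fun x hx =>
    abs_lt.2 ⟨by linarith [hx.1], by linarith [hx.2]⟩
  have hbox : ∀ z ∈ Icc (-a₁, 0) (a₁, r₁), Φ z ∈ chartBox b p h a r ∩ 𝒪ᶜ := fun z hz => by
    have h1 : |z.1| < a := abs_lt.2 ⟨by linarith [hz.1.1], by linarith [hz.2.1]⟩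
    have h2 : |z.2| < r := abs_lt.2 ⟨by linarith [hz.1.2], by linarith [hz.2.2]⟩
    exact ⟨graphMap_mem_chartBox.2 ⟨h1, h2⟩,
      hc.graphMap_mem_compl h1.le hz.1.2 (abs_lt.1 h2).2.le⟩
  have hw1 : ContDiffOn ℝ 1 w (chartBox b p h a r ∩ 𝒪ᶜ) :=
    (hw.contDiffOn.mono fun y hy =>
      ⟨hy.2, fun h => hcorner.le_bot ⟨hy.1, h⟩⟩).of_le (by norm_num)
  have hDc := hc.continuousOn_fderivWithin hw1
  have hdiff : ∀ y ∈ chartBox b p h a r ∩ 𝒪ᶜ, DifferentiableWithinAt ℝ w 𝒪ᶜ y := by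
    intro y hy
    have := (hw1.differentiableOn (by norm_num)) y hy
    rw [inter_comm] at this
    exact (differentiableWithinAt_inter (hc.isOpen_chartBox.mem_nhds hy.1)).1 this
  have hx0 : ∀ x ∈ Icc (-a₁) a₁, (x, (0 : ℝ)) ∈ Icc (-a₁, (0 : ℝ)) (a₁, r₁) := fun x hx =>
    ⟨⟨hx.1, le_rfl⟩, ⟨hx.2, hr₁.le⟩⟩
  have hev : ∀ᶠ δ in 𝓝[>] (0 : ℝ), δ ∈ Ioo 0 (min 1 r₁) := Ioo_mem_nhdsGT (by positivity)
  have hDN : ∀ x ∈ Icc (-a₁) a₁, Tendsto (fun δ => D (Φ (x, δ)) (N x)) (𝓝[>] 0)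
      (𝓝 (D (Φ (x, 0)) (N x))) := by
    intro x hx
    have hline : Tendsto (fun δ : ℝ => Φ (x, δ)) (𝓝[>] 0)
        (𝓝[chartBox b p h a r ∩ 𝒪ᶜ] (Φ (x, 0))) := by
      refine tendsto_nhdsWithin_iff.2 ⟨?_, hev.mono fun δ hδ => hbox _
        ⟨⟨hx.1, hδ.1.le⟩, ⟨hx.2, hδ.2.le.trans (min_le_right _ _)⟩⟩⟩
      exact ((hΦc.comp (by fun_prop : Continuous fun δ : ℝ => (x, δ))).tendsto 0).mono_left
        nhdsWithin_le_nhds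
    exact ((ContinuousLinearMap.apply ℝ ℝ (N x)).continuous.tendsto _).comp
      ((hDc _ (hbox _ (hx0 x hx))).tendsto.comp hline)
  -- the boundary integrals in coordinates
  have hc₁ := hc.mono ha₁ haa.le hr₁ hrr.le
  have hnormal : ∀ x ∈ Icc (-a₁) a₁,
      √(1 + deriv h x ^ 2) * D (Φ (x, 0)) (ν (Φ (x, 0))) = D (Φ (x, 0)) (N x) := by
    intro x hx
    have h1 : Φ (x, 0) ∈ frontier 𝒪 \ corners 𝒪 := ⟨hc.graphMap_mem_frontier hO (habs x hx),
      fun h => hcorner.le_bot ⟨(hbox _ (hx0 x hx)).1, h⟩⟩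
    rw [hc.eq_of_isOutwardUnitNormal hO (habs x hx) (hν _ h1), map_smul, smul_eq_mul,
      mul_inv_cancel_left₀ (by positivity)]
  have hDNc : ContinuousOn (fun x => D (Φ (x, 0)) (N x)) (Icc (-a₁) a₁) :=
    ContinuousOn.clm_apply (hDc.comp (by fun_prop : Continuous fun x : ℝ => Φ (x, 0)).continuousOn
      fun x hx => hbox _ (hx0 x hx)) hNc.continuousOn
  have hψc : Continuous fun x : ℝ => ψ (Φ (x, 0)) := hψ.continuous.comp (by fun_prop)
  have hsub : Function.support ψ ⊆ chartBox b p h a₁ r₁ := (subset_tsupport ψ).trans hsupp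
  have hB1 := hc₁.integrableOn_frontier hO (k := fun y => ψ y * D y (ν y))
    (fun y hy => hsub (left_ne_zero_of_mul hy)) (by
      refine ((hψc.continuousOn.mul hDNc).integrableOn_compact isCompact_Icc).mono_set
        Ioo_subset_Icc_self |>.congr_fun (fun x hx => ?_) measurableSet_Ioo
      simp only [Pi.mul_apply]
      rw [← hnormal x (Ioo_subset_Icc_self hx)]
      ring)
  have hB2 := hc₁.integrableOn_frontier hO (k := fun y => ψ y * |D y (ν y)|)
    (fun y hy => hsub (left_ne_zero_of_mul hy)) (by
      refine ((hψc.continuousOn.mul hDNc.abs).integrableOn_compact isCompact_Icc).mono_set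
        Ioo_subset_Icc_self |>.congr_fun (fun x hx => ?_) measurableSet_Ioo
      simp only [Pi.mul_apply]
      rw [← hnormal x (Ioo_subset_Icc_self hx), abs_mul, abs_of_nonneg (Real.sqrt_nonneg _)]
      ring)
  have hI1 : ∫ y in frontier 𝒪, ψ y * D y (ν y) ∂(Measure.hausdorffMeasure 1) =
      ∫ x in (-a₁)..a₁, ψ (Φ (x, 0)) * D (Φ (x, 0)) (N x) := by
    rw [hB1.2]
    refine intervalIntegral.integral_congr fun x hx => ?_
    rw [uIcc_of_le (by linarith)] at hx
    rw [← hnormal x hx]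
    ring
  have hI2 : ∫ y in frontier 𝒪, ψ y * |D y (ν y)| ∂(Measure.hausdorffMeasure 1) =
      ∫ x in (-a₁)..a₁, ψ (Φ (x, 0)) * |D (Φ (x, 0)) (N x)| := by
    rw [hB2.2]
    refine intervalIntegral.integral_congr fun x hx => ?_
    rw [uIcc_of_le (by linarith)] at hx
    rw [← hnormal x hx, abs_mul, abs_of_nonneg (Real.sqrt_nonneg _)]
    ring
  -- Green's identity above the level `δ`
  have hgreen : ∀ f : ℝ → ℝ, ContDiff ℝ 2 f → ∀ δ ∈ Ioo 0 (min 1 r₁),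
      ∫ z in Icc (-a₁, δ) (a₁, r₁), greenDiv b f w ψ (Φ z) =
        -∫ x in (-a₁)..a₁, greenField f w ψ (Φ (x, δ)) (N x) := by
    intro f hf δ hδ
    refine integral_greenDiv_graphMap hc.contDiff isClosed_closure.isOpen_compl hf
      hw.contDiffOn_exterior hψ ha₁.le (hδ.2.le.trans (min_le_right _ _)) (fun z hz => ?_)
      fun z hz hz' hzs => ?_
    · exact hc.graphMap_mem_exterior (abs_lt.2 ⟨by linarith [hz.1.1], by linarith [hz.2.1]⟩)
        (hδ.1.trans_le hz.1.2) (hz.2.2.trans_lt hrr)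
    · have h1 := graphMap_mem_chartBox.1 (hsupp hzs)
      rcases hz' with h2 | h2 | h2
      · rw [h2, abs_neg, abs_of_pos ha₁] at h1
        exact lt_irrefl _ h1.1
      · rw [h2, abs_of_pos ha₁] at h1
        exact lt_irrefl _ h1.1
      · rw [h2, abs_of_pos hr₁] at h1
        exact lt_irrefl _ h1.2
  have hhelm : ∀ δ ∈ Ioo 0 (min 1 r₁), ∀ z ∈ Icc (-a₁, δ) (a₁, r₁),
      (Δ w) (Φ z) = -(lam ^ 2 * w (Φ z)) := fun δ hδ z hz =>
    hw.helmholtz _ (hc.graphMap_mem_exterior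
      (abs_lt.2 ⟨by linarith [hz.1.1], by linarith [hz.2.1]⟩)
        (hδ.1.trans_le hz.1.2) (hz.2.2.trans_lt hrr))
  refine ⟨hB1.1, ?_, fun hψ0 => ?_⟩
  · rw [hI1]
    have t1 := hc.tendsto_integral_reducedDiv haa hr₁ hrr hw.continuousOn hw.boundary hO hψ hsupp
      (lam := lam) isRegularization_id
    have t2 := (hc.tendsto_integral_greenField hO hcorner hw ha₁ haa hr₁ hrr hψ isRegularization_id
      (L := fun x => D (Φ (x, 0)) (N x)) fun x hx =>
        (hDN x hx).congr fun δ => by simp only [deriv_id'', one_mul, hN, hΦ, hD]).neg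
    rw [neg_neg] at t2
    refine tendsto_nhds_unique t2 (t1.congr' ?_)
    filter_upwards [hev] with δ hδ
    refine Eq.trans ?_ (hgreen (fun t => t) contDiff_id δ hδ)
    refine setIntegral_congr_fun measurableSet_Icc fun z hz => ?_
    rw [greenDiv_eq_reducedDiv (hhelm δ hδ z hz)]
    simp [hΦ]
  · rw [hI2]
    have t1 := hc.tendsto_integral_reducedDiv haa hr₁ hrr hw.continuousOn hw.boundary hO hψ hsupp
      (lam := lam) isRegularization_smoothAbs
    have t2 := (hc.tendsto_integral_greenField hO hcorner hw ha₁ haa hr₁ hrr hψ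
      isRegularization_smoothAbs (L := fun x => |D (Φ (x, 0)) (N x)|) fun x hx => by
        obtain ⟨e1, e2⟩ := hc.fderivWithin_normal hO hw.boundary (habs x hx)
          (hdiff _ (hbox _ (hx0 x hx)))
        -- If the normal derivative vanishes, the factor `f'(w)` need not converge, but it is
        -- bounded by `1` and its companion tends to `0`. Otherwise the factor tends to the sign of
        -- the normal derivative.
        by_cases hα : fderivWithin ℝ w 𝒪ᶜ (graphMap b p h (x, 0)) (b 1) = 0
        · have h3 := hDN x hx
          rw [hD, hN, hΦ] at h3 ⊢
          simp only [e1, hα, mul_zero, abs_zero] at h3 ⊢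
          refine squeeze_zero_norm' ?_ (h3.norm.trans (by rw [norm_zero]))
          filter_upwards [hev] with δ hδ
          rw [norm_mul]
          exact mul_le_of_le_one_left (norm_nonneg _)
            (isRegularization_smoothAbs.abs_deriv_le δ hδ.1 (hδ.2.le.trans (min_le_left _ _)) _)
        · have h3 := (tendsto_deriv_smoothAbs hα e2).mul (hDN x hx)
          convert h3 using 2
          rw [hD, hN, hΦ]
          simp only [e1]
          rw [abs_mul, abs_of_nonneg (by positivity : 0 ≤ 1 + deriv h x ^ 2)]
          have := abs_pos.2 hα
          field_simp
          rw [sq_abs]).neg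
    rw [neg_neg] at t2
    refine le_of_tendsto_of_tendsto t2 t1 ?_
    filter_upwards [hev] with δ hδ
    rw [← hgreen _ (contDiff_smoothAbs hδ.1) δ hδ]
    have hK : ∀ z ∈ Icc (-a₁, δ) (a₁, r₁), Φ z ∈ (closure 𝒪)ᶜ := fun z hz =>
      hc.graphMap_mem_exterior (abs_lt.2 ⟨by linarith [hz.1.1], by linarith [hz.2.1]⟩)
        (hδ.1.trans_le hz.1.2) (hz.2.2.trans_lt hrr)
    have hwK : ContinuousOn (fun z => w (Φ z)) (Icc (-a₁, δ) (a₁, r₁)) :=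
      hw.contDiffOn_exterior.continuousOn.comp hΦc.continuousOn hK
    have hgd : ContinuousOn (fun z => greenDiv b (smoothAbs δ) w ψ (Φ z))
        (Icc (-a₁, δ) (a₁, r₁)) := by
      have h1 := (contDiffOn_greenField (contDiff_smoothAbs hδ.1)
        isClosed_closure.isOpen_compl hw.contDiffOn_exterior hψ).continuousOn_fderiv_of_isOpen
          isClosed_closure.isOpen_compl le_rfl
      have h2 : ContinuousOn (fun z => ∑ i, fderiv ℝ (greenField (smoothAbs δ) w ψ) (Φ z)
          (b i) (b i)) (Icc (-a₁, δ) (a₁, r₁)) :=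
        continuousOn_finsetSum _ fun i _ => ((h1.comp hΦc.continuousOn hK).clm_apply
          continuousOn_const).clm_apply continuousOn_const
      refine h2.congr fun z hz => ?_
      exact (sum_fderiv_greenField (contDiff_smoothAbs hδ.1) (hw.contDiffOn_exterior.contDiffAt
        (isClosed_closure.isOpen_compl.mem_nhds (hK z hz))) hψ).symm
    have hrd : ContinuousOn (fun z => reducedDiv lam (smoothAbs δ) w ψ (Φ z))
        (Icc (-a₁, δ) (a₁, r₁)) := by
      have h1 := (contDiff_smoothAbs hδ.1 (n := 2)).continuous.comp_continuousOn hwK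
      have h2 := (contDiff_smoothAbs hδ.1 (n := 2)).deriv_one.continuous.comp_continuousOn hwK
      exact (h1.mul ((continuous_laplacian hψ).comp hΦc).continuousOn).add
        ((continuous_const.mul (hψ.continuous.comp hΦc)).continuousOn.mul (hwK.mul h2))
    -- The two integrands differ by `ψ f''(w) |∇w|²`, which is nonnegative by convexity.
    refine setIntegral_mono_on (hgd.integrableOn_compact isCompact_Icc)
      (hrd.integrableOn_compact isCompact_Icc) measurableSet_Icc fun z hz => ?_
    rw [greenDiv_eq_reducedDiv (hhelm δ hδ z hz)]
    have := mul_nonneg (hψ0 (Φ z)) (mul_nonneg (deriv_deriv_smoothAbs_nonneg hδ.1 (w (Φ z)))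
      (Finset.sum_nonneg fun i (_ : i ∈ Finset.univ) => sq_nonneg (fderiv ℝ w (Φ z) (b i))))
    linarith

end LocalGreen


/-! ### Test functions supported near an arbitrary point which is not a corner. -/

section GlobalGreen

variable {𝒪 : Set Plane} {b : OrthonormalBasis (Fin 2) ℝ Plane} {p : Plane}
  {a r lam : ℝ} {w ψ : Plane → ℝ} {ν : Plane → Plane}

theorem greenHolds_of_integral (hψ : ∀ y ∈ frontier 𝒪, ψ y = 0)
    (h1 : ∫ y in (closure 𝒪)ᶜ, w y * ((Δ ψ) y + lam ^ 2 * ψ y) = 0)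
    (h2 : (∀ y, 0 ≤ ψ y) → 0 ≤ ∫ y in (closure 𝒪)ᶜ, |w y| * ((Δ ψ) y + lam ^ 2 * ψ y)) :
    GreenHolds 𝒪 ν lam w ψ := by
  refine ⟨?_, ?_, fun h0 => ?_⟩
  · exact (integrableOn_zero (ε' := ℝ)).congr_fun (fun y hy => by simp [hψ y hy])
      isClosed_frontier.measurableSet
  · rw [h1]
    exact setIntegral_eq_zero_of_forall_eq_zero fun y hy => by simp [hψ y hy]
  · refine le_of_eq_of_le ?_ (h2 h0)
    exact setIntegral_eq_zero_of_forall_eq_zero fun y hy => by simp [hψ y hy]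

/-- On a box inside the exterior `ψ` vanishes near all four sides, so the divergence integrates to
zero: this is Green's formula without boundary term, and convexity again gives the inequality. -/
theorem greenHolds_of_subset_exterior (hw : IsDirichletSolution 𝒪 lam w) (ha : 0 < a) (hr : 0 < r)
    (hbox : ∀ z ∈ Icc (-a, -r) (a, r), graphMap b p (fun _ => 0) z ∈ (closure 𝒪)ᶜ)
    (hψ : ContDiff ℝ 2 ψ) (hsupp : tsupport ψ ⊆ chartBox b p (fun _ => 0) a r) :
    GreenHolds 𝒪 ν lam w ψ := by
  have hh : ContDiff ℝ 2 fun _ : ℝ => (0 : ℝ) := contDiff_const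
  set Φ := graphMap b p (fun _ => 0) with hΦ
  have hΦc : Continuous Φ := hh.graphMap.continuous
  have hΩ : IsOpen (closure 𝒪)ᶜ := isClosed_closure.isOpen_compl
  have hside : ∀ z : ℝ × ℝ, |z.1| = a ∨ |z.2| = r → Φ z ∉ tsupport ψ := by
    intro z hz hzs
    have h1 := graphMap_mem_chartBox.1 (hsupp hzs)
    rcases hz with h2 | h2
    · exact h1.1.ne h2
    · exact h1.2.ne h2
  have hgreen : ∀ f : ℝ → ℝ, ContDiff ℝ 2 f →
      ∫ z in Icc (-a, -r) (a, r), greenDiv b f w ψ (Φ z) = 0 := by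
    intro f hf
    rw [integral_greenDiv_graphMap hh hΩ hf hw.contDiffOn_exterior hψ ha.le (by linarith) hbox
      fun z _ hz' => hside z ?_]
    · rw [intervalIntegral.integral_congr (g := fun _ => 0), intervalIntegral.integral_zero, neg_zero]
      intro x _
      have h1 := hside (x, -r) (Or.inr (by simp [abs_of_pos hr]))
      have h2 : fderiv ℝ ψ (Φ (x, -r)) = 0 := by
        rw [notMem_tsupport_iff_eventuallyEq] at h1
        rw [h1.fderiv_eq]; simp
      rw [hΦ] at h1 h2
      simp [greenField, h2, image_eq_zero_of_notMem_tsupport h1]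
    · rcases hz' with h | h | h
      · exact Or.inl (by rw [h, abs_neg, abs_of_pos ha])
      · exact Or.inl (by rw [h, abs_of_pos ha])
      · exact Or.inr (by rw [h, abs_of_pos hr])
  have hvol : ∀ g : ℝ → ℝ, ∫ y in (closure 𝒪)ᶜ, g (w y) * ((Δ ψ) y + lam ^ 2 * ψ y) =
      ∫ z in Icc (-a, -r) (a, r), g (w (Φ z)) * ((Δ ψ) (Φ z) + lam ^ 2 * ψ (Φ z)) := by
    intro g
    rw [← (measurePreserving_graphMap (b := b) (p := p) continuous_const).setIntegral_preimage_emb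
      (graphHomeomorph b p hh).measurableEmbedding]
    refine setIntegral_eq_of_subset_of_forall_sdiff_eq_zero
      (hΩ.preimage hΦc).measurableSet hbox ?_
    rintro z ⟨_, h2⟩
    have h1 : Φ z ∉ tsupport ψ := fun h => h2 <| by
      have h3 := graphMap_mem_chartBox.1 (hsupp h)
      rw [abs_lt, abs_lt] at h3
      exact ⟨⟨h3.1.1.le, h3.2.1.le⟩, ⟨h3.1.2.le, h3.2.2.le⟩⟩
    rw [laplacian_eq_zero_of_notMem_tsupport h1, image_eq_zero_of_notMem_tsupport h1]
    simp
  have hwK : ContinuousOn (fun z => w (Φ z)) (Icc (-a, -r) (a, r)) :=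
    hw.contDiffOn_exterior.continuousOn.comp hΦc.continuousOn hbox
  have hψf : ∀ y ∈ frontier 𝒪, ψ y = 0 := by
    intro y hy
    by_contra hne
    have h1 := hsupp (subset_tsupport ψ hne)
    refine hbox (graphCoord b p (fun _ => 0) y)
      ⟨⟨h1.1.1.le, h1.2.1.le⟩, ⟨h1.1.2.le, h1.2.2.le⟩⟩ ?_
    rw [hΦ, graphMap_graphCoord]
    exact hy.1
  refine greenHolds_of_integral hψf ?_ fun hψ0 => ?_
  · rw [hvol fun t => t, ← hgreen _ contDiff_id]
    refine setIntegral_congr_fun measurableSet_Icc fun z hz => ?_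
    rw [greenDiv_eq_reducedDiv (lam := lam) (hw.helmholtz _ (hbox z hz))]
    simp [reducedDiv]
    ring
  · rw [hvol fun t => |t|]
    set q₀ : ℝ × ℝ → ℝ := fun z => |w (Φ z)| * ((Δ ψ) (Φ z) + lam ^ 2 * ψ (Φ z)) with hq₀
    have hΔc := continuous_laplacian hψ
    have hψc := hψ.continuous
    have hq₀i : IntegrableOn q₀ (Icc (-a, -r) (a, r)) :=
      (hwK.abs.mul (by fun_prop : Continuous _).continuousOn).integrableOn_compact isCompact_Icc
    have hBi : IntegrableOn (fun z => |(Δ ψ) (Φ z)| + lam ^ 2 * |ψ (Φ z)|) (Icc (-a, -r) (a, r)) :=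
      (by fun_prop : Continuous _).continuousOn.integrableOn_compact isCompact_Icc
    set C := ∫ z in Icc (-a, -r) (a, r), (|(Δ ψ) (Φ z)| + lam ^ 2 * |ψ (Φ z)|)
    -- The integral of `greenDiv` is zero, and pointwise `greenDiv` is at most `reducedDiv`, which
    -- exceeds `q₀` by at most `δ (|Δψ| + λ²|ψ|)`.
    have key : ∀ δ ∈ Ioc (0 : ℝ) 1, 0 ≤ (∫ z in Icc (-a, -r) (a, r), q₀ z) + δ * C := by
      intro δ hδ
      rw [← integral_const_mul, ← integral_add hq₀i (hBi.const_mul δ),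
        ← hgreen _ (contDiff_smoothAbs hδ.1)]
      have hgd : ContinuousOn (fun z => greenDiv b (smoothAbs δ) w ψ (Φ z))
          (Icc (-a, -r) (a, r)) := by
        have h1 := (contDiffOn_greenField (contDiff_smoothAbs hδ.1)
          hΩ hw.contDiffOn_exterior hψ).continuousOn_fderiv_of_isOpen hΩ le_rfl
        have h2 : ContinuousOn (fun z => ∑ i, fderiv ℝ (greenField (smoothAbs δ) w ψ) (Φ z)
            (b i) (b i)) (Icc (-a, -r) (a, r)) :=
          continuousOn_finsetSum _ fun i _ => ((h1.comp hΦc.continuousOn hbox).clm_apply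
            continuousOn_const).clm_apply continuousOn_const
        refine h2.congr fun z hz => ?_
        exact (sum_fderiv_greenField (contDiff_smoothAbs hδ.1) (hw.contDiffOn_exterior.contDiffAt
          (hΩ.mem_nhds (hbox z hz))) hψ).symm
      refine setIntegral_mono_on (hgd.integrableOn_compact isCompact_Icc)
        (hq₀i.add (hBi.const_mul δ)) measurableSet_Icc fun z hz => ?_
      rw [greenDiv_eq_reducedDiv (lam := lam) (hw.helmholtz _ (hbox z hz))]
      have h1 := mul_nonneg (hψ0 (Φ z)) (mul_nonneg (deriv_deriv_smoothAbs_nonneg hδ.1 (w (Φ z)))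
        (Finset.sum_nonneg fun i (_ : i ∈ Finset.univ) => sq_nonneg (fderiv ℝ w (Φ z) (b i))))
      have h2 := (abs_le.1 (abs_reducedDiv_sub_le (lam := lam) (w := w) (ψ := ψ)
        isRegularization_smoothAbs hδ.1 hδ.2 (Φ z))).2
      simp only [hq₀]
      linarith
    have hlim : Tendsto (fun δ : ℝ => (∫ z in Icc (-a, -r) (a, r), q₀ z) + δ * C) (𝓝[>] 0)
        (𝓝 ((∫ z in Icc (-a, -r) (a, r), q₀ z) + 0 * C)) :=
      ((by fun_prop : Continuous fun δ : ℝ => (∫ z in Icc (-a, -r) (a, r), q₀ z) + δ * C).tendsto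
        0).mono_left nhdsWithin_le_nhds
    rw [zero_mul, add_zero] at hlim
    refine ge_of_tendsto hlim ?_
    filter_upwards [Ioc_mem_nhdsGT (zero_lt_one' ℝ)] with δ hδ using key δ hδ

/-- Green's formula holds for test functions supported near a point which is not a corner. -/
theorem exists_nhds_greenHolds (hO : IsOpen 𝒪)
    (hw : IsDirichletSolution 𝒪 lam w)
    (hν : ∀ x ∈ frontier 𝒪 \ corners 𝒪, IsOutwardUnitNormal 𝒪 x (ν x)) {y : Plane}
    (hy : y ∉ corners 𝒪) : ∃ V, IsOpen V ∧ y ∈ V ∧ ∀ ψ : Plane → ℝ, ContDiff ℝ 2 ψ →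
      tsupport ψ ⊆ V → GreenHolds 𝒪 ν lam w ψ := by
  by_cases hyO : y ∈ 𝒪
  · refine ⟨𝒪, hO, hyO, fun ψ _ hψs => ?_⟩
    have h0 : ∀ z ∈ (closure 𝒪)ᶜ, ∀ t : ℝ, t * ((Δ ψ) z + lam ^ 2 * ψ z) = 0 := fun z hz t => by
      have h1 : z ∉ tsupport ψ := fun h => hz (subset_closure (hψs h))
      rw [laplacian_eq_zero_of_notMem_tsupport h1, image_eq_zero_of_notMem_tsupport h1]
      simp
    refine greenHolds_of_integral (fun z hz => ?_)
      (setIntegral_eq_zero_of_forall_eq_zero fun z hz => h0 z hz _) fun _ =>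
      (setIntegral_eq_zero_of_forall_eq_zero fun z hz => h0 z hz _).ge
    rw [hO.frontier_eq] at hz
    exact image_eq_zero_of_notMem_tsupport fun h => hz.2 (hψs h)
  by_cases hyf : y ∈ frontier 𝒪
  · obtain ⟨-, U, ρ, hρ⟩ : IsSmoothBoundaryPoint 𝒪 y := by
      by_contra hcon
      exact hy ⟨hyf, hcon⟩
    obtain ⟨b, h, a, r, hc, hh0, hU⟩ := exists_isGraphChart hO hyf hρ
    have hcorner : Disjoint (chartBox b y h a r) (corners 𝒪) := by
      rw [Set.disjoint_left]
      intro z hz hzc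
      refine hzc.2 ⟨hzc.1, U, ρ, hρ.isOpen, ?_, hρ.contDiffOn, hρ.gradient_ne_zero, hρ.mem_iff⟩
      have := hU (graphCoord b y h z) (abs_lt.2 hz.1).le (abs_lt.2 hz.2).le
      rwa [graphMap_graphCoord] at this
    have ha := hc.a_pos
    have hr := hc.r_pos
    refine ⟨chartBox b y h (a / 2) (r / 2),
      (hc.mono (half_pos ha) (by linarith) (half_pos hr) (by linarith)).isOpen_chartBox, ?_,
      fun ψ hψ hψs => hc.greenHolds hO hcorner hw hν (half_pos ha) (by linarith) (half_pos hr)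
        (by linarith) hψ hψs⟩
    have : graphMap b y h (0, 0) = y := by simp [graphMap, frameMap, hh0]
    have h2 : graphMap b y h (0, 0) ∈ chartBox b y h (a / 2) (r / 2) :=
      graphMap_mem_chartBox.2 ⟨by simpa using ha, by simpa using hr⟩
    rwa [this] at h2
  · have hyΩ : y ∈ (closure 𝒪)ᶜ := fun h => hyf (by rw [hO.frontier_eq]; exact ⟨h, hyO⟩)
    obtain ⟨b⟩ : Nonempty (OrthonormalBasis (Fin 2) ℝ Plane) :=
      ⟨EuclideanSpace.basisFun (Fin 2) ℝ⟩
    have hh : ContDiff ℝ 2 fun _ : ℝ => (0 : ℝ) := contDiff_const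
    have h0 : graphMap b y (fun _ => 0) (0, 0) = y := by simp [graphMap, frameMap]
    have hnear : ∀ᶠ z in 𝓝 ((0 : ℝ), (0 : ℝ)), graphMap b y (fun _ => 0) z ∈ (closure 𝒪)ᶜ := by
      refine (hh.graphMap (b := b) (p := y)).continuous.continuousAt ?_
      rw [h0]
      exact isClosed_closure.isOpen_compl.mem_nhds hyΩ
    obtain ⟨s, hs, hball⟩ := Metric.eventually_nhds_iff_ball.1 hnear
    refine ⟨chartBox b y (fun _ => 0) (s / 2) (s / 2), (isOpen_Ioo.prod isOpen_Ioo).preimage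
      (continuous_graphCoord hh.continuous), ?_, fun ψ hψ hψs =>
        greenHolds_of_subset_exterior hw (half_pos hs) (half_pos hs) (fun z hz => hball z ?_) hψ hψs⟩
    · have h2 : graphMap b y (fun _ => 0) (0, 0) ∈ chartBox b y (fun _ => 0) (s / 2) (s / 2) :=
        graphMap_mem_chartBox.2 ⟨by simpa using hs, by simpa using hs⟩
      rwa [h0] at h2
    · have h1 : |z.1| ≤ s / 2 := abs_le.2 ⟨hz.1.1, hz.2.1⟩
      have h2 : |z.2| ≤ s / 2 := abs_le.2 ⟨hz.1.2, hz.2.2⟩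
      rw [Metric.mem_ball, ← Prod.zero_eq_mk, dist_zero_right, Prod.norm_def, max_lt_iff, Real.norm_eq_abs,
        Real.norm_eq_abs]
      exact ⟨by linarith, by linarith⟩

end GlobalGreen


/-! ### Localization by a partition of unity. -/

section Partition

variable {𝒪 : Set Plane} {lam : ℝ} {w ψ χ : Plane → ℝ} {ν : Plane → Plane}

theorem integrableOn_mul_of_hasCompactSupport {𝔸 : Type*} [RCLike 𝔸] {g k : Plane → 𝔸}
    (hO : IsOpen 𝒪) (hg : ContinuousOn g 𝒪ᶜ) (hk : Continuous k) (hkc : HasCompactSupport k) :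
    IntegrableOn (fun y => g y * k y) (closure 𝒪)ᶜ := by
  have h1 : IntegrableOn (fun y => g y * k y) (tsupport k ∩ 𝒪ᶜ) := by
    refine ContinuousOn.integrableOn_compact (hkc.inter_right hO.isClosed_compl) ?_
    exact (hg.mul hk.continuousOn).mono inter_subset_right
  have h2 : IntegrableOn (fun y => g y * k y) 𝒪ᶜ :=
    h1.of_forall_sdiff_eq_zero hO.isClosed_compl.measurableSet fun y hy => by
      rw [image_eq_zero_of_notMem_tsupport fun h => hy.2 ⟨h, hy.1⟩, mul_zero]
  exact h2.mono_set (compl_subset_compl.2 subset_closure)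

theorem hasCompactSupport_helmholtz (hψ : HasCompactSupport ψ) :
    HasCompactSupport fun y => (Δ ψ) y + lam ^ 2 * ψ y :=
  HasCompactSupport.intro hψ fun y hy => by
    rw [laplacian_eq_zero_of_notMem_tsupport hy, image_eq_zero_of_notMem_tsupport hy]
    simp

theorem continuous_helmholtz (hψ : ContDiff ℝ 2 ψ) :
    Continuous fun y => (Δ ψ) y + lam ^ 2 * ψ y :=
  (continuous_laplacian hψ).add (continuous_const.mul hψ.continuous)

theorem integrableOn_volume (hO : IsOpen 𝒪) (hw : ContinuousOn w 𝒪ᶜ) (hψ : ContDiff ℝ 2 ψ)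
    (hψc : HasCompactSupport ψ) :
    IntegrableOn (fun y => w y * ((Δ ψ) y + lam ^ 2 * ψ y)) (closure 𝒪)ᶜ :=
  integrableOn_mul_of_hasCompactSupport hO hw (continuous_helmholtz hψ)
    (hasCompactSupport_helmholtz hψc)

/-- Kato's inequality is available only for nonnegative test functions, so it adds up only if the
summands are nonnegative whenever the sum is. The condition `hnn` holds for pieces of one function
cut by nonnegative weights. -/
theorem GreenHolds.add (hO : IsOpen 𝒪) (hw : ContinuousOn w 𝒪ᶜ) (hψ : ContDiff ℝ 2 ψ)
    (hψc : HasCompactSupport ψ) (hχ : ContDiff ℝ 2 χ) (hχc : HasCompactSupport χ)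
    (h1 : GreenHolds 𝒪 ν lam w ψ) (h2 : GreenHolds 𝒪 ν lam w χ)
    (hnn : (∀ y, 0 ≤ ψ y + χ y) → (∀ y, 0 ≤ ψ y) ∧ ∀ y, 0 ≤ χ y) :
    GreenHolds 𝒪 ν lam w fun y => ψ y + χ y := by
  have e : ∀ y, (Δ fun y => ψ y + χ y) y = (Δ ψ) y + (Δ χ) y := fun y =>
    hψ.contDiffAt.laplacian_add hχ.contDiffAt
  have e1 : ∀ t : ℝ, ∀ y, t * ((Δ fun y => ψ y + χ y) y + lam ^ 2 * (ψ y + χ y)) =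
      t * ((Δ ψ) y + lam ^ 2 * ψ y) + t * ((Δ χ) y + lam ^ 2 * χ y) := fun t y => by
    rw [e]; ring
  have habs : ∀ {ψ : Plane → ℝ}, ContDiff ℝ 2 ψ → GreenHolds 𝒪 ν lam w ψ → (∀ y, 0 ≤ ψ y) →
      IntegrableOn (fun y => ψ y * |fderivWithin ℝ w 𝒪ᶜ y (ν y)|) (frontier 𝒪)
        (Measure.hausdorffMeasure 1) := fun {ψ} _ h h0 => by
    refine h.integrableOn.norm.congr (ae_of_all _ fun y => ?_)
    simp [abs_of_nonneg (h0 y)]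
  refine ⟨?_, ?_, fun h0 => ?_⟩
  · simp only [add_mul]
    exact h1.integrableOn.add h2.integrableOn
  · simp only [add_mul, e1]
    rw [integral_add h1.integrableOn h2.integrableOn, integral_add
      (integrableOn_volume hO hw hψ hψc) (integrableOn_volume hO hw hχ hχc),
      h1.integral_eq, h2.integral_eq]
  · obtain ⟨h3, h4⟩ := hnn h0
    simp only [add_mul, e1]
    rw [integral_add (habs hψ h1 h3) (habs hχ h2 h4), integral_add
      (integrableOn_volume hO hw.abs hψ hψc) (integrableOn_volume hO hw.abs hχ hχc)]
    exact add_le_add (h1.integral_abs_le h3) (h2.integral_abs_le h4)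

theorem greenHolds_zero : GreenHolds 𝒪 ν lam w fun _ => 0 := by
  have e : ∀ y, (Δ fun _ : Plane => (0 : ℝ)) y = 0 := fun y =>
    laplacian_eq_zero_of_notMem_tsupport (by simp [tsupport])
  refine greenHolds_of_integral (fun _ _ => rfl) ?_ fun _ => ?_ <;> simp [e]

/-- Green's formula is local in the test function. -/
theorem greenHolds_of_locally (hO : IsOpen 𝒪) (hw : ContinuousOn w 𝒪ᶜ) (hψ : ContDiff ℝ 2 ψ)
    (hψc : HasCompactSupport ψ) (hloc : ∀ y ∈ tsupport ψ, ∃ V, IsOpen V ∧ y ∈ V ∧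
      ∀ χ : Plane → ℝ, ContDiff ℝ 2 χ → tsupport χ ⊆ V → GreenHolds 𝒪 ν lam w χ) :
    GreenHolds 𝒪 ν lam w ψ := by
  choose! V hV hyV hVg using hloc
  obtain ⟨t, ht, hcov⟩ := hψc.isCompact.elim_nhds_subcover V
    fun y hy => (hV y hy).mem_nhds (hyV y hy)
  have hcov' : tsupport ψ ⊆ ⋃ i : t, V i := by
    refine hcov.trans fun y hy => ?_
    simp only [mem_iUnion] at hy ⊢
    obtain ⟨i, hi, hyi⟩ := hy
    exact ⟨⟨i, hi⟩, hyi⟩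
  obtain ⟨f, hf⟩ := SmoothPartitionOfUnity.exists_isSubordinate 𝓘(ℝ, Plane)
    (isClosed_tsupport ψ) (fun i : t => V i) (fun i => hV i (ht i i.2)) hcov'
  have hfs : ∀ i, ContDiff ℝ 2 (f i) := fun i =>
    ((f i).contMDiff.contDiff).of_le (WithTop.coe_le_coe.2 (le_top : (2 : ℕ∞) ≤ ⊤))
  have hψe : ψ = fun y => ∑ i, f i y * ψ y := by
    ext y
    by_cases hy : y ∈ tsupport ψ
    · have h1 := f.sum_eq_one hy
      rw [finsum_eq_sum_of_fintype] at h1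
      rw [← Finset.sum_mul, h1, one_mul]
    · simp [image_eq_zero_of_notMem_tsupport hy]
  have hterm : ∀ i, ContDiff ℝ 2 fun y => f i y * ψ y := fun i => (hfs i).mul hψ
  have htc : ∀ i, HasCompactSupport fun y => f i y * ψ y := fun i => hψc.mul_left
  have main : ∀ s : Finset t, ContDiff ℝ 2 (fun y => ∑ i ∈ s, f i y * ψ y) ∧
      HasCompactSupport (fun y => ∑ i ∈ s, f i y * ψ y) ∧
      (GreenHolds 𝒪 ν lam w fun y => ∑ i ∈ s, f i y * ψ y) := by
    intro s
    induction s using Finset.induction_on with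
    | empty => exact ⟨by simpa using contDiff_const, by
        simp only [Finset.sum_empty]
        exact HasCompactSupport.zero,
        by simpa using greenHolds_zero⟩
    | insert i s his ih =>
      simp only [Finset.sum_insert his]
      refine ⟨(hterm i).add ih.1, (htc i).add ih.2.1, ?_⟩
      refine GreenHolds.add hO hw (hterm i) (htc i) ih.1 ih.2.1
        (hVg i (ht i i.2) _ (hterm i) ((tsupport_mul_subset_left).trans (hf i))) ih.2.2 fun h0 => ?_
      simp only [← Finset.sum_mul] at h0 ⊢
      simp only [← add_mul] at h0
      have h1 : ∀ y, 0 ≤ ∑ i ∈ s, f i y := fun y => Finset.sum_nonneg fun i _ => f.nonneg i y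
      have h2 : ∀ y, 0 ≤ f i y := fun y => f.nonneg i y
      -- Where `ψ < 0`, nonnegativity of the sum forces all the weights involved to vanish, so each
      -- piece is zero there.
      refine ⟨fun y => ?_, fun y => ?_⟩ <;> rcases le_or_gt 0 (ψ y) with h3 | h3
      · exact mul_nonneg (h2 y) h3
      · have h4 : f i y + ∑ i ∈ s, f i y ≤ 0 := by
          by_contra hcon
          exact absurd (h0 y) (not_le.2 (mul_neg_of_pos_of_neg (not_le.1 hcon) h3))
        have h5 : f i y = 0 := by linarith [h1 y, h2 y]
        simp [h5]
      · exact mul_nonneg (h1 y) h3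
      · have h4 : f i y + ∑ i ∈ s, f i y ≤ 0 := by
          by_contra hcon
          exact absurd (h0 y) (not_le.2 (mul_neg_of_pos_of_neg (not_le.1 hcon) h3))
        have h5 : ∑ i ∈ s, f i y = 0 := by linarith [h1 y, h2 y]
        rw [h5, zero_mul]
  rw [hψe]
  exact (main Finset.univ).2.2

end Partition


/-! ### Cutoffs which remove a point. -/

section PointCutoff

theorem fderiv_comp_dilation {E F : Type*} [NormedAddCommGroup E] [NormedSpace ℝ E]
    [NormedAddCommGroup F] [NormedSpace ℝ F] (f : E → F) (c : E) (t : ℝ) (x : E) :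
    fderiv ℝ (fun y => f (t • (y - c))) x = t • fderiv ℝ f (t • (x - c)) := by
  have h1 := fderiv_comp_sub (𝕜 := ℝ) (f := fun y => f (t • y)) (x := x) c
  rw [h1]
  exact fderiv_comp_smul t

/-- A smooth bump function equal to `1` on the unit ball and supported in the ball of radius `2`. -/
def unitBump : ContDiffBump (0 : Plane) := ⟨1, 2, one_pos, one_lt_two⟩

theorem laplacian_comp_dilation {F : Type*} [NormedAddCommGroup F] [NormedSpace ℝ F]
    {f : Plane → F} (hf : ContDiff ℝ 2 f) (c : Plane) (t : ℝ) (x : Plane) :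
    (Δ fun y => f (t • (y - c))) x = t ^ 2 • (Δ f) (t • (x - c)) := by
  rw [laplacian_eq_sum_fderiv_fderiv (stdOrthonormalBasis ℝ Plane),
    laplacian_eq_sum_fderiv_fderiv (stdOrthonormalBasis ℝ Plane), Finset.smul_sum]
  refine Finset.sum_congr rfl fun i _ => ?_
  have h1 : fderiv ℝ (fun y => f (t • (y - c))) = fun y => t • fderiv ℝ f (t • (y - c)) :=
    funext fun y => fderiv_comp_dilation f c t y
  have h2 : DifferentiableAt ℝ (fun y => fderiv ℝ f (t • (y - c))) x := by
    have h3 : Differentiable ℝ (fderiv ℝ f) :=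
      (hf.fderiv_right (m := 1) (by norm_num)).differentiable (by norm_num)
    exact (h3 _).comp x (by fun_prop)
  rw [h1, fderiv_fun_const_smul h2, fderiv_comp_dilation (fderiv ℝ f) c t x, smul_smul, sq]
  rfl

/-- A cutoff function which vanishes near `c` and equals `1` outside a ball of radius `2 / t`. -/
noncomputable def pointCutoff (c : Plane) (t : ℝ) (y : Plane) : ℝ := 1 - unitBump (t • (y - c))

variable {c y : Plane} {t : ℝ}

theorem contDiff_pointCutoff : ContDiff ℝ 2 (pointCutoff c t) := by
  have : ContDiff ℝ 2 unitBump := unitBump.contDiff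
  unfold pointCutoff
  exact contDiff_const.sub (this.comp (by fun_prop))

theorem pointCutoff_nonneg : 0 ≤ pointCutoff c t y := sub_nonneg.2 unitBump.le_one

theorem pointCutoff_le_one : pointCutoff c t y ≤ 1 :=
  sub_le_self _ unitBump.nonneg

theorem pointCutoff_eq_one (h : 2 ≤ t * dist y c) : pointCutoff c t y = 1 := by
  rw [pointCutoff, unitBump.zero_of_le_dist, sub_zero]
  rw [dist_zero_right, norm_smul, ← dist_eq_norm]
  exact h.trans (mul_le_mul_of_nonneg_right (le_abs_self t) dist_nonneg)

theorem notMem_tsupport_pointCutoff : c ∉ tsupport (pointCutoff c t) := by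
  rw [notMem_tsupport_iff_eventuallyEq]
  have h1 : Tendsto (fun y => t • (y - c)) (𝓝 c) (𝓝 0) := by
    have : Continuous fun y : Plane => t • (y - c) := by fun_prop
    simpa using this.tendsto c
  filter_upwards [h1.eventually unitBump.eventuallyEq_one] with y hy
  simp only [Pi.one_apply] at hy
  simp [pointCutoff, hy]

theorem tendsto_pointCutoff (h : y ≠ c) :
    Tendsto (fun n : ℕ => pointCutoff c (n + 1) y) atTop (𝓝 1) := by
  have h1 : Tendsto (fun n : ℕ => ((n : ℝ) + 1) * dist y c) atTop atTop :=
    (tendsto_atTop_add_const_right _ _ tendsto_natCast_atTop_atTop).atTop_mul_const (dist_pos.2 h)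
  refine tendsto_const_nhds.congr' ?_
  filter_upwards [h1.eventually_ge_atTop 2] with n hn using (pointCutoff_eq_one hn).symm

/-- Each derivative that falls on the dilated bump costs a factor `t`, so the error made by the
cutoff is `O(t²)`; it is confined to the disc of radius `2/t`. -/
theorem exists_abs_helmholtz_pointCutoff_sub_le {ψ : Plane → ℝ} (hψ : ContDiff ℝ 2 ψ)
    (hψc : HasCompactSupport ψ) (c : Plane) (lam : ℝ) : ∃ C, 0 ≤ C ∧ ∀ t : ℝ, 1 ≤ t → ∀ y,
      |((Δ fun y => ψ y * pointCutoff c t y) y + lam ^ 2 * (ψ y * pointCutoff c t y)) -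
        ((Δ ψ) y + lam ^ 2 * ψ y)| ≤ C * t ^ 2 ∧
      (2 < t * dist y c → ((Δ fun y => ψ y * pointCutoff c t y) y +
        lam ^ 2 * (ψ y * pointCutoff c t y)) - ((Δ ψ) y + lam ^ 2 * ψ y) = 0) := by
  set b := stdOrthonormalBasis ℝ Plane
  have hβ : ContDiff ℝ 2 unitBump := unitBump.contDiff
  have hβc : HasCompactSupport unitBump := unitBump.hasCompactSupport
  have hΔβ : HasCompactSupport (Δ (unitBump : Plane → ℝ)) := HasCompactSupport.intro hβc
    fun y hy => laplacian_eq_zero_of_notMem_tsupport hy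
  obtain ⟨C₁, h₁⟩ := hψc.exists_bound_of_continuous hψ.continuous
  obtain ⟨C₂, h₂⟩ := (hψc.fderiv (𝕜 := ℝ)).exists_bound_of_continuous
    (hψ.continuous_fderiv (by norm_num))
  obtain ⟨C₃, h₃⟩ := (hasCompactSupport_helmholtz (lam := lam) hψc).exists_bound_of_continuous
    (continuous_helmholtz hψ)
  obtain ⟨B₂, k₂⟩ := (hβc.fderiv (𝕜 := ℝ)).exists_bound_of_continuous
    (hβ.continuous_fderiv (by norm_num))
  obtain ⟨B₃, k₃⟩ := hΔβ.exists_bound_of_continuous (continuous_laplacian hβ)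
  have hC₁ := (norm_nonneg _).trans (h₁ 0)
  have hC₂ := (norm_nonneg _).trans (h₂ 0)
  have hC₃ := (norm_nonneg _).trans (h₃ 0)
  have hB₂ := (norm_nonneg _).trans (k₂ 0)
  have hB₃ := (norm_nonneg _).trans (k₃ 0)
  -- With `η` the cutoff, the three terms bound `ψ Δη`, `2 ⟨∇ψ, ∇η⟩` (the inner `2` counts the basis
  -- vectors) and `(1 - η)(Δψ + λ²ψ)`.
  refine ⟨C₁ * B₃ + 2 * (2 * (C₂ * B₂)) + C₃, by positivity, fun t ht y => ⟨?_, fun hy => ?_⟩⟩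
  · have hΔη : (Δ (pointCutoff c t)) y = -(t ^ 2 * (Δ (unitBump : Plane → ℝ)) (t • (y - c))) := by
      have e1 : pointCutoff c t = (fun _ => (1 : ℝ)) - fun y => unitBump (t • (y - c)) := rfl
      have e2 : ContDiff ℝ 2 fun y : Plane => unitBump (t • (y - c)) :=
        hβ.comp (by fun_prop)
      have e3 : (Δ fun _ : Plane => (1 : ℝ)) y = 0 := by
        rw [laplacian_eq_sum_fderiv_fderiv b]
        simp
      rw [e1, contDiffAt_const.laplacian_sub e2.contDiffAt, e3, laplacian_comp_dilation hβ]
      simp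
    have hdη : fderiv ℝ (pointCutoff c t) y = -(t • fderiv ℝ unitBump (t • (y - c))) := by
      unfold pointCutoff
      rw [fderiv_const_sub, fderiv_comp_dilation]
    rw [laplacian_mul b hψ.contDiffAt contDiff_pointCutoff.contDiffAt, hΔη, hdη]
    have e : ψ y * -(t ^ 2 * (Δ (unitBump : Plane → ℝ)) (t • (y - c))) +
          2 * ∑ i, fderiv ℝ ψ y (b i) * (-(t • fderiv ℝ unitBump (t • (y - c)))) (b i) +
          pointCutoff c t y * (Δ ψ) y + lam ^ 2 * (ψ y * pointCutoff c t y) -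
          ((Δ ψ) y + lam ^ 2 * ψ y) =
        -(ψ y * (t ^ 2 * (Δ (unitBump : Plane → ℝ)) (t • (y - c)))) -
          2 * ∑ i, fderiv ℝ ψ y (b i) * (t * fderiv ℝ unitBump (t • (y - c)) (b i)) -
          (1 - pointCutoff c t y) * ((Δ ψ) y + lam ^ 2 * ψ y) := by
      simp only [neg_apply, smul_apply, smul_eq_mul,
        mul_neg, Finset.sum_neg_distrib]
      ring
    rw [e]
    have hb : ∀ i, ‖b i‖ = 1 := fun i => b.norm_eq_one i
    have m1 : |ψ y * (t ^ 2 * (Δ (unitBump : Plane → ℝ)) (t • (y - c)))| ≤ C₁ * B₃ * t ^ 2 := by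
      rw [abs_mul, abs_mul, abs_of_nonneg (sq_nonneg t)]
      calc _ ≤ C₁ * (t ^ 2 * B₃) := by
            gcongr
            · exact h₁ y
            · exact k₃ _
        _ = _ := by ring
    have m2 : |∑ i, fderiv ℝ ψ y (b i) * (t * fderiv ℝ unitBump (t • (y - c)) (b i))| ≤
        2 * (C₂ * B₂) * t ^ 2 := by
      have m3 : ∀ i, |fderiv ℝ ψ y (b i) * (t * fderiv ℝ unitBump (t • (y - c)) (b i))| ≤
          C₂ * B₂ * t ^ 2 := fun i => by
        rw [abs_mul, abs_mul, abs_of_nonneg (by linarith : 0 ≤ t)]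
        have a1 : |fderiv ℝ ψ y (b i)| ≤ C₂ := by
          have := (fderiv ℝ ψ y).le_opNorm (b i)
          rw [hb, mul_one] at this
          exact this.trans (h₂ y)
        have a2 : |fderiv ℝ unitBump (t • (y - c)) (b i)| ≤ B₂ := by
          have := (fderiv ℝ unitBump (t • (y - c))).le_opNorm (b i)
          rw [hb, mul_one] at this
          exact this.trans (k₂ _)
        calc _ ≤ C₂ * (t * B₂) := by gcongr
          _ = C₂ * B₂ * t := by ring
          _ ≤ C₂ * B₂ * t ^ 2 := by
            refine mul_le_mul_of_nonneg_left ?_ (by positivity)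
            nlinarith
      refine (Finset.abs_sum_le_sum_abs _ _).trans
        ((Finset.sum_le_sum fun i _ => m3 i).trans (le_of_eq ?_))
      rw [Finset.sum_const, Finset.card_univ, Fintype.card_fin, finrank_euclideanSpace_fin]
      simp
      ring
    have m4 : |(1 - pointCutoff c t y) * ((Δ ψ) y + lam ^ 2 * ψ y)| ≤ C₃ * t ^ 2 := by
      rw [abs_mul, abs_of_nonneg (sub_nonneg.2 pointCutoff_le_one)]
      calc _ ≤ 1 * C₃ := by
            gcongr
            · linarith [pointCutoff_nonneg (c := c) (t := t) (y := y)]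
            · exact h₃ y
        _ ≤ C₃ * t ^ 2 := by
          rw [one_mul]
          exact le_mul_of_one_le_right hC₃ (one_le_pow₀ ht)
    rw [abs_le] at m1 m2 m4 ⊢
    constructor <;> linarith [m1.1, m1.2, m2.1, m2.2, m4.1, m4.2]
  · have hev : (fun y => ψ y * pointCutoff c t y) =ᶠ[𝓝 y] ψ := by
      have : Continuous fun z => t * dist z c := by fun_prop
      filter_upwards [this.continuousAt.eventually_const_lt hy] with z hz
      rw [pointCutoff_eq_one hz.le, mul_one]
    rw [(InnerProductSpace.laplacian_congr_nhds hev).eq_of_nhds, pointCutoff_eq_one hy.le]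
    ring

/-- Multiplying the test function by a cutoff near a zero `c` of `g` does not matter in the limit. -/
theorem tendsto_integral_helmholtz_pointCutoff {𝒪 : Set Plane} {g ψ : Plane → ℝ} {lam : ℝ}
    (hO : IsOpen 𝒪) (hg : ContinuousOn g 𝒪ᶜ) (hc : c ∈ 𝒪ᶜ) (hgc : g c = 0)
    (hψ : ContDiff ℝ 2 ψ) (hψc : HasCompactSupport ψ) :
    Tendsto (fun n : ℕ => ∫ y in (closure 𝒪)ᶜ, g y * ((Δ fun y => ψ y * pointCutoff c (n + 1) y) y +
      lam ^ 2 * (ψ y * pointCutoff c (n + 1) y))) atTop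
      (𝓝 (∫ y in (closure 𝒪)ᶜ, g y * ((Δ ψ) y + lam ^ 2 * ψ y))) := by
  obtain ⟨C, hC, hCb⟩ := exists_abs_helmholtz_pointCutoff_sub_le hψ hψc c lam
  rw [Metric.tendsto_atTop]
  intro ε hε
  have hcont : ∀ δ > 0, ∃ r > 0, ∀ y ∈ (closure 𝒪)ᶜ, dist y c ≤ r → |g y| ≤ δ := by
    intro δ hδ
    obtain ⟨r, hr, h⟩ := Metric.continuousWithinAt_iff.1 (hg c hc) δ hδ
    refine ⟨r / 2, half_pos hr, fun y hy hyr => ?_⟩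
    have := h (compl_subset_compl.2 subset_closure hy) (by linarith)
    rw [hgc, dist_zero_right] at this
    exact this.le
  set V := volume.real (Metric.closedBall (0 : Plane) 1) with hV
  have hV0 : 0 ≤ V := measureReal_nonneg
  -- The disc of radius `2/t` has area `4V/t²`, which cancels the `C t²` of the cutoff error. Hence
  -- smallness of `g` near its zero is enough; the summand `1` keeps the denominator positive.
  obtain ⟨r, hr, hgr⟩ := hcont (ε / (C * (4 * V) + 1)) (by positivity)
  obtain ⟨N, hN⟩ := exists_nat_gt (2 / r)
  refine ⟨N, fun n hn => ?_⟩
  set t : ℝ := (n : ℝ) + 1 with ht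
  have ht1 : 1 ≤ t := by simp [ht]
  have ht0 : 0 < t := by linarith
  have htr : 2 / t ≤ r := by
    rw [div_lt_iff₀ hr] at hN
    rw [div_le_iff₀ ht0]
    have : (N : ℝ) ≤ n := by exact_mod_cast hn
    nlinarith
  have hψη : ContDiff ℝ 2 fun y => ψ y * pointCutoff c t y := hψ.mul contDiff_pointCutoff
  rw [dist_eq_norm, ← integral_sub (integrableOn_volume hO hg hψη hψc.mul_right)
    (integrableOn_volume hO hg hψ hψc)]
  simp only [← mul_sub]
  rw [setIntegral_eq_of_subset_of_forall_sdiff_eq_zero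
    (s := (closure 𝒪)ᶜ ∩ Metric.closedBall c (2 / t))
    isClosed_closure.isOpen_compl.measurableSet inter_subset_left]
  · have hfin : volume ((closure 𝒪)ᶜ ∩ Metric.closedBall c (2 / t)) < ⊤ :=
      (measure_mono inter_subset_right).trans_lt measure_closedBall_lt_top
    have hle := norm_setIntegral_le_of_norm_le_const (μ := volume)
      (s := (closure 𝒪)ᶜ ∩ Metric.closedBall c (2 / t))
      (f := fun y => g y * (((Δ fun y => ψ y * pointCutoff c t y) y +
        lam ^ 2 * (ψ y * pointCutoff c t y)) - ((Δ ψ) y + lam ^ 2 * ψ y)))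
      (C := ε / (C * (4 * V) + 1) * (C * t ^ 2)) hfin fun y hy => by
        rw [Real.norm_eq_abs, abs_mul]
        exact mul_le_mul (hgr y hy.1 (hy.2.trans htr)) (hCb t ht1 y).1 (abs_nonneg _)
          (by positivity)
    refine hle.trans_lt ?_
    have hvol : volume.real ((closure 𝒪)ᶜ ∩ Metric.closedBall c (2 / t)) ≤ (2 / t) ^ 2 * V := by
      refine (measureReal_mono inter_subset_right measure_closedBall_lt_top.ne).trans ?_
      rw [Measure.addHaar_real_closedBall' _ _ (by positivity), finrank_euclideanSpace_fin]
    calc _ ≤ ε / (C * (4 * V) + 1) * (C * t ^ 2) * ((2 / t) ^ 2 * V) := by gcongr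
      _ = ε * (C * (4 * V)) / (C * (4 * V) + 1) := by
        field_simp
        ring
      _ < ε := by
        rw [div_lt_iff₀ (by positivity)]
        nlinarith
  · intro y hy
    rw [(hCb t ht1 y).2, mul_zero]
    have : ¬ dist y c ≤ 2 / t := fun h => hy.2 ⟨hy.1, h⟩
    rw [not_le, div_lt_iff₀ ht0] at this
    linarith

end PointCutoff


/-- A nonnegative `C²` majorant, supported in a given open set, of a continuous function. -/
theorem exists_contDiff_majorant {ψ : Plane → ℝ} {U : Set Plane} (hψ : Continuous ψ)
    (hψc : HasCompactSupport ψ) (hU : IsOpen U) (hψU : tsupport ψ ⊆ U) :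
    ∃ χ : Plane → ℝ, ContDiff ℝ 2 χ ∧ HasCompactSupport χ ∧ tsupport χ ⊆ U ∧ (∀ y, 0 ≤ χ y) ∧
      ∀ y, |ψ y| ≤ χ y := by
  obtain ⟨L, hL, hψL, hLU⟩ := exists_compact_between hψc.isCompact hU hψU
  obtain ⟨f, hf1, hf0, hf⟩ := exists_contMDiffMap_one_nhds_of_subset_interior (n := (⊤ : ℕ∞))
    𝓘(ℝ, Plane) (isClosed_tsupport ψ) hψL
  obtain ⟨M, hM⟩ := hψc.exists_bound_of_continuous hψ
  have hM0 := (norm_nonneg _).trans (hM 0)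
  have hfL : tsupport (fun y => M * f y) ⊆ L := closure_minimal
    (fun y hy => by_contra fun h => hy (by simp [hf0 y h])) hL.isClosed
  refine ⟨fun y => M * f y, ?_, hL.of_isClosed_subset (isClosed_tsupport _) hfL, hfL.trans hLU,
    fun y => mul_nonneg hM0 (hf y).1, fun y => ?_⟩
  · exact contDiff_const.mul (f.contMDiff.contDiff.of_le
      (WithTop.coe_le_coe.2 (le_top : (2 : ℕ∞) ≤ ⊤)))
  · by_cases hy : y ∈ tsupport ψ
    · have : f y = 1 := hf1.self_of_nhdsSet y hy
      simpa [this] using hM y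
    · rw [image_eq_zero_of_notMem_tsupport hy, abs_zero]
      exact mul_nonneg hM0 (hf y).1

/-! ### Removing the corners. -/

section RemovePoint

variable {𝒪 : Set Plane} {lam : ℝ} {w ψ : Plane → ℝ} {ν : Plane → Plane} {c : Plane}

theorem ae_ne_hausdorffMeasure_one (s : Set Plane) (c : Plane) :
    ∀ᵐ y ∂((Measure.hausdorffMeasure 1).restrict s), y ≠ c := by
  have := Measure.nullSingletonClass_hausdorff Plane one_pos
  exact ae_restrict_of_ae (compl_mem_ae_iff.2 (measure_singleton c))

theorem ae_tendsto_mul_pointCutoff (g : Plane → ℝ) (s : Set Plane) :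
    ∀ᵐ y ∂((Measure.hausdorffMeasure 1).restrict s),
      Tendsto (fun n : ℕ => ψ y * pointCutoff c (n + 1) y * g y) atTop (𝓝 (ψ y * g y)) := by
  filter_upwards [ae_ne_hausdorffMeasure_one s c] with y hy
  have := ((tendsto_pointCutoff hy).const_mul (ψ y)).mul_const (g y)
  rwa [mul_one] at this

/-- Kato's inequality bounds the boundary integrals with cutoff by exterior integrals of `|w|`,
which converge because `w` vanishes at `c`. Fatou's lemma passes the bound to the limit, so no
information on the gradient near `c` is needed. -/
theorem integrableOn_of_greenHolds_pointCutoff (hO : IsOpen 𝒪) (hw : ContinuousOn w 𝒪ᶜ)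
    (hc : c ∈ 𝒪ᶜ) (hwc : w c = 0) (hψ : ContDiff ℝ 2 ψ) (hψc : HasCompactSupport ψ)
    (hψ0 : ∀ y, 0 ≤ ψ y)
    (h : ∀ n : ℕ, GreenHolds 𝒪 ν lam w fun y => ψ y * pointCutoff c (n + 1) y) :
    IntegrableOn (fun y => ψ y * fderivWithin ℝ w 𝒪ᶜ y (ν y)) (frontier 𝒪)
      (Measure.hausdorffMeasure 1) := by
  set g : Plane → ℝ := fun y => fderivWithin ℝ w 𝒪ᶜ y (ν y) with hg
  set μ := (Measure.hausdorffMeasure 1 : Measure Plane).restrict (frontier 𝒪) with hμ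
  have hlim := ae_tendsto_mul_pointCutoff (ψ := ψ) (c := c) g (frontier 𝒪)
  refine ⟨aestronglyMeasurable_of_tendsto_ae atTop (fun n => (h n).integrableOn.1) hlim, ?_⟩
  have hvol := tendsto_integral_helmholtz_pointCutoff (lam := lam) hO hw.abs hc (by simp [hwc])
    hψ hψc
  have hn0 : ∀ n : ℕ, ∀ y, 0 ≤ ψ y * pointCutoff c (n + 1) y := fun n y =>
    mul_nonneg (hψ0 y) pointCutoff_nonneg
  have hfatou : ∫⁻ y, ‖ψ y * g y‖ₑ ∂μ ≤
      liminf (fun n : ℕ => ∫⁻ y, ‖ψ y * pointCutoff c (n + 1) y * g y‖ₑ ∂μ) atTop := by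
    refine le_trans (lintegral_mono_ae ?_) (lintegral_liminf_le' fun n => (h n).integrableOn.1.enorm)
    filter_upwards [hlim] with y hy
    exact hy.enorm.liminf_eq.ge
  refine hfatou.trans_lt ?_
  have hle : ∀ n : ℕ, ∫⁻ y, ‖ψ y * pointCutoff c (n + 1) y * g y‖ₑ ∂μ ≤
      ENNReal.ofReal (∫ y in (closure 𝒪)ᶜ, |w y| * ((Δ fun y => ψ y * pointCutoff c (n + 1) y) y +
      lam ^ 2 * (ψ y * pointCutoff c (n + 1) y))) := by
    intro n
    rw [← ofReal_integral_norm_eq_lintegral_enorm (h n).integrableOn]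
    refine ENNReal.ofReal_le_ofReal ?_
    refine le_of_eq_of_le (integral_congr_ae (ae_of_all _ fun y => ?_))
      ((h n).integral_abs_le (hn0 n))
    simp only [norm_mul, Real.norm_eq_abs, abs_of_nonneg (hψ0 y), abs_of_nonneg
      (pointCutoff_nonneg (c := c) (t := n + 1) (y := y))]
  refine (liminf_le_liminf (Eventually.of_forall hle)).trans_lt ?_
  rw [(ENNReal.tendsto_ofReal hvol).liminf_eq]
  exact ENNReal.ofReal_lt_top

/-- An isolated zero of `w` does not matter for Green's formula. -/
theorem greenHolds_of_pointCutoff (hO : IsOpen 𝒪) (hw : ContinuousOn w 𝒪ᶜ)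
    (hc : c ∈ 𝒪ᶜ) (hwc : w c = 0) (hψ : ContDiff ℝ 2 ψ) (hψc : HasCompactSupport ψ)
    (hi : IntegrableOn (fun y => ψ y * fderivWithin ℝ w 𝒪ᶜ y (ν y)) (frontier 𝒪)
      (Measure.hausdorffMeasure 1))
    (h : ∀ n : ℕ, GreenHolds 𝒪 ν lam w fun y => ψ y * pointCutoff c (n + 1) y) :
    GreenHolds 𝒪 ν lam w ψ := by
  have hbound : ∀ (n : ℕ) (y : Plane) (t : ℝ),
      ‖ψ y * pointCutoff c (n + 1) y * t‖ ≤ ‖ψ y * t‖ := by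
    intro n y t
    rw [norm_mul, norm_mul, norm_mul]
    refine mul_le_mul_of_nonneg_right ?_ (norm_nonneg _)
    refine mul_le_of_le_one_right (norm_nonneg _) ?_
    rw [Real.norm_eq_abs, abs_of_nonneg pointCutoff_nonneg]
    exact pointCutoff_le_one
  refine ⟨hi, ?_, fun hψ0 => ?_⟩
  · refine tendsto_nhds_unique ?_
      (tendsto_integral_helmholtz_pointCutoff hO hw hc hwc hψ hψc)
    simp only [← fun n => (h n).integral_eq]
    exact tendsto_integral_of_dominated_convergence _ (fun n => (h n).integrableOn.1) hi.norm
      (fun n => ae_of_all _ fun y => hbound n y _) (ae_tendsto_mul_pointCutoff _ _)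
  · have hn : ∀ {ψ : Plane → ℝ}, IntegrableOn (fun y => ψ y * fderivWithin ℝ w 𝒪ᶜ y (ν y))
        (frontier 𝒪) (Measure.hausdorffMeasure 1) → (∀ y, 0 ≤ ψ y) →
        IntegrableOn (fun y => ψ y * |fderivWithin ℝ w 𝒪ᶜ y (ν y)|) (frontier 𝒪)
        (Measure.hausdorffMeasure 1) := fun {ψ} h h0 => by
      refine h.norm.congr (ae_of_all _ fun y => ?_)
      simp [abs_of_nonneg (h0 y)]
    have hn0 : ∀ n : ℕ, ∀ y, 0 ≤ ψ y * pointCutoff c (n + 1) y := fun n y =>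
      mul_nonneg (hψ0 y) pointCutoff_nonneg
    refine le_of_tendsto_of_tendsto' ?_ (tendsto_integral_helmholtz_pointCutoff (lam := lam) hO
      hw.abs hc (by simp [hwc]) hψ hψc) fun n => (h n).integral_abs_le (hn0 n)
    exact tendsto_integral_of_dominated_convergence _
      (fun n => (hn (h n).integrableOn (hn0 n)).1) (hn hi hψ0).norm
      (fun n => ae_of_all _ fun y => hbound n y _) (ae_tendsto_mul_pointCutoff _ _)

/-- The functions `ψ` times the cutoffs avoid `c` as well as `F`, so the hypothesis applies to them.
This is the induction step by which the corners are removed one at a time. -/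
theorem greenHolds_of_disjoint_insert {F : Set Plane} (hO : IsOpen 𝒪) (hw : ContinuousOn w 𝒪ᶜ)
    (hF : IsClosed F) (hc : c ∈ 𝒪ᶜ) (hwc : w c = 0)
    (h : ∀ χ : Plane → ℝ, ContDiff ℝ 2 χ → HasCompactSupport χ →
      Disjoint (tsupport χ) (insert c F) → GreenHolds 𝒪 ν lam w χ)
    (hψ : ContDiff ℝ 2 ψ) (hψc : HasCompactSupport ψ) (hψF : Disjoint (tsupport ψ) F) :
    GreenHolds 𝒪 ν lam w ψ := by
  have key : ∀ χ : Plane → ℝ, ContDiff ℝ 2 χ → HasCompactSupport χ → Disjoint (tsupport χ) F →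
      ∀ n : ℕ, GreenHolds 𝒪 ν lam w fun y => χ y * pointCutoff c (n + 1) y := by
    intro χ hχ hχc hχF n
    refine h _ (hχ.mul contDiff_pointCutoff) hχc.mul_right ?_
    rw [disjoint_insert_right]
    exact ⟨fun hcs => notMem_tsupport_pointCutoff (tsupport_mul_subset_right hcs),
      hχF.mono_left tsupport_mul_subset_left⟩
  -- Integrability near `c` comes from Kato's inequality and hence first for a nonnegative test
  -- function; the majorant passes it on to `ψ` of arbitrary sign.
  obtain ⟨χ, hχ, hχc, hχF, hχ0, hχψ⟩ := exists_contDiff_majorant hψ.continuous hψc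
    hF.isOpen_compl hψF.subset_compl_right
  have hχi := integrableOn_of_greenHolds_pointCutoff hO hw hc hwc hχ hχc hχ0
    (key χ hχ hχc (disjoint_left.2 fun y hy hy' => hχF hy hy'))
  refine greenHolds_of_pointCutoff hO hw hc hwc hψ hψc ?_ (key ψ hψ hψc hψF)
  refine Integrable.mono hχi (aestronglyMeasurable_of_tendsto_ae atTop
    (fun n => (key ψ hψ hψc hψF n).integrableOn.1) (ae_tendsto_mul_pointCutoff _ _))
    (ae_of_all _ fun y => ?_)
  rw [norm_mul, norm_mul, Real.norm_eq_abs, Real.norm_eq_abs (χ y), abs_of_nonneg (hχ0 y)]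
  exact mul_le_mul_of_nonneg_right (hχψ y) (norm_nonneg _)

/-- Green's formula for Dirichlet solutions. -/
theorem IsDirichletSolution.greenHolds (hO : IsOpen 𝒪) (hcorners : (corners 𝒪).Finite)
    (hw : IsDirichletSolution 𝒪 lam w)
    (hν : ∀ x ∈ frontier 𝒪 \ corners 𝒪, IsOutwardUnitNormal 𝒪 x (ν x))
    (hψ : ContDiff ℝ 2 ψ) (hψc : HasCompactSupport ψ) : GreenHolds 𝒪 ν lam w ψ := by
  have base : ∀ χ : Plane → ℝ, ContDiff ℝ 2 χ → HasCompactSupport χ →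
      Disjoint (tsupport χ) (∅ ∪ corners 𝒪) → GreenHolds 𝒪 ν lam w χ := by
    intro χ hχ hχc hχF
    rw [empty_union] at hχF
    exact greenHolds_of_locally hO hw.continuousOn hχ hχc fun y hy =>
      exists_nhds_greenHolds hO hw hν (disjoint_left.1 hχF hy)
  -- Induction on the number of corners which the support of the test function must still avoid.
  have step : ∀ s : Set Plane, s.Finite → s ⊆ corners 𝒪 → 
      (∀ χ : Plane → ℝ, ContDiff ℝ 2 χ → HasCompactSupport χ →
        Disjoint (tsupport χ) s → GreenHolds 𝒪 ν lam w χ) → 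
      ∀ χ : Plane → ℝ, ContDiff ℝ 2 χ → HasCompactSupport χ → GreenHolds 𝒪 ν lam w χ := by
    intro s hs
    induction s, hs using Set.Finite.induction_on with
    | empty => exact fun _ h χ hχ hχc => h χ hχ hχc (disjoint_empty _)
    | @insert c s _ hs ih =>
      intro hsub h
      have hc : c ∈ frontier 𝒪 := (hsub (mem_insert _ _)).1
      have hcO : c ∈ 𝒪ᶜ := by
        rw [hO.frontier_eq] at hc
        exact hc.2
      exact ih ((subset_insert _ _).trans hsub) fun χ hχ hχc hχs =>
        greenHolds_of_disjoint_insert hO hw.continuousOn hs.isClosed hcO (hw.boundary c hc) h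
          hχ hχc hχs
  exact step _ hcorners subset_rfl (by simpa using base) ψ hψ hψc

end RemovePoint


/-! ### Green's formula for complex solutions. -/

section ComplexGreen

theorem integral_ofReal_sub_add_mul_I {α : Type*} [MeasurableSpace α] {μ : Measure α}
    {f₁ f₂ f₃ f₄ : α → ℝ} (h₁ : Integrable f₁ μ) (h₂ : Integrable f₂ μ) (h₃ : Integrable f₃ μ)
    (h₄ : Integrable f₄ μ) :
    Integrable (fun x => ((f₁ x - f₂ x : ℝ) : ℂ) + (f₃ x + f₄ x : ℝ) * I) μ ∧
      ∫ x, ((f₁ x - f₂ x : ℝ) : ℂ) + (f₃ x + f₄ x : ℝ) * I ∂μ =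
        ((∫ x, f₁ x ∂μ - ∫ x, f₂ x ∂μ : ℝ) : ℂ) + (∫ x, f₃ x ∂μ + ∫ x, f₄ x ∂μ : ℝ) * I := by
  have i1 : Integrable (fun x => ((f₁ x - f₂ x : ℝ) : ℂ)) μ := (h₁.sub h₂).ofReal
  have i2 : Integrable (fun x => ((f₃ x + f₄ x : ℝ) : ℂ) * I) μ := (h₃.add h₄).ofReal.mul_const I
  refine ⟨i1.add i2, ?_⟩
  rw [integral_add i1 i2, integral_mul_const, integral_complex_ofReal, integral_complex_ofReal,
    integral_sub h₁ h₂, integral_add h₃ h₄]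

variable {𝒪 : Set Plane} {lam : ℝ} {e ψ : Plane → ℂ} {ν : Plane → Plane}

/-- A complex solution of `(-Δ - λ²) e = 0` outside `𝒪`, smooth up to the boundary away from the
corners, continuous, and vanishing on the boundary. -/
structure IsComplexDirichletSolution (𝒪 : Set Plane) (lam : ℝ) (e : Plane → ℂ) : Prop where
  continuousOn : ContinuousOn e 𝒪ᶜ
  contDiffOn : ContDiffOn ℝ 2 e (𝒪ᶜ \ corners 𝒪)
  helmholtz : ∀ x ∈ (closure 𝒪)ᶜ, (Δ e) x = -((lam : ℂ) ^ 2 * e x)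
  boundary : ∀ x ∈ frontier 𝒪, e x = 0

theorem IsComplexDirichletSolution.contDiffAt (he : IsComplexDirichletSolution 𝒪 lam e) {x : Plane}
    (hx : x ∈ (closure 𝒪)ᶜ) : ContDiffAt ℝ 2 e x :=
  (he.contDiffOn.mono (t := (closure 𝒪)ᶜ) fun _ hy =>
    ⟨fun h => hy (subset_closure h), fun h => hy h.1.1⟩).contDiffAt
    (isClosed_closure.isOpen_compl.mem_nhds hx)

theorem IsComplexDirichletSolution.comp (he : IsComplexDirichletSolution 𝒪 lam e) (l : ℂ →L[ℝ] ℝ) :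
    IsDirichletSolution 𝒪 lam (l ∘ e) where
  continuousOn := l.continuous.comp_continuousOn he.continuousOn
  contDiffOn := l.contDiff.comp_contDiffOn he.contDiffOn
  helmholtz x hx := by
    rw [(he.contDiffAt hx).laplacian_CLM_comp_left, Function.comp_apply, he.helmholtz x hx]
    have : -((lam : ℂ) ^ 2 * e x) = (-lam ^ 2 : ℝ) • e x := by
      rw [real_smul]; push_cast; ring
    rw [this, map_smul, smul_eq_mul, Function.comp_apply]
    ring
  boundary x hx := by simp [he.boundary x hx]

theorem uniqueDiffWithinAt_compl (hO : IsOpen 𝒪) {y : Plane} (hy : y ∈ frontier 𝒪 \ corners 𝒪) :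
    UniqueDiffWithinAt ℝ 𝒪ᶜ y := by
  obtain ⟨-, U, ρ, hρ⟩ : IsSmoothBoundaryPoint 𝒪 y := by
    by_contra hcon
    exact hy.2 ⟨hy.1, hcon⟩
  obtain ⟨b, h, a, r, hc, hh0, -⟩ := exists_isGraphChart hO hy.1 hρ
  refine hc.uniqueDiffWithinAt ?_ fun h => ?_
  · have h1 : graphMap b y h (0, 0) = y := by simp [graphMap, frameMap, hh0]
    have h2 : graphMap b y h (0, 0) ∈ chartBox b y h a r :=
      graphMap_mem_chartBox.2 ⟨by simpa using hc.a_pos, by simpa using hc.r_pos⟩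
    rwa [h1] at h2
  · have := hy.1
    rw [hO.frontier_eq] at this
    exact this.2 h

theorem IsComplexDirichletSolution.fderivWithin_comp (hO : IsOpen 𝒪)
    (hcorners : (corners 𝒪).Finite) (he : IsComplexDirichletSolution 𝒪 lam e) (l : ℂ →L[ℝ] ℝ)
    {y : Plane} (hy : y ∈ frontier 𝒪 \ corners 𝒪) (n : Plane) :
    fderivWithin ℝ (l ∘ e) 𝒪ᶜ y n = l (fderivWithin ℝ e 𝒪ᶜ y n) := by
  have hyO : y ∈ 𝒪ᶜ := by
    have := hy.1
    rw [hO.frontier_eq] at this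
    exact this.2
  have h1 : DifferentiableWithinAt ℝ e (𝒪ᶜ \ corners 𝒪) y :=
    he.contDiffOn.differentiableOn (by norm_num) y ⟨hyO, hy.2⟩
  have h2 : DifferentiableWithinAt ℝ e 𝒪ᶜ y :=
    (differentiableWithinAt_inter (hcorners.isClosed.isOpen_compl.mem_nhds hy.2)).1 h1
  rw [(l.hasFDerivAt.comp_hasFDerivWithinAt y h2.hasFDerivWithinAt).fderivWithin
    (uniqueDiffWithinAt_compl hO hy)]
  rfl

/-- Green's formula for complex Dirichlet solutions. -/
theorem IsComplexDirichletSolution.green (hO : IsOpen 𝒪) (hcorners : (corners 𝒪).Finite)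
    (he : IsComplexDirichletSolution 𝒪 lam e)
    (hν : ∀ x ∈ frontier 𝒪 \ corners 𝒪, IsOutwardUnitNormal 𝒪 x (ν x))
    (hψ : ContDiff ℝ 2 ψ) (hψc : HasCompactSupport ψ) :
    IntegrableOn (fun y => ψ y * fderivWithin ℝ e 𝒪ᶜ y (ν y)) (frontier 𝒪)
      (Measure.hausdorffMeasure 1) ∧
    ∫ y in frontier 𝒪, ψ y * fderivWithin ℝ e 𝒪ᶜ y (ν y) ∂(Measure.hausdorffMeasure 1) =
      ∫ y in (closure 𝒪)ᶜ, e y * ((Δ ψ) y + (lam : ℂ) ^ 2 * ψ y) := by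
  set g := fun (l : ℂ →L[ℝ] ℝ) y => fderivWithin ℝ (l ∘ e) 𝒪ᶜ y (ν y) with hg
  -- The product of complex functions splits into four products of real and imaginary parts. Since
  -- `λ` is real, each part of `e` is a real Dirichlet solution.
  have hl : ∀ k l : ℂ →L[ℝ] ℝ, GreenHolds 𝒪 ν lam (l ∘ e) (k ∘ ψ) := fun k l =>
    (he.comp l).greenHolds hO hcorners hν (k.contDiff.comp hψ) (hψc.comp_left (map_zero k))
  have hvi : ∀ k l : ℂ →L[ℝ] ℝ, IntegrableOn (fun y => (l ∘ e) y *
      ((Δ (k ∘ ψ)) y + lam ^ 2 * (k ∘ ψ) y)) (closure 𝒪)ᶜ := fun k l =>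
    integrableOn_volume hO (he.comp l).continuousOn (k.contDiff.comp hψ)
      (hψc.comp_left (map_zero k))
  -- Taking real and imaginary parts commutes with the exterior derivative only where that
  -- derivative exists and is unique; the finitely many corners are null for the Hausdorff measure.
  have hae : ∀ᵐ y ∂((Measure.hausdorffMeasure 1 : Measure Plane).restrict (frontier 𝒪)),
      ψ y * fderivWithin ℝ e 𝒪ᶜ y (ν y) =
        (((reCLM ∘ ψ) y * g reCLM y - (imCLM ∘ ψ) y * g imCLM y : ℝ) : ℂ) +
        ((reCLM ∘ ψ) y * g imCLM y + (imCLM ∘ ψ) y * g reCLM y : ℝ) * I := by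
    have := Measure.nullSingletonClass_hausdorff Plane one_pos
    filter_upwards [ae_restrict_mem isClosed_frontier.measurableSet,
      ae_restrict_of_ae (compl_mem_ae_iff.2 (hcorners.measure_zero (Measure.hausdorffMeasure 1)))]
      with y hy hyc
    simp only [hg]
    rw [he.fderivWithin_comp hO hcorners _ ⟨hy, hyc⟩, he.fderivWithin_comp hO hcorners _ ⟨hy, hyc⟩]
    apply Complex.ext <;> simp
  have hvol : ∀ y, e y * ((Δ ψ) y + (lam : ℂ) ^ 2 * ψ y) =
      (((reCLM ∘ e) y * ((Δ (reCLM ∘ ψ)) y + lam ^ 2 * (reCLM ∘ ψ) y) -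
        (imCLM ∘ e) y * ((Δ (imCLM ∘ ψ)) y + lam ^ 2 * (imCLM ∘ ψ) y) : ℝ) : ℂ) +
      ((imCLM ∘ e) y * ((Δ (reCLM ∘ ψ)) y + lam ^ 2 * (reCLM ∘ ψ) y) +
        (reCLM ∘ e) y * ((Δ (imCLM ∘ ψ)) y + lam ^ 2 * (imCLM ∘ ψ) y) : ℝ) * I := fun y => by
    rw [hψ.contDiffAt.laplacian_CLM_comp_left, hψ.contDiffAt.laplacian_CLM_comp_left]
    apply Complex.ext <;> simp [pow_two]
    ring
  have hb := fun k l => (hl k l).integrableOn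
  obtain ⟨h1, h2⟩ := integral_ofReal_sub_add_mul_I (hb reCLM reCLM) (hb imCLM imCLM)
    (hb reCLM imCLM) (hb imCLM reCLM)
  refine ⟨h1.congr (hae.mono fun y hy => hy.symm), (integral_congr_ae hae).trans (h2.trans ?_)⟩
  simp only [hvol]
  rw [(integral_ofReal_sub_add_mul_I (hvi reCLM reCLM) (hvi imCLM imCLM)
    (hvi reCLM imCLM) (hvi imCLM reCLM)).2, (hl _ _).integral_eq, (hl _ _).integral_eq,
    (hl _ _).integral_eq, (hl _ _).integral_eq]

end ComplexGreen

/-! ### Plane waves. -/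

section PlaneWave

variable {lam : ℝ} {ω : Plane}

theorem contDiff_planeWave {n : WithTop ℕ∞} : ContDiff ℝ n (planeWave lam ω) := by
  unfold planeWave
  have h1 : ContDiff ℝ n fun x : Plane => ((⟪x, ω⟫ : ℝ) : ℂ) :=
    ofRealCLM.contDiff.comp (contDiff_id.inner ℝ contDiff_const)
  exact (contDiff_const.mul h1).cexp

theorem norm_planeWave (x : Plane) : ‖planeWave lam ω x‖ = 1 := by
  rw [planeWave, mul_assoc, mul_comm, ← ofReal_mul]
  exact norm_exp_ofReal_mul_I _

theorem fderiv_planeWave (x v : Plane) :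
    fderiv ℝ (planeWave lam ω) x v = I * lam * (⟪v, ω⟫ : ℝ) * planeWave lam ω x := by
  have h1 : HasFDerivAt (fun x : Plane => ((⟪x, ω⟫ : ℝ) : ℂ))
      (ofRealCLM.comp ((innerSL ℝ).flip ω)) x :=
    ofRealCLM.hasFDerivAt.comp x ((innerSL ℝ).flip ω).hasFDerivAt
  have h2 := ((h1.const_mul (I * lam)).cexp).fderiv
  rw [show planeWave lam ω = fun x => cexp (I * lam * (⟪x, ω⟫ : ℝ)) from rfl, h2]
  have h3 : (innerSL ℝ ω) v = ⟪v, ω⟫ := real_inner_comm v ω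
  simp [h3]
  ring

theorem laplacian_planeWave (x : Plane) :
    (Δ (planeWave lam ω)) x = -((lam * ‖ω‖ : ℝ) : ℂ) ^ 2 * planeWave lam ω x := by
  set b := stdOrthonormalBasis ℝ Plane
  rw [laplacian_eq_sum_fderiv_fderiv b]
  have h1 : ∀ i, fderiv ℝ (fderiv ℝ (planeWave lam ω)) x (b i) (b i) =
      (I * lam * (⟪b i, ω⟫ : ℝ)) ^ 2 * planeWave lam ω x := by
    intro i
    have h3 : DifferentiableAt ℝ (fderiv ℝ (planeWave lam ω)) x :=
      contDiff_planeWave.contDiffAt.differentiableAt_fderiv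
    have h2 : fderiv ℝ (fderiv ℝ (planeWave lam ω)) x (b i) (b i) =
        fderiv ℝ (fun y => fderiv ℝ (planeWave lam ω) y (b i)) x (b i) := by
      rw [fderiv_clm_apply h3 (differentiableAt_const _)]
      simp
    rw [h2]
    simp only [fderiv_planeWave]
    rw [fderiv_const_mul (contDiff_planeWave (n := 1)).contDiffAt.differentiableAt_one]
    simp only [smul_apply, fderiv_planeWave, smul_eq_mul]
    ring
  simp only [h1]
  rw [← Finset.sum_mul]
  congr 1
  have h4 := b.sum_sq_norm_inner_right ω
  have h5 : ∑ i, ((⟪b i, ω⟫ : ℝ) : ℂ) ^ 2 = ((‖ω‖ : ℝ) : ℂ) ^ 2 := by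
    rw [← ofReal_pow, ← h4]
    push_cast
    exact Finset.sum_congr rfl fun i _ => by
      rw [← ofReal_pow, ← ofReal_pow, Real.norm_eq_abs, sq_abs]
  simp only [mul_pow, I_sq]
  rw [← Finset.mul_sum, h5]
  push_cast
  ring

end PlaneWave


/-! ### Radial functions and a smoothed norm. -/

section RadialFunctions

theorem laplacian_comp_left {f : ℝ → ℝ} {ρ : Plane → ℝ} {ι : Type*} [Fintype ι]
    (b : OrthonormalBasis ι ℝ Plane) (hf : ContDiff ℝ 2 f) (hρ : ContDiff ℝ 2 ρ) (y : Plane) :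
    (Δ fun x => f (ρ x)) y = deriv (deriv f) (ρ y) * ∑ i, fderiv ℝ ρ y (b i) ^ 2 +
      deriv f (ρ y) * (Δ ρ) y := by
  have hfd : ∀ t, HasDerivAt f (deriv f t) t := fun t =>
    (hf.differentiable (by norm_num) t).hasDerivAt
  have hfd2 : HasDerivAt (deriv f) (deriv (deriv f) (ρ y)) (ρ y) :=
    (hf.deriv_one.differentiable (by norm_num) _).hasDerivAt
  have hρd : ∀ x, HasFDerivAt ρ (fderiv ℝ ρ x) x := fun x =>
    (hρ.differentiable (by norm_num) x).hasFDerivAt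
  have h1 : fderiv ℝ (fun x => f (ρ x)) = fun x => deriv f (ρ x) • fderiv ℝ ρ x :=
    funext fun x => ((hfd _).comp_hasFDerivAt x (hρd x)).fderiv
  have h2 : HasFDerivAt (fderiv ℝ ρ) (fderiv ℝ (fderiv ℝ ρ) y) y :=
    hρ.contDiffAt.differentiableAt_fderiv.hasFDerivAt
  have h3 : HasFDerivAt (fun x => deriv f (ρ x) • fderiv ℝ ρ x) _ y :=
    (hfd2.comp_hasFDerivAt y (hρd y)).smul h2
  rw [laplacian_eq_sum_fderiv_fderiv b, laplacian_eq_sum_fderiv_fderiv b, h1,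
    h3.fderiv, Finset.mul_sum, Finset.mul_sum,
    ← Finset.sum_add_distrib]
  refine Finset.sum_congr rfl fun i _ => ?_
  simp
  ring

theorem fderiv_norm_apply {y : Plane} (hy : y ≠ 0) (v : Plane) :
    fderiv ℝ (fun x : Plane => ‖x‖) y v = ⟪y, v⟫ / ‖y‖ := by
  have h1 : HasFDerivAt (fun x : Plane => ‖x‖ ^ 2) (2 • innerSL ℝ y) y :=
    (hasStrictFDerivAt_norm_sq y).hasFDerivAt
  have h2 := h1.sqrt (by simpa using hy)
  simp only [Real.sqrt_sq (norm_nonneg _)] at h2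
  rw [h2.fderiv]
  simp
  field_simp

/-- The product rule for `‖x‖ * ‖x‖`, with `Δ‖x‖² = 4` and unit gradient of the norm, reads `4 = 2
‖x‖ Δ‖x‖ + 2`. -/
theorem laplacian_norm {y : Plane} (hy : y ≠ 0) : (Δ fun x : Plane => ‖x‖) y = ‖y‖⁻¹ := by
  set b := EuclideanSpace.basisFun (Fin 2) ℝ
  have hy' : 0 < ‖y‖ := norm_pos_iff.2 hy
  have hs : ContDiffAt ℝ 2 (fun x : Plane => ‖x‖) y := contDiffAt_norm ℝ hy
  have h1 := laplacian_mul b hs hs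
  have h2 : (Δ fun x : Plane => ‖x‖ * ‖x‖) y = 4 := by
    have e : (fun x : Plane => ‖x‖ * ‖x‖) = fun x => ‖x‖ ^ 2 := by ext; ring
    have e1 : fderiv ℝ (fun x : Plane => ‖x‖ ^ 2) = fun x => 2 • innerSL ℝ x :=
      funext fun x => (hasStrictFDerivAt_norm_sq x).hasFDerivAt.fderiv
    have e2 : fderiv ℝ (fun x : Plane => 2 • innerSL ℝ x) y = 2 • innerSL ℝ := 
      ((innerSL ℝ : Plane →L[ℝ] Plane →L[ℝ] ℝ).hasFDerivAt.const_smul 2).fderiv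
    rw [e, laplacian_eq_sum_fderiv_fderiv b, e1, e2]
    have e3 : ∀ i, (innerSL ℝ (b i)) (b i) = 1 := fun i => by
      rw [innerSL_apply_apply, real_inner_self_eq_norm_sq, b.norm_eq_one, one_pow]
    simp [e3]
    norm_num
  have h3 : ∑ i, (⟪y, b i⟫ / ‖y‖) * (⟪y, b i⟫ / ‖y‖) = 1 := by
    have := b.sum_sq_norm_inner_left y
    simp only [Real.norm_eq_abs, sq_abs] at this
    simp only [← sq, div_pow]
    rw [← Finset.sum_div, this, div_self (pow_pos hy' 2).ne']
  simp only [fderiv_norm_apply hy] at h1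
  rw [h2, h3] at h1
  refine eq_inv_of_mul_eq_one_right ?_
  linarith

/-- A `C²` function which vanishes near the ball of radius `R` and equals `|y|` for `|y| ≥ 2 R`. -/
noncomputable def cutoffNorm (R : ℝ) (y : Plane) : ℝ := pointCutoff 0 R⁻¹ y * ‖y‖

variable {R : ℝ} {y : Plane}

theorem cutoffNorm_eq_zero (hR : 0 < R) (hy : ‖y‖ ≤ R) : cutoffNorm R y = 0 := by
  rw [cutoffNorm, pointCutoff, sub_zero, unitBump.one_of_mem_closedBall, sub_self, zero_mul]
  rw [mem_closedBall_zero_iff, norm_smul, norm_inv, Real.norm_of_nonneg hR.le]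
  exact (inv_mul_le_one₀ hR).2 hy

theorem cutoffNorm_eq_norm (hR : 0 < R) (hy : 2 * R ≤ ‖y‖) : cutoffNorm R y = ‖y‖ := by
  rw [cutoffNorm, pointCutoff_eq_one, one_mul]
  rw [dist_zero_right, ← div_eq_inv_mul, le_div_iff₀ hR]
  exact hy

theorem norm_sub_le_cutoffNorm (hR : 0 < R) : ‖y‖ - 2 * R ≤ cutoffNorm R y := by
  rcases le_or_gt (2 * R) ‖y‖ with h | h
  · rw [cutoffNorm_eq_norm hR h]
    linarith
  · exact (by linarith : ‖y‖ - 2 * R ≤ 0).trans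
      (mul_nonneg pointCutoff_nonneg (norm_nonneg _))

theorem cutoffNorm_nonneg : 0 ≤ cutoffNorm R y := mul_nonneg pointCutoff_nonneg (norm_nonneg _)

theorem contDiff_cutoffNorm (hR : 0 < R) : ContDiff ℝ 2 (cutoffNorm R) := by
  refine contDiff_iff_contDiffAt.2 fun y => ?_
  by_cases hy : y = 0
  · refine (contDiffAt_const (c := (0 : ℝ))).congr_of_eventuallyEq ?_
    rw [hy]
    filter_upwards [Metric.closedBall_mem_nhds (0 : Plane) hR] with z hz
    exact cutoffNorm_eq_zero hR (mem_closedBall_zero_iff.1 hz)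
  · exact contDiff_pointCutoff.contDiffAt.mul (contDiffAt_norm ℝ hy)

theorem cutoffNorm_eventuallyEq (hR : 0 < R) (hy : 2 * R < ‖y‖) :
    cutoffNorm R =ᶠ[𝓝 y] fun x => ‖x‖ := by
  filter_upwards [continuous_norm.continuousAt.eventually_const_lt hy] with z hz
  exact cutoffNorm_eq_norm hR hz.le

theorem ne_zero_of_two_mul_lt (hR : 0 < R) (hy : 2 * R < ‖y‖) : y ≠ 0 := by
  rintro rfl
  rw [norm_zero] at hy
  linarith

theorem fderiv_cutoffNorm (hR : 0 < R) (hy : 2 * R < ‖y‖) (v : Plane) :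
    fderiv ℝ (cutoffNorm R) y v = ⟪y, v⟫ / ‖y‖ := by
  rw [(cutoffNorm_eventuallyEq hR hy).fderiv_eq, fderiv_norm_apply (ne_zero_of_two_mul_lt hR hy)]

theorem laplacian_cutoffNorm (hR : 0 < R) (hy : 2 * R < ‖y‖) :
    (Δ (cutoffNorm R)) y = ‖y‖⁻¹ := by
  rw [(InnerProductSpace.laplacian_congr_nhds (cutoffNorm_eventuallyEq hR hy)).eq_of_nhds,
    laplacian_norm (ne_zero_of_two_mul_lt hR hy)]

theorem exists_bound_cutoffNorm (hR : 0 < R) : ∃ C, 0 ≤ C ∧ ∀ y,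
    ‖fderiv ℝ (cutoffNorm R) y‖ ≤ C ∧ |(Δ (cutoffNorm R)) y| ≤ C := by
  have hc := contDiff_cutoffNorm hR
  obtain ⟨C₁, h₁⟩ := (isCompact_closedBall (0 : Plane) (2 * R)).exists_bound_of_continuousOn
    (hc.continuous_fderiv (by norm_num)).continuousOn
  obtain ⟨C₂, h₂⟩ := (isCompact_closedBall (0 : Plane) (2 * R)).exists_bound_of_continuousOn
    (continuous_laplacian hc).continuousOn
  refine ⟨max (max C₁ C₂) (max 1 (2 * R)⁻¹), by positivity, fun y => ?_⟩
  rcases le_or_gt ‖y‖ (2 * R) with hy | hy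
  · have hy' : y ∈ Metric.closedBall (0 : Plane) (2 * R) := mem_closedBall_zero_iff.2 hy
    exact ⟨(h₁ y hy').trans ((le_max_left _ _).trans (le_max_left _ _)),
      (h₂ y hy').trans ((le_max_right _ _).trans (le_max_left _ _))⟩
  · have hy0 : 0 < ‖y‖ := by linarith
    refine ⟨le_trans ?_ ((le_max_left 1 _).trans (le_max_right _ _)),
      le_trans ?_ ((le_max_right _ _).trans (le_max_right _ _))⟩
    · refine ContinuousLinearMap.opNorm_le_bound _ zero_le_one fun v => ?_
      rw [fderiv_cutoffNorm hR hy, norm_div, norm_norm, div_le_iff₀ hy0, one_mul, mul_comm]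
      exact norm_inner_le_norm y v
    · rw [laplacian_cutoffNorm hR hy, abs_of_pos (inv_pos.2 hy0)]
      exact inv_anti₀ (by positivity) hy.le

end RadialFunctions


/-! ### Green's formula against a cut off plane wave. -/

section Transport

/-- The operator `Δ m - 2 i λ ∂_θ m`, which is `Δ + λ²` conjugated with `exp(-iλ⟨x, θ⟩)`. -/
noncomputable def transport (lam : ℝ) (θ : Plane) (m : Plane → ℝ) (y : Plane) : ℂ :=
  ((Δ m) y : ℝ) - 2 * I * lam * (fderiv ℝ m y θ : ℝ)

variable {𝒪 : Set Plane} {lam : ℝ} {θ : Plane} {ω : UnitCircle} {m : Plane → ℝ} {u : Plane → ℂ}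
  {b : UnitCircle → ℂ} {ν : Plane → Plane} {y : Plane}

theorem helmholtz_planeWave_mul (hθ : ‖θ‖ = 1) (hm : ContDiff ℝ 2 m) (y : Plane) :
    (Δ fun y => planeWave (-lam) θ y * (m y : ℂ)) y +
      (lam : ℂ) ^ 2 * (planeWave (-lam) θ y * (m y : ℂ)) =
        planeWave (-lam) θ y * transport lam θ m y := by
  set c := EuclideanSpace.basisFun (Fin 2) ℝ
  have hmc : ContDiff ℝ 2 fun y => (m y : ℂ) := ofRealCLM.contDiff.comp hm
  have h1 : (Δ fun y => (m y : ℂ)) y = (((Δ m) y : ℝ) : ℂ) :=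
    hm.contDiffAt.laplacian_CLM_comp_left (l := ofRealCLM)
  have h2 : ∀ v, fderiv ℝ (fun y => (m y : ℂ)) y v = (fderiv ℝ m y v : ℝ) := fun v => by
    have : HasFDerivAt (fun y => (m y : ℂ)) (ofRealCLM.comp (fderiv ℝ m y)) y :=
      ofRealCLM.hasFDerivAt.comp y (hm.differentiable (by norm_num) y).hasFDerivAt
    rw [this.fderiv]
    rfl
  have h3 : fderiv ℝ m y θ = ∑ i, ⟪c i, θ⟫ * fderiv ℝ m y (c i) := by
    conv_lhs => rw [← c.sum_repr' θ, map_sum]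
    simp
  rw [laplacian_mul c contDiff_planeWave.contDiffAt hmc.contDiffAt, h1, laplacian_planeWave, hθ,
    transport, h3]
  simp only [h2, fderiv_planeWave]
  push_cast
  simp only [mul_sub, Fin.sum_univ_two]
  ring

theorem transport_eq_zero (h : m =ᶠ[𝓝 y] fun _ => 1) : transport lam θ m y = 0 := by
  rw [transport, (InnerProductSpace.laplacian_congr_nhds h).eq_of_nhds, h.fderiv_eq]
  simp

theorem IsOutgoingSolution.isComplexDirichletSolution
    (hu : IsOutgoingSolution 𝒪 lam ω u b) :
    IsComplexDirichletSolution 𝒪 lam (perturbedPlaneWave lam ω u) where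
  continuousOn := (contDiff_planeWave (n := 0)).continuous.continuousOn.add hu.continuousOn
  contDiffOn := contDiff_planeWave.contDiffOn.add
    (hu.contDiffOn.of_le (WithTop.coe_le_coe.2 (le_top : (2 : ℕ∞) ≤ ⊤)))
  helmholtz x hx := by
    have h1 : ContDiffAt ℝ 2 u x := ((hu.contDiffOn.of_le (WithTop.coe_le_coe.2
      (le_top : (2 : ℕ∞) ≤ ⊤))).mono (t := (closure 𝒪)ᶜ) fun _ hy =>
        ⟨fun h => hy (subset_closure h), fun h => hy h.1.1⟩).contDiffAt
          (isClosed_closure.isOpen_compl.mem_nhds hx)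
    have h2 := hu.helmholtz x hx
    have h3 : perturbedPlaneWave lam ω u = planeWave lam ω + u := rfl
    have h4 : ‖(ω : Plane)‖ = 1 := by simp
    rw [h3, contDiff_planeWave.contDiffAt.laplacian_add h1, laplacian_planeWave, h4, Pi.add_apply,
      mul_one]
    linear_combination -h2
  boundary x hx := by rw [perturbedPlaneWave, hu.boundary x hx, add_neg_cancel]

theorem corners_empty : corners (∅ : Set Plane) = ∅ := by simp [corners]

/-- This is Green's formula for the empty obstacle, of which the plane wave is a Dirichlet solution
with no boundary condition to satisfy. -/
theorem integral_planeWave_mul_helmholtz {φ : Plane → ℂ} (hφ : ContDiff ℝ 2 φ)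
    (hφc : HasCompactSupport φ) :
    ∫ y, planeWave lam ω y * ((Δ φ) y + (lam : ℂ) ^ 2 * φ y) = 0 := by
  have h : IsComplexDirichletSolution ∅ lam (planeWave lam ω) :=
    ⟨(contDiff_planeWave (n := 0)).continuous.continuousOn, contDiff_planeWave.contDiffOn,
      fun x _ => by rw [laplacian_planeWave]; simp, by simp⟩
  have h1 := (h.green (ν := 0) isOpen_empty (by simp [corners_empty]) (by simp) hφ hφc).2
  simpa using h1.symm

/-- Since `m = 1` near `closure 𝒪`, `transport` of `m` vanishes there. The exterior integral of the
incident wave is thus an integral over the whole plane, which is zero, and only `u` is left in place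
of the total wave. -/
theorem green_transport (hO : IsOpen 𝒪) (hcorners : (corners 𝒪).Finite)
    (hν : ∀ x ∈ frontier 𝒪 \ corners 𝒪, IsOutwardUnitNormal 𝒪 x (ν x))
    (hu : IsOutgoingSolution 𝒪 lam ω u b) (hθ : ‖θ‖ = 1) (hm : ContDiff ℝ 2 m)
    (hmc : HasCompactSupport m) (hm1 : ∀ y ∈ closure 𝒪, m =ᶠ[𝓝 y] fun _ => 1) :
    IntegrableOn (fun y => planeWave (-lam) θ y *
      exteriorNormalDeriv 𝒪 (perturbedPlaneWave lam ω u) y (ν y)) (frontier 𝒪)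
      (Measure.hausdorffMeasure 1) ∧
    ∫ y in frontier 𝒪, planeWave (-lam) θ y *
      exteriorNormalDeriv 𝒪 (perturbedPlaneWave lam ω u) y (ν y) ∂(Measure.hausdorffMeasure 1) =
      ∫ y in (closure 𝒪)ᶜ, u y * (planeWave (-lam) θ y * transport lam θ m y) := by
  set φ : Plane → ℂ := fun y => planeWave (-lam) θ y * (m y : ℂ) with hφdef
  have hφ : ContDiff ℝ 2 φ := contDiff_planeWave.mul (ofRealCLM.contDiff.comp hm)
  have hφc : HasCompactSupport φ := (hmc.comp_left (g := ((↑) : ℝ → ℂ)) ofReal_zero).mul_left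
  obtain ⟨h1, h2⟩ := hu.isComplexDirichletSolution.green hO hcorners hν hφ hφc
  have e1 : EqOn (fun y => φ y * fderivWithin ℝ (perturbedPlaneWave lam ω u) 𝒪ᶜ y (ν y))
      (fun y => planeWave (-lam) θ y *
        exteriorNormalDeriv 𝒪 (perturbedPlaneWave lam ω u) y (ν y)) (frontier 𝒪) := by
    intro y hy
    have := (hm1 y hy.1).self_of_nhds
    simp [hφdef, this, exteriorNormalDeriv]
  refine ⟨h1.congr_fun e1 isClosed_frontier.measurableSet, ?_⟩
  rw [← setIntegral_congr_fun isClosed_frontier.measurableSet e1, h2]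
  have hT : ∀ y, (Δ φ) y + (lam : ℂ) ^ 2 * φ y = planeWave (-lam) θ y * transport lam θ m y :=
    fun y => helmholtz_planeWave_mul hθ hm y
  have hk : Continuous fun y => planeWave (-lam) θ y * transport lam θ m y := by
    have h4 := continuous_laplacian hm
    have h5 := hm.continuous_fderiv (by norm_num)
    have h6 := (contDiff_planeWave (n := 0) (lam := -lam) (ω := θ)).continuous
    unfold transport
    fun_prop
  have hkc : HasCompactSupport fun y => planeWave (-lam) θ y * transport lam θ m y :=
    HasCompactSupport.intro hφc fun y hy => by
      rw [← hT, laplacian_eq_zero_of_notMem_tsupport hy, image_eq_zero_of_notMem_tsupport hy]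
      simp
  have h3 := integral_planeWave_mul_helmholtz (lam := lam) (ω := ω) hφ hφc
  simp only [hT] at h3 ⊢
  have h4 : ∫ y in (closure 𝒪)ᶜ, planeWave lam ω y *
      (planeWave (-lam) θ y * transport lam θ m y) = 0 := by
    rw [setIntegral_eq_integral_of_forall_compl_eq_zero fun y hy => ?_, h3]
    rw [transport_eq_zero (hm1 y (not_not.1 hy))]
    simp
  simp only [perturbedPlaneWave, add_mul]
  rw [integral_add, h4, zero_add]
  · exact integrableOn_mul_of_hasCompactSupport hO
      (contDiff_planeWave (n := 0)).continuous.continuousOn hk hkc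
  · exact integrableOn_mul_of_hasCompactSupport hO hu.continuousOn hk hkc

end Transport


/-! ### Size of outgoing solutions. -/

section OutgoingBounds

variable {𝒪 : Set Plane} {lam : ℝ} {ω : UnitCircle} {u : Plane → ℂ} {b : UnitCircle → ℂ}

/-- The exponentials have modulus one and `b` is bounded on the compact circle. At the origin both
sides are `0`, by the conventions for division by zero and for negative powers of zero. -/
theorem exists_bound_outgoingLeadingTerm (lam : ℝ) (hb : Continuous b) :
    ∃ C, 0 ≤ C ∧ ∀ y, ‖outgoingLeadingTerm lam b y‖ ≤ C * ‖y‖ ^ (-(1 / 2) : ℝ) := by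
  obtain ⟨B, hB⟩ := isCompact_univ.exists_bound_of_continuousOn (hb.continuousOn (s := univ))
  have hB0 : 0 ≤ B := (norm_nonneg _).trans (hB (direction 0) (mem_univ _))
  refine ⟨Real.sqrt (2 * Real.pi) / ‖(lam : ℂ) ^ (1 / 2 : ℂ)‖ * B, by positivity, fun y => ?_⟩
  have h1 : ‖exp (-(Real.pi * I / 4))‖ = 1 := by
    rw [show -(Real.pi * I / 4) = ((-(Real.pi / 4) : ℝ) : ℂ) * I by push_cast; ring]
    exact norm_exp_ofReal_mul_I _
  have h2 : ‖exp (I * lam * ‖y‖)‖ = 1 := by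
    rw [show I * lam * ‖y‖ = ((lam * ‖y‖ : ℝ) : ℂ) * I by push_cast; ring]
    exact norm_exp_ofReal_mul_I _
  have h3 : Real.sqrt (2 * Real.pi / ‖y‖) = Real.sqrt (2 * Real.pi) * ‖y‖ ^ (-(1 / 2) : ℝ) := by
    rw [Real.sqrt_div' _ (norm_nonneg y), Real.sqrt_eq_rpow ‖y‖, Real.rpow_neg (norm_nonneg y),
      div_eq_mul_inv]
  rw [outgoingLeadingTerm, norm_mul, norm_mul, norm_mul, h1, h2, norm_div, norm_real,
    Real.norm_of_nonneg (Real.sqrt_nonneg _), h3]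
  have h4 := hB (direction y) (mem_univ _)
  have h5 : 0 ≤ ‖y‖ ^ (-(1 / 2) : ℝ) := Real.rpow_nonneg (norm_nonneg y) _
  calc _ = Real.sqrt (2 * Real.pi) / ‖(lam : ℂ) ^ (1 / 2 : ℂ)‖ * ‖y‖ ^ (-(1 / 2) : ℝ) *
        ‖b (direction y)‖ := by ring
    _ ≤ Real.sqrt (2 * Real.pi) / ‖(lam : ℂ) ^ (1 / 2 : ℂ)‖ * ‖y‖ ^ (-(1 / 2) : ℝ) * B := by gcongr
    _ = _ := by ring

theorem IsOutgoingSolution.exists_remainder_bound (hu : IsOutgoingSolution 𝒪 lam ω u b) :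
    ∃ R C, 1 ≤ R ∧ 0 ≤ C ∧ ∀ y, R ≤ ‖y‖ →
      ‖u y - outgoingLeadingTerm lam b y‖ ≤ C * ‖y‖ ^ (-(3 / 2) : ℝ) := by
  obtain ⟨C, hC⟩ := hu.outgoing.bound
  rw [← comap_norm_atTop, eventually_comap] at hC
  obtain ⟨R, hR⟩ := eventually_atTop.1 hC
  refine ⟨max R 1, max C 0, le_max_right _ _, le_max_right _ _, fun y hy => ?_⟩
  have h5 : 0 ≤ ‖y‖ ^ (-(3 / 2) : ℝ) := Real.rpow_nonneg (norm_nonneg y) _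
  have := hR ‖y‖ ((le_max_left _ _).trans hy) y rfl
  rw [Real.norm_of_nonneg h5] at this
  exact this.trans (mul_le_mul_of_nonneg_right (le_max_left _ _) h5)

theorem IsOutgoingSolution.exists_bound (hO : IsOpen 𝒪) (hu : IsOutgoingSolution 𝒪 lam ω u b) :
    ∃ M, 0 ≤ M ∧ ∀ y ∈ 𝒪ᶜ, ‖u y‖ ≤ M := by
  obtain ⟨R, C, hR, hC, hrem⟩ := hu.exists_remainder_bound
  obtain ⟨C', hC', hlead⟩ := exists_bound_outgoingLeadingTerm lam hu.amplitude_smooth.continuous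
  obtain ⟨M, hM⟩ := ((isCompact_closedBall (0 : Plane) R).inter_right
    hO.isClosed_compl).exists_bound_of_continuousOn (hu.continuousOn.mono inter_subset_right)
  refine ⟨max M (C + C'), le_max_of_le_right (by positivity), fun y hy => ?_⟩
  rcases le_or_gt ‖y‖ R with h | h
  · exact (hM y ⟨mem_closedBall_zero_iff.2 h, hy⟩).trans (le_max_left _ _)
  · refine le_trans ?_ (le_max_right _ _)
    have hy1 : 1 ≤ ‖y‖ := hR.trans h.le
    calc ‖u y‖ = ‖(u y - outgoingLeadingTerm lam b y) + outgoingLeadingTerm lam b y‖ := by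
          rw [sub_add_cancel]
      _ ≤ C * ‖y‖ ^ (-(3 / 2) : ℝ) + C' * ‖y‖ ^ (-(1 / 2) : ℝ) :=
          (norm_add_le _ _).trans (add_le_add (hrem y h.le) (hlead y))
      _ ≤ C * 1 + C' * 1 := by
          gcongr
          · exact Real.rpow_le_one_of_one_le_of_nonpos hy1 (by norm_num)
          · exact Real.rpow_le_one_of_one_le_of_nonpos hy1 (by norm_num)
      _ = C + C' := by ring

end OutgoingBounds

/-! ### The damping factor and its truncations. -/

section Damping

/-- A smooth bump function on the line. -/
def lineBump : ContDiffBump (0 : ℝ) := ⟨1, 2, one_pos, one_lt_two⟩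

theorem deriv_exp_mul {h : ℝ → ℝ} (hh : Differentiable ℝ h) (ε : ℝ) :
    deriv (fun t => Real.exp (-(ε * t)) * h t) =
      fun t => Real.exp (-(ε * t)) * (deriv h t - ε * h t) := by
  ext t
  have h1 : HasDerivAt (fun t : ℝ => -(ε * t)) (-ε) t := by
    simpa using ((hasDerivAt_id t).const_mul ε).fun_neg
  rw [(h1.exp.fun_mul (hh t).hasDerivAt).deriv]
  ring

theorem deriv_deriv_exp_mul {h : ℝ → ℝ} (hh : ContDiff ℝ 2 h) (ε : ℝ) :
    deriv (deriv fun t => Real.exp (-(ε * t)) * h t) =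
      fun t => Real.exp (-(ε * t)) * (deriv (deriv h) t - 2 * ε * deriv h t + ε ^ 2 * h t) := by
  have h1 : Differentiable ℝ h := hh.differentiable (by norm_num)
  have h2 : Differentiable ℝ (deriv h) := hh.deriv_one.differentiable (by norm_num)
  rw [deriv_exp_mul h1, deriv_exp_mul (h2.fun_sub (h1.const_mul ε))]
  ext t
  rw [deriv_fun_sub (h2 t) ((h1 t).const_mul ε), deriv_const_mul _ (h1 t)]
  ring

/-- The damping factor `exp(-εt)`, cut off where `t` is of order `n`. -/
noncomputable def truncatedDamping (ε : ℝ) (n : ℕ) (t : ℝ) : ℝ :=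
  Real.exp (-(ε * t)) * lineBump (((n : ℝ) + 1)⁻¹ * t)

variable {ε : ℝ} {n : ℕ} {t : ℝ}

theorem contDiff_lineBump_mul (c : ℝ) : ContDiff ℝ 2 fun t : ℝ => lineBump (c * t) :=
  (lineBump.contDiff (n := 2)).comp (by fun_prop)

theorem contDiff_truncatedDamping : ContDiff ℝ 2 (truncatedDamping ε n) :=
  ContDiff.mul (by fun_prop) (contDiff_lineBump_mul _)

theorem contDiff_damping (ε : ℝ) : ContDiff ℝ 2 fun t : ℝ => Real.exp (-(ε * t)) := by fun_prop

theorem truncatedDamping_zero : truncatedDamping ε n 0 = 1 := by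
  rw [truncatedDamping, mul_zero, mul_zero, neg_zero, Real.exp_zero, one_mul,
    lineBump.one_of_mem_closedBall]
  exact Metric.mem_closedBall_self zero_le_one

theorem truncatedDamping_eq_zero (ht : 2 * ((n : ℝ) + 1) ≤ t) : truncatedDamping ε n t = 0 := by
  rw [truncatedDamping, lineBump.zero_of_le_dist, mul_zero]
  have hn : (0 : ℝ) < n + 1 := by positivity
  rw [dist_zero_right, norm_mul, norm_inv, Real.norm_of_nonneg hn.le, ← div_eq_inv_mul,
    le_div_iff₀ hn]
  exact ht.trans (le_abs_self t)

theorem eventually_truncatedDamping_eventuallyEq (ε t : ℝ) :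
    ∀ᶠ n : ℕ in atTop, truncatedDamping ε n =ᶠ[𝓝 t] fun t => Real.exp (-(ε * t)) := by
  filter_upwards [tendsto_natCast_atTop_atTop.eventually_gt_atTop |t|] with n hn
  filter_upwards [continuous_abs.continuousAt.eventually_lt_const hn] with s hs
  rw [truncatedDamping, lineBump.one_of_mem_closedBall, mul_one]
  have hn : (0 : ℝ) < n + 1 := by positivity
  rw [mem_closedBall_zero_iff, norm_mul, norm_inv, Real.norm_of_nonneg hn.le]
  exact (inv_mul_le_one₀ hn).2 (by rw [Real.norm_eq_abs]; linarith)

/-- The truncation is dilated by `1/(n + 1) ≤ 1`, which only decreases its derivatives. The bound is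
uniform in `n`, as dominated convergence requires. -/
theorem exists_bound_truncatedDamping (ε : ℝ) : ∃ K, 0 ≤ K ∧ ∀ (n : ℕ) (t : ℝ),
    |deriv (truncatedDamping ε n) t| ≤ K * Real.exp (-(ε * t)) ∧
    |deriv (deriv (truncatedDamping ε n)) t| ≤ K * Real.exp (-(ε * t)) := by
  have hβ : ContDiff ℝ 2 lineBump := lineBump.contDiff
  have hβc : HasCompactSupport lineBump := lineBump.hasCompactSupport
  obtain ⟨B₁, h₁⟩ := hβc.deriv.exists_bound_of_continuous hβ.deriv_one.continuous
  obtain ⟨B₂, h₂⟩ := hβc.deriv.deriv.exists_bound_of_continuous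
    (hβ.deriv_one.continuous_deriv le_rfl)
  have hB₁ := (norm_nonneg _).trans (h₁ 0)
  have hB₂ := (norm_nonneg _).trans (h₂ 0)
  refine ⟨(B₁ + |ε|) + (B₂ + 2 * |ε| * B₁ + ε ^ 2), by positivity, fun n t => ?_⟩
  set c : ℝ := ((n : ℝ) + 1)⁻¹ with hc
  have hc0 : 0 ≤ c := by positivity
  have hc1 : c ≤ 1 := inv_le_one_of_one_le₀ (by linarith [n.cast_nonneg (α := ℝ)])
  have hd1 : deriv (fun t : ℝ => lineBump (c * t)) = fun t => c * deriv lineBump (c * t) := by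
    ext t
    exact deriv_comp_mul_left c lineBump t
  have hd2 : deriv (deriv (fun t : ℝ => lineBump (c * t))) =
      fun t => c * (c * deriv (deriv lineBump) (c * t)) := by
    rw [hd1]
    ext t
    rw [deriv_const_mul_field]
    congr 1
    exact deriv_comp_mul_left c (deriv lineBump) t
  have a0 : |lineBump (c * t)| ≤ 1 := by
    rw [abs_of_nonneg lineBump.nonneg]
    exact lineBump.le_one
  have a1 : |c * deriv lineBump (c * t)| ≤ B₁ := by
    rw [abs_mul, abs_of_nonneg hc0]
    exact (mul_le_of_le_one_left (abs_nonneg _) hc1).trans (h₁ _)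
  have a2 : |c * (c * deriv (deriv lineBump) (c * t))| ≤ B₂ := by
    rw [abs_mul, abs_mul, abs_of_nonneg hc0]
    exact (mul_le_of_le_one_left (by positivity) hc1).trans
      ((mul_le_of_le_one_left (abs_nonneg _) hc1).trans (h₂ _))
  have e1 : deriv (truncatedDamping ε n) t = Real.exp (-(ε * t)) *
      (c * deriv lineBump (c * t) - ε * lineBump (c * t)) := by
    have := congrFun (deriv_exp_mul ((contDiff_lineBump_mul c).differentiable (by norm_num)) ε) t
    rw [hd1] at this
    exact this
  have e2 : deriv (deriv (truncatedDamping ε n)) t = Real.exp (-(ε * t)) *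
      (c * (c * deriv (deriv lineBump) (c * t)) - 2 * ε * (c * deriv lineBump (c * t)) +
        ε ^ 2 * lineBump (c * t)) := by
    have := congrFun (deriv_deriv_exp_mul (contDiff_lineBump_mul c) ε) t
    rw [hd2, hd1] at this
    exact this
  have b1 : |c * deriv lineBump (c * t) - ε * lineBump (c * t)| ≤ B₁ + |ε| := by
    refine (abs_sub _ _).trans (add_le_add a1 ?_)
    rw [abs_mul]
    exact mul_le_of_le_one_right (abs_nonneg _) a0
  have b2 : |c * (c * deriv (deriv lineBump) (c * t)) - 2 * ε * (c * deriv lineBump (c * t)) +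
        ε ^ 2 * lineBump (c * t)| ≤ B₂ + 2 * |ε| * B₁ + ε ^ 2 := by
    refine (abs_add_le _ _).trans (add_le_add ((abs_sub _ _).trans (add_le_add a2 ?_)) ?_)
    · rw [abs_mul, abs_mul, abs_two]
      gcongr
    · rw [abs_mul, abs_of_nonneg (sq_nonneg ε)]
      exact mul_le_of_le_one_right (sq_nonneg ε) a0
  have hexp := Real.exp_pos (-(ε * t))
  rw [e1, e2, abs_mul, abs_mul, abs_of_pos hexp, mul_comm _ (Real.exp _)]
  constructor
  · refine mul_le_mul_of_nonneg_left (b1.trans (le_add_of_nonneg_right (by positivity))) hexp.le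
  · refine mul_le_mul_of_nonneg_left (b2.trans (le_add_of_nonneg_left (by positivity))) hexp.le

end Damping


/-! ### Green's formula against a damped plane wave. -/

section DampedGreen

variable {𝒪 : Set Plane} {lam R ε : ℝ} {θ : Plane} {ω : UnitCircle} {u : Plane → ℂ}
  {b : UnitCircle → ℂ} {ν : Plane → Plane} {f : ℝ → ℝ} {y : Plane}

/-- Polar coordinates reduce this to a Gamma integral. The power `ε^(-(s + 2))` is what decides
which error terms survive as `ε → 0`. -/
theorem integrable_norm_rpow_mul_exp {s : ℝ} (hs : -2 < s) (hε : 0 < ε) :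
    Integrable (fun y : Plane => ‖y‖ ^ s * Real.exp (-(ε * ‖y‖))) ∧
    ∫ y : Plane, ‖y‖ ^ s * Real.exp (-(ε * ‖y‖)) = 2 * volume.real (Metric.ball (0 : Plane) 1) *
      ((1 / ε) ^ (s + 2) * Real.Gamma (s + 2)) := by
  have e : EqOn (fun r : ℝ => r ^ (s + 2 - 1) * Real.exp (-(ε * r)))
      (fun r => r ^ (Module.finrank ℝ Plane - 1) • (r ^ s * Real.exp (-(ε * r)))) (Ioi 0) := by
    intro r hr
    have h1 : s + 2 - 1 = s + 1 := by ring
    simp only [finrank_euclideanSpace_fin, smul_eq_mul, h1, Real.rpow_add_one (ne_of_gt hr)]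
    ring
  constructor
  · rw [integrable_fun_norm_addHaar volume (f := fun r => r ^ s * Real.exp (-(ε * r)))]
    refine IntegrableOn.congr_fun ?_ e measurableSet_Ioi
    have := integrableOn_rpow_mul_exp_neg_mul_rpow (p := 1) (s := s + 2 - 1) (b := ε)
      (by linarith) one_pos hε
    simpa [neg_mul] using this
  · rw [integral_fun_norm_addHaar volume (fun r => r ^ s * Real.exp (-(ε * r))),
      ← setIntegral_congr_fun measurableSet_Ioi e, Real.integral_rpow_mul_exp_neg_mul_Ioi
        (by linarith) hε, finrank_euclideanSpace_fin]
    simp [mul_assoc]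

theorem transport_comp (hf : ContDiff ℝ 2 f) {ρ : Plane → ℝ} (hρ : ContDiff ℝ 2 ρ) :
    transport lam θ (fun x => f (ρ x)) y =
      (deriv (deriv f) (ρ y) * ∑ i, fderiv ℝ ρ y (EuclideanSpace.basisFun (Fin 2) ℝ i) ^ 2 : ℝ) +
        deriv f (ρ y) * transport lam θ ρ y := by
  have h1 : fderiv ℝ (fun x => f (ρ x)) y = deriv f (ρ y) • fderiv ℝ ρ y :=
    ((hf.differentiable (by norm_num) _).hasDerivAt.comp_hasFDerivAt y
      (hρ.differentiable (by norm_num) y).hasFDerivAt).fderiv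
  rw [transport, laplacian_comp_left (EuclideanSpace.basisFun (Fin 2) ℝ) hf hρ, h1, transport]
  simp only [smul_apply, smul_eq_mul]
  push_cast
  ring

theorem exists_bound_transport_cutoffNorm (lam : ℝ) (hR : 0 < R) (hθ : ‖θ‖ = 1) :
    ∃ K, 0 ≤ K ∧ ∀ (f : ℝ → ℝ), ContDiff ℝ 2 f → ∀ y,
      ‖transport lam θ (fun x => f (cutoffNorm R x)) y‖ ≤
        K * (|deriv f (cutoffNorm R y)| + |deriv (deriv f) (cutoffNorm R y)|) := by
  obtain ⟨C, hC, hCb⟩ := exists_bound_cutoffNorm hR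
  refine ⟨2 * C ^ 2 + (C + 2 * |lam| * C), by positivity, fun f hf y => ?_⟩
  obtain ⟨h1, h2⟩ := hCb y
  have h3 : ∀ v : Plane, ‖v‖ = 1 → |fderiv ℝ (cutoffNorm R) y v| ≤ C := fun v hv => by
    have := (fderiv ℝ (cutoffNorm R) y).le_opNorm v
    rw [hv, mul_one] at this
    exact this.trans h1
  have h4 : ‖transport lam θ (cutoffNorm R) y‖ ≤ C + 2 * |lam| * C := by
    refine (norm_sub_le _ _).trans (add_le_add ?_ ?_)
    · rwa [norm_real]
    · simp only [norm_mul, norm_real, norm_I, mul_one, norm_ofNat, Real.norm_eq_abs]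
      exact mul_le_mul_of_nonneg_left (h3 θ hθ) (by positivity)
  have h5 : |∑ i, fderiv ℝ (cutoffNorm R) y (EuclideanSpace.basisFun (Fin 2) ℝ i) ^ 2| ≤
      2 * C ^ 2 := by
    rw [abs_of_nonneg (Finset.sum_nonneg fun i _ => sq_nonneg _), Fin.sum_univ_two]
    have h6 : ∀ i, fderiv ℝ (cutoffNorm R) y (EuclideanSpace.basisFun (Fin 2) ℝ i) ^ 2 ≤ C ^ 2 :=
      fun i => sq_le_sq' (abs_le.1 (h3 _ (OrthonormalBasis.norm_eq_one _ i))).1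
        (abs_le.1 (h3 _ (OrthonormalBasis.norm_eq_one _ i))).2
    linarith [h6 0, h6 1]
  rw [transport_comp hf (contDiff_cutoffNorm hR)]
  refine (norm_add_le _ _).trans ?_
  rw [norm_real, norm_mul, norm_mul, norm_real, Real.norm_eq_abs, Real.norm_eq_abs,
    Real.norm_eq_abs]
  have m1 := mul_le_mul_of_nonneg_left h5 (abs_nonneg (deriv (deriv f) (cutoffNorm R y)))
  have m2 := mul_le_mul_of_nonneg_left h4 (abs_nonneg (deriv f (cutoffNorm R y)))
  have m3 : 0 ≤ |deriv (deriv f) (cutoffNorm R y)| * (C + 2 * |lam| * C) := by positivity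
  have m4 : 0 ≤ |deriv f (cutoffNorm R y)| * (2 * C ^ 2) := by positivity
  linarith

theorem continuous_transport {m : Plane → ℝ} (hm : ContDiff ℝ 2 m) :
    Continuous (transport lam θ m) := by
  have h4 := continuous_laplacian hm
  have h5 := hm.continuous_fderiv (by norm_num)
  unfold transport
  fun_prop

/-- The boundary integral as a volume integral against a damped plane wave. -/
theorem green_damped (hO : IsOpen 𝒪) (hcorners : (corners 𝒪).Finite)
    (hν : ∀ x ∈ frontier 𝒪 \ corners 𝒪, IsOutwardUnitNormal 𝒪 x (ν x))
    (hu : IsOutgoingSolution 𝒪 lam ω u b) (hθ : ‖θ‖ = 1) (hR : 0 < R)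
    (hOR : closure 𝒪 ⊆ Metric.ball 0 R) (hε : 0 < ε) :
    IntegrableOn (fun y => u y * (planeWave (-lam) θ y *
        transport lam θ (fun x => Real.exp (-(ε * cutoffNorm R x))) y)) (closure 𝒪)ᶜ ∧
    ∫ y in frontier 𝒪, planeWave (-lam) θ y *
      exteriorNormalDeriv 𝒪 (perturbedPlaneWave lam ω u) y (ν y) ∂(Measure.hausdorffMeasure 1) =
      ∫ y in (closure 𝒪)ᶜ, u y * (planeWave (-lam) θ y *
        transport lam θ (fun x => Real.exp (-(ε * cutoffNorm R x))) y) := by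
  have hρ := contDiff_cutoffNorm hR
  obtain ⟨M, hM, huM⟩ := hu.exists_bound hO
  obtain ⟨K, hK, hKb⟩ := exists_bound_transport_cutoffNorm lam hR hθ
  obtain ⟨B, hB, hBb⟩ := exists_bound_truncatedDamping ε
  -- The damping factor lacks compact support, so Green's formula is applied to its truncations and
  -- `n → ∞` is taken at fixed `ε`.
  have hgreen := fun n : ℕ => (green_transport hO hcorners hν hu hθ
    (m := fun x => truncatedDamping ε n (cutoffNorm R x)) (contDiff_truncatedDamping.comp hρ)
    (HasCompactSupport.intro (isCompact_closedBall 0 (2 * ((n : ℝ) + 1) + 2 * R)) fun y hy => by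
      rw [mem_closedBall_zero_iff, not_le] at hy
      exact truncatedDamping_eq_zero (by linarith [norm_sub_le_cutoffNorm (y := y) hR]))
    fun y hy => by
      filter_upwards [Metric.isOpen_ball.mem_nhds (hOR hy)] with z hz
      rw [cutoffNorm_eq_zero hR (mem_ball_zero_iff.1 hz).le, truncatedDamping_zero]).2
  set F : ℕ → Plane → ℂ := fun n y => u y * (planeWave (-lam) θ y *
    transport lam θ (fun x => truncatedDamping ε n (cutoffNorm R x)) y)
  have hcont : ∀ f : ℝ → ℝ, ContDiff ℝ 2 f → ContinuousOn (fun y => u y * (planeWave (-lam) θ y *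
      transport lam θ (fun x => f (cutoffNorm R x)) y)) (closure 𝒪)ᶜ := fun f hf =>
    (hu.continuousOn.mono (compl_subset_compl.2 subset_closure)).mul
      ((contDiff_planeWave (n := 0)).continuous.mul
        (continuous_transport (hf.comp hρ))).continuousOn
  have hmeas : MeasurableSet (closure 𝒪)ᶜ := isClosed_closure.isOpen_compl.measurableSet
  have hle : ∀ y ∈ (closure 𝒪)ᶜ, ∀ (f : ℝ → ℝ), ContDiff ℝ 2 f → 
      ‖u y * (planeWave (-lam) θ y * transport lam θ (fun x => f (cutoffNorm R x)) y)‖ ≤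
      M * (K * (|deriv f (cutoffNorm R y)| + |deriv (deriv f) (cutoffNorm R y)|)) := by
    intro y hy f hf
    rw [norm_mul, norm_mul, norm_planeWave, one_mul]
    exact mul_le_mul (huM y fun h => hy (subset_closure h)) (hKb f hf y) (norm_nonneg _) hM
  have hbound : ∀ n, ∀ y ∈ (closure 𝒪)ᶜ, ‖F n y‖ ≤
      M * (K * (2 * B)) * Real.exp (ε * (2 * R)) *
        (‖y‖ ^ (0 : ℝ) * Real.exp (-(ε * ‖y‖))) := by
    intro n y hy
    refine (hle y hy _ contDiff_truncatedDamping).trans ?_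
    obtain ⟨b1, b2⟩ := hBb n (cutoffNorm R y)
    have b3 : Real.exp (-(ε * cutoffNorm R y)) ≤ Real.exp (ε * (2 * R)) *
        Real.exp (-(ε * ‖y‖)) := by
      rw [← Real.exp_add, Real.exp_le_exp]
      nlinarith [norm_sub_le_cutoffNorm (y := y) hR]
    calc _ ≤ M * (K * (B * Real.exp (-(ε * cutoffNorm R y)) +
          B * Real.exp (-(ε * cutoffNorm R y)))) := by gcongr
      _ = M * (K * (2 * B)) * Real.exp (-(ε * cutoffNorm R y)) := by ring
      _ ≤ M * (K * (2 * B)) * (Real.exp (ε * (2 * R)) * Real.exp (-(ε * ‖y‖))) := by gcongr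
      _ = _ := by rw [Real.rpow_zero]; ring
  have hdom : IntegrableOn (fun y : Plane => M * (K * (2 * B)) * Real.exp (ε * (2 * R)) *
        (‖y‖ ^ (0 : ℝ) * Real.exp (-(ε * ‖y‖)))) (closure 𝒪)ᶜ :=
    ((integrable_norm_rpow_mul_exp (by norm_num) hε).1.const_mul _).integrableOn
  have hlim : ∀ y, ∀ᶠ n in atTop, F n y = u y * (planeWave (-lam) θ y *
        transport lam θ (fun x => Real.exp (-(ε * cutoffNorm R x))) y) := by
    intro y
    filter_upwards [eventually_truncatedDamping_eventuallyEq ε (cutoffNorm R y)] with n hn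
    have h1 : (fun x => truncatedDamping ε n (cutoffNorm R x)) =ᶠ[𝓝 y]
        fun x => Real.exp (-(ε * cutoffNorm R x)) := hρ.continuous.continuousAt.eventually hn
    simp only [F, transport, (InnerProductSpace.laplacian_congr_nhds h1).eq_of_nhds, h1.fderiv_eq]
  have hlim' : ∀ y, Tendsto (fun n => F n y) atTop (𝓝 (u y * (planeWave (-lam) θ y *
        transport lam θ (fun x => Real.exp (-(ε * cutoffNorm R x))) y))) := fun y =>
    tendsto_const_nhds.congr' ((hlim y).mono fun n hn => hn.symm)
  constructor
  · refine hdom.mono' ((hcont _ (contDiff_damping ε)).aestronglyMeasurable hmeas) ?_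
    refine (ae_restrict_iff' hmeas).2 (ae_of_all _ fun y hy => ?_)
    obtain ⟨n, hn⟩ := (hlim y).exists
    rw [← hn]
    exact hbound n y hy
  · have ht := tendsto_integral_of_dominated_convergence (μ := volume.restrict (closure 𝒪)ᶜ)
      _ (fun n => (hcont _ contDiff_truncatedDamping).aestronglyMeasurable hmeas) hdom
      (fun n => (ae_restrict_iff' hmeas).2 (ae_of_all _ (hbound n)))
      (ae_of_all _ fun y => hlim' y)
    refine tendsto_nhds_unique (tendsto_const_nhds.congr fun n => ?_) ht
    exact hgreen n

/-- The boundary integral in terms of the behaviour of `u` near infinity. -/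
theorem tendsto_integral_exterior (hO : IsOpen 𝒪) (hcorners : (corners 𝒪).Finite)
    (hν : ∀ x ∈ frontier 𝒪 \ corners 𝒪, IsOutwardUnitNormal 𝒪 x (ν x))
    (hu : IsOutgoingSolution 𝒪 lam ω u b) (hθ : ‖θ‖ = 1) (hR : 0 < R)
    (hOR : closure 𝒪 ⊆ Metric.ball 0 R) :
    Tendsto (fun ε : ℝ => ∫ y in {y : Plane | 2 * R < ‖y‖}, u y * (planeWave (-lam) θ y *
      (Real.exp (-(ε * ‖y‖)) * ((ε ^ 2 - ε / ‖y‖ : ℝ) + 2 * I * lam * ε * (⟪y, θ⟫ / ‖y‖ : ℝ)))))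
      (𝓝[>] 0) (𝓝 (∫ y in frontier 𝒪, planeWave (-lam) θ y *
        exteriorNormalDeriv 𝒪 (perturbedPlaneWave lam ω u) y (ν y)
          ∂(Measure.hausdorffMeasure 1))) := by
  set J := ∫ y in frontier 𝒪, planeWave (-lam) θ y *
        exteriorNormalDeriv 𝒪 (perturbedPlaneWave lam ω u) y (ν y)
          ∂(Measure.hausdorffMeasure 1) with hJ
  have hρ := contDiff_cutoffNorm hR
  obtain ⟨M, hM, huM⟩ := hu.exists_bound hO
  obtain ⟨K, hK, hKb⟩ := exists_bound_transport_cutoffNorm lam hR hθ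
  have hd1 : ∀ ε, deriv (fun t : ℝ => Real.exp (-(ε * t))) =
      fun t => -ε * Real.exp (-(ε * t)) := fun ε => by
    have := deriv_exp_mul (differentiable_const (1 : ℝ)) ε
    simp only [mul_one, deriv_const', zero_sub] at this
    rw [this]
    ext t
    ring
  have hd2 : ∀ ε, deriv (deriv (fun t : ℝ => Real.exp (-(ε * t)))) =
      fun t => ε ^ 2 * Real.exp (-(ε * t)) := fun ε => by
    have := deriv_deriv_exp_mul (contDiff_const (c := (1 : ℝ))) ε
    simp only [mul_one, deriv_const', mul_zero, sub_zero, zero_add] at this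
    rw [this]
    ext t
    ring
  set G : ℝ → Plane → ℂ := fun ε y => u y * (planeWave (-lam) θ y *
    transport lam θ (fun x => Real.exp (-(ε * cutoffNorm R x))) y) with hG
  have hext : {y : Plane | 2 * R < ‖y‖} ⊆ (closure 𝒪)ᶜ := fun y hy h => by
    have h1 := mem_ball_zero_iff.1 (hOR h)
    have h2 : 2 * R < ‖y‖ := hy
    linarith
  have hopen : IsOpen {y : Plane | 2 * R < ‖y‖} := isOpen_lt continuous_const continuous_norm
  have hGout : ∀ ε, ∀ y ∈ {y : Plane | 2 * R < ‖y‖}, G ε y = u y * (planeWave (-lam) θ y *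
      (Real.exp (-(ε * ‖y‖)) * ((ε ^ 2 - ε / ‖y‖ : ℝ) +
        2 * I * lam * ε * (⟪y, θ⟫ / ‖y‖ : ℝ)))) := by
    intro ε y hy
    have hy' : 2 * R < ‖y‖ := hy
    have hy0 : 0 < ‖y‖ := by linarith
    simp only [hG]
    rw [transport_comp (contDiff_damping ε) hρ, hd2, hd1, transport, laplacian_cutoffNorm hR hy',
      cutoffNorm_eq_norm hR hy'.le]
    simp only [fderiv_cutoffNorm hR hy', div_pow]
    have h3 := (EuclideanSpace.basisFun (Fin 2) ℝ).sum_sq_norm_inner_left y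
    simp only [Real.norm_eq_abs, sq_abs] at h3
    rw [← Finset.sum_div, h3, div_self (pow_pos hy0 2).ne']
    push_cast
    ring
  -- Every derivative of `exp(-ερ)` carries a factor `ε`, so a bounded region, in particular the one
  -- where the norm is modified, contributes `O(ε)`.
  have hin : ∀ ε ∈ Ioo (0 : ℝ) 1, ∀ y ∈ (closure 𝒪)ᶜ, ‖G ε y‖ ≤ M * (K * (2 * ε)) := by
    intro ε hε y hy
    simp only [hG]
    rw [norm_mul, norm_mul, norm_planeWave, one_mul]
    refine mul_le_mul (huM y fun h => hy (subset_closure h)) ((hKb _ (contDiff_damping ε) y).trans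
      (mul_le_mul_of_nonneg_left ?_ hK)) (norm_nonneg _) hM
    have h1 : Real.exp (-(ε * cutoffNorm R y)) ≤ 1 :=
      Real.exp_le_one_iff.2 (neg_nonpos.2 (mul_nonneg hε.1.le cutoffNorm_nonneg))
    rw [hd2, hd1, abs_mul, abs_mul, abs_of_pos (Real.exp_pos _), abs_neg, abs_of_pos hε.1,
      abs_of_nonneg (sq_nonneg ε)]
    have h2 := mul_le_of_le_one_right hε.1.le h1
    have h3 := mul_le_of_le_one_right (sq_nonneg ε) h1
    nlinarith [hε.1, hε.2]
  set D := (closure 𝒪)ᶜ \ {y : Plane | 2 * R < ‖y‖} with hD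
  have hDball : D ⊆ Metric.closedBall 0 (2 * R) := fun y hy =>
    mem_closedBall_zero_iff.2 (not_lt.1 hy.2)
  have hDfin : volume D < ⊤ := (measure_mono hDball).trans_lt measure_closedBall_lt_top
  have key : ∀ ε ∈ Ioo (0 : ℝ) 1, ‖(∫ y in {y : Plane | 2 * R < ‖y‖}, G ε y) - J‖ ≤
      M * (K * (2 * ε)) * volume.real D := by
    intro ε hε
    obtain ⟨hi, he⟩ := green_damped hO hcorners hν hu hθ hR hOR hε.1
    rw [hJ, he, ← norm_neg, neg_sub, ← setIntegral_sdiff hopen.measurableSet hi hext]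
    exact norm_setIntegral_le_of_norm_le_const hDfin fun y hy => hin ε hε y hy.1
  have hev : ∀ᶠ ε in 𝓝[>] (0 : ℝ), ε ∈ Ioo (0 : ℝ) 1 := Ioo_mem_nhdsGT one_pos
  have hzero : Tendsto (fun ε : ℝ => M * (K * (2 * ε)) * volume.real D) (𝓝[>] 0) (𝓝 0) := by
    have : Continuous fun ε : ℝ => M * (K * (2 * ε)) * volume.real D := by fun_prop
    simpa using (this.tendsto 0).mono_left (nhdsWithin_le_nhds (s := Ioi 0))
  have hmain : Tendsto (fun ε => ∫ y in {y : Plane | 2 * R < ‖y‖}, G ε y) (𝓝[>] 0) (𝓝 J) :=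
    tendsto_iff_norm_sub_tendsto_zero.2
      (squeeze_zero' (Eventually.of_forall fun _ => norm_nonneg _) (hev.mono key) hzero)
  exact hmain.congr fun ε => setIntegral_congr_fun hopen.measurableSet (hGout ε)

end DampedGreen


/-! ### Reduction to the leading term of the outgoing solution. -/

section LeadingTerm

variable {𝒪 : Set Plane} {lam R ε : ℝ} {θ : Plane} {ω : UnitCircle} {u : Plane → ℂ}
  {b : UnitCircle → ℂ} {ν : Plane → Plane} {y : Plane}

theorem coe_direction (hy : y ≠ 0) : (direction y : Plane) = ‖y‖⁻¹ • y := by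
  simp [direction, hy]

theorem continuousOn_direction : ContinuousOn direction {0}ᶜ := by
  rw [Topology.IsInducing.subtypeVal.continuousOn_iff]
  have : ContinuousOn (fun y : Plane => ‖y‖⁻¹ • y) {0}ᶜ :=
    (continuousOn_id.norm.inv₀ fun y hy => norm_ne_zero_iff.2 hy).smul continuousOn_id
  exact this.congr fun y hy => coe_direction hy

theorem continuousOn_outgoingLeadingTerm (hb : Continuous b) :
    ContinuousOn (outgoingLeadingTerm lam b) {0}ᶜ := by
  unfold outgoingLeadingTerm
  have h1 : ContinuousOn (fun y : Plane => Real.sqrt (2 * Real.pi / ‖y‖)) {0}ᶜ :=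
    (continuousOn_const.div continuousOn_id.norm fun y hy => norm_ne_zero_iff.2 hy).sqrt
  have h2 : ContinuousOn (fun y : Plane => ((Real.sqrt (2 * Real.pi / ‖y‖) : ℝ) : ℂ)) {0}ᶜ :=
    continuous_ofReal.comp_continuousOn h1
  have h3 : Continuous fun y : Plane => exp (I * lam * ‖y‖) := by fun_prop
  exact ((continuousOn_const.mul (h2.div_const _)).mul h3.continuousOn).mul
    (hb.comp_continuousOn continuousOn_direction)

/-- The kernel whose integrals against `u` are asymptotically the boundary integral. -/
noncomputable def dampedKernel (lam : ℝ) (θ : Plane) (ε : ℝ) (y : Plane) : ℂ :=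
  planeWave (-lam) θ y * (Real.exp (-(ε * ‖y‖)) * (2 * I * lam * ε * (⟪y, θ⟫ / ‖y‖ : ℝ)))

theorem abs_inner_div_norm_le (hθ : ‖θ‖ = 1) : |⟪y, θ⟫ / ‖y‖| ≤ 1 := by
  rw [abs_div, abs_norm]
  refine div_le_one_of_le₀ ?_ (norm_nonneg y)
  simpa [hθ] using abs_real_inner_le_norm y θ

theorem norm_dampedKernel_le (hθ : ‖θ‖ = 1) (hε : 0 < ε) :
    ‖dampedKernel lam θ ε y‖ ≤ 2 * |lam| * ε * Real.exp (-(ε * ‖y‖)) := by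
  simp only [dampedKernel, norm_mul, norm_planeWave, norm_real, norm_I, norm_ofNat,
    Real.norm_eq_abs, abs_of_pos hε, Real.abs_exp, one_mul, mul_one]
  rw [mul_comm]
  exact mul_le_mul_of_nonneg_right (mul_le_of_le_one_right (by positivity)
    (abs_inner_div_norm_le hθ)) (Real.exp_pos _).le

theorem continuousOn_dampedKernel : ContinuousOn (dampedKernel lam θ ε) {0}ᶜ := by
  have h1 : ContinuousOn (fun y : Plane => ⟪y, θ⟫ / ‖y‖) {0}ᶜ :=
    ContinuousOn.div (by fun_prop) continuousOn_id.norm fun y hy => norm_ne_zero_iff.2 hy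
  have h2 : ContinuousOn (fun y : Plane => ((⟪y, θ⟫ / ‖y‖ : ℝ) : ℂ)) {0}ᶜ :=
    continuous_ofReal.comp_continuousOn h1
  have h3 : Continuous fun y : Plane => ((Real.exp (-(ε * ‖y‖)) : ℝ) : ℂ) := by fun_prop
  exact (contDiff_planeWave (n := 0)).continuous.continuousOn.mul
    (h3.continuousOn.mul (continuousOn_const.mul h2))

theorem aestronglyMeasurable_of_continuousOn_compl_zero {f : Plane → ℂ}
    (hf : ContinuousOn f {0}ᶜ) : AEStronglyMeasurable f volume := by
  rw [← restrict_compl_singleton (μ := (volume : Measure Plane)) 0]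
  exact hf.aestronglyMeasurable (measurableSet_singleton 0).compl

theorem integrable_outgoingLeadingTerm_mul_dampedKernel (hb : Continuous b) (hθ : ‖θ‖ = 1)
    (hε : 0 < ε) : Integrable fun y => outgoingLeadingTerm lam b y * dampedKernel lam θ ε y := by
  obtain ⟨C, hC, hCb⟩ := exists_bound_outgoingLeadingTerm lam hb
  refine ((integrable_norm_rpow_mul_exp (s := -(1 / 2)) (by norm_num) hε).1.const_mul
    (C * (2 * |lam| * ε))).mono' (aestronglyMeasurable_of_continuousOn_compl_zero
      ((continuousOn_outgoingLeadingTerm hb).mul continuousOn_dampedKernel))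
        (ae_of_all _ fun y => ?_)
  rw [norm_mul]
  refine (mul_le_mul (hCb y) (norm_dampedKernel_le hθ hε) (norm_nonneg _)
    (by positivity)).trans (le_of_eq ?_)
  ring

/-- The boundary integral in terms of the leading term of `u` near infinity. -/
theorem tendsto_integral_leadingTerm (hO : IsOpen 𝒪) (hbdd : Bornology.IsBounded 𝒪)
    (hcorners : (corners 𝒪).Finite)
    (hν : ∀ x ∈ frontier 𝒪 \ corners 𝒪, IsOutwardUnitNormal 𝒪 x (ν x))
    (hu : IsOutgoingSolution 𝒪 lam ω u b) (hθ : ‖θ‖ = 1) :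
    Tendsto (fun ε : ℝ => ∫ y, outgoingLeadingTerm lam b y * dampedKernel lam θ ε y)
      (𝓝[>] 0) (𝓝 (∫ y in frontier 𝒪, planeWave (-lam) θ y *
        exteriorNormalDeriv 𝒪 (perturbedPlaneWave lam ω u) y (ν y)
          ∂(Measure.hausdorffMeasure 1))) := by
  obtain ⟨R₀, hR₀⟩ := hbdd.closure.subset_ball 0
  obtain ⟨R₁, C, hR₁, hC, hrem⟩ := hu.exists_remainder_bound
  have hb := hu.amplitude_smooth.continuous
  obtain ⟨C', hC', hlead⟩ := exists_bound_outgoingLeadingTerm lam hb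
  set R := max R₀ R₁ with hRdef
  have hR1 : 1 ≤ R := hR₁.trans (le_max_right _ _)
  have hR : 0 < R := by linarith
  have hOR : closure 𝒪 ⊆ Metric.ball 0 R := hR₀.trans (Metric.ball_subset_ball (le_max_left _ _))
  have hlim := tendsto_integral_exterior hO hcorners hν hu hθ hR hOR
  set S := {y : Plane | 2 * R < ‖y‖} with hS
  have hSm : MeasurableSet S := (isOpen_lt continuous_const continuous_norm).measurableSet
  set F : ℝ → Plane → ℂ := fun ε y => u y * (planeWave (-lam) θ y *
      (Real.exp (-(ε * ‖y‖)) * ((ε ^ 2 - ε / ‖y‖ : ℝ) + 2 * I * lam * ε * (⟪y, θ⟫ / ‖y‖ : ℝ))))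
    with hF
  set L : ℝ → Plane → ℂ := fun ε y => outgoingLeadingTerm lam b y * dampedKernel lam θ ε y
  set K₁ := C + C' with hK₁
  set K₂ := K₁ + 2 * |lam| * C + 2 * |lam| * C' * (2 * R) with hK₂
  have hSy : ∀ y ∈ S, 1 ≤ ‖y‖ ∧ R₁ ≤ ‖y‖ := fun y hy => by
    have h1 : 2 * R < ‖y‖ := hy
    have h2 : R₁ ≤ R := le_max_right _ _
    constructor <;> linarith
  have huS : ∀ y ∈ S, ‖u y‖ ≤ K₁ * ‖y‖ ^ (-(1 / 2) : ℝ) := by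
    intro y hy
    obtain ⟨h1, h2⟩ := hSy y hy
    calc ‖u y‖ = ‖(u y - outgoingLeadingTerm lam b y) + outgoingLeadingTerm lam b y‖ := by
          rw [sub_add_cancel]
      _ ≤ C * ‖y‖ ^ (-(3 / 2) : ℝ) + C' * ‖y‖ ^ (-(1 / 2) : ℝ) :=
          (norm_add_le _ _).trans (add_le_add (hrem y h2) (hlead y))
      _ ≤ C * ‖y‖ ^ (-(1 / 2) : ℝ) + C' * ‖y‖ ^ (-(1 / 2) : ℝ) := by
          refine add_le_add (mul_le_mul_of_nonneg_left ?_ hC) le_rfl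
          exact Real.rpow_le_rpow_of_exponent_le h1 (by norm_num)
      _ = _ := by rw [hK₁]; ring
  have hstep : ∀ y : Plane, y ≠ 0 → ‖y‖ ^ (-(1 / 2) : ℝ) = ‖y‖ * ‖y‖ ^ (-(3 / 2) : ℝ) := by
    intro y hy
    have h1 : (-(1 / 2) : ℝ) = 1 + -(3 / 2) := by norm_num
    rw [h1, Real.rpow_add (norm_pos_iff.2 hy), Real.rpow_one]
  have hFcont : ∀ ε, ContinuousOn (F ε) S := by
    intro ε
    have h0 : S ⊆ {0}ᶜ := fun y hy h => by
      have := (hSy y hy).1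
      rw [mem_singleton_iff.1 h, norm_zero] at this
      linarith
    have hne : ∀ y ∈ S, ‖y‖ ≠ 0 := fun y hy => norm_ne_zero_iff.2 (h0 hy)
    have h1 : ContinuousOn (fun y : Plane => ⟪y, θ⟫ / ‖y‖) S :=
      ContinuousOn.div (by fun_prop) continuousOn_id.norm hne
    have h2 : ContinuousOn (fun y : Plane => ((⟪y, θ⟫ / ‖y‖ : ℝ) : ℂ)) S :=
      continuous_ofReal.comp_continuousOn h1
    have h3 : Continuous fun y : Plane => ((Real.exp (-(ε * ‖y‖)) : ℝ) : ℂ) := by fun_prop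
    have h4 : ContinuousOn (fun y : Plane => ((ε ^ 2 - ε / ‖y‖ : ℝ) : ℂ)) S :=
      continuous_ofReal.comp_continuousOn (continuousOn_const.sub
        (continuousOn_const.div continuousOn_id.norm hne))
    have h5 : S ⊆ 𝒪ᶜ := fun y hy h => by
      have h6 := mem_ball_zero_iff.1 (hOR (subset_closure h))
      have h7 : 2 * R < ‖y‖ := hy
      linarith
    exact (hu.continuousOn.mono h5).mul ((contDiff_planeWave (n := 0)).continuous.continuousOn.mul
      (h3.continuousOn.mul (h4.add (continuousOn_const.mul h2))))
  have hdiff : ∀ ε, 0 < ε → ∀ y, ‖S.indicator (F ε) y - L ε y‖ ≤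
      K₁ * ε ^ 2 * (‖y‖ ^ (-(1 / 2) : ℝ) * Real.exp (-(ε * ‖y‖))) +
        K₂ * ε * (‖y‖ ^ (-(3 / 2) : ℝ) * Real.exp (-(ε * ‖y‖))) := by
    intro ε hε y
    have hex := Real.exp_pos (-(ε * ‖y‖))
    have hq1 : 0 ≤ ‖y‖ ^ (-(1 / 2) : ℝ) := Real.rpow_nonneg (norm_nonneg y) _
    have hq3 : 0 ≤ ‖y‖ ^ (-(3 / 2) : ℝ) := Real.rpow_nonneg (norm_nonneg y) _
    by_cases hy : y ∈ S
    · obtain ⟨h1, h2⟩ := hSy y hy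
      have hy0 : 0 < ‖y‖ := by linarith
      have e : F ε y - L ε y = u y * (planeWave (-lam) θ y * (Real.exp (-(ε * ‖y‖)) *
            (ε ^ 2 - ε / ‖y‖ : ℝ))) +
          (u y - outgoingLeadingTerm lam b y) * dampedKernel lam θ ε y := by
        simp only [hF, L, dampedKernel]
        ring
      rw [indicator_of_mem hy, e]
      refine (norm_add_le _ _).trans ?_
      have h3 : |ε ^ 2 - ε / ‖y‖| ≤ ε ^ 2 + ε / ‖y‖ := by
        refine (abs_sub _ _).trans (le_of_eq ?_)
        rw [abs_of_nonneg (sq_nonneg ε), abs_of_pos (by positivity)]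
      have m1 : ‖u y * (planeWave (-lam) θ y * (Real.exp (-(ε * ‖y‖)) *
            (ε ^ 2 - ε / ‖y‖ : ℝ)))‖ ≤ K₁ * ‖y‖ ^ (-(1 / 2) : ℝ) *
            (Real.exp (-(ε * ‖y‖)) * (ε ^ 2 + ε / ‖y‖)) := by
        rw [norm_mul, norm_mul, norm_mul, norm_planeWave, one_mul, norm_real, norm_real,
          Real.norm_of_nonneg hex.le, Real.norm_eq_abs]
        exact mul_le_mul (huS y hy) (mul_le_mul_of_nonneg_left h3 hex.le) (by positivity)
          (by positivity)
      have m2 : ‖(u y - outgoingLeadingTerm lam b y) * dampedKernel lam θ ε y‖ ≤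
          C * ‖y‖ ^ (-(3 / 2) : ℝ) * (2 * |lam| * ε * Real.exp (-(ε * ‖y‖))) := by
        rw [norm_mul]
        exact mul_le_mul (hrem y h2) (norm_dampedKernel_le hθ hε) (norm_nonneg _) (by positivity)
      refine (add_le_add m1 m2).trans ?_
      have m3 : K₁ * ‖y‖ ^ (-(1 / 2) : ℝ) * (Real.exp (-(ε * ‖y‖)) * (ε ^ 2 + ε / ‖y‖)) =
          K₁ * ε ^ 2 * (‖y‖ ^ (-(1 / 2) : ℝ) * Real.exp (-(ε * ‖y‖))) +
            K₁ * ε * (‖y‖ ^ (-(3 / 2) : ℝ) * Real.exp (-(ε * ‖y‖))) := by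
        rw [hstep y (norm_pos_iff.1 hy0)]
        field_simp
      rw [m3]
      have m4 : 0 ≤ 2 * |lam| * C' * (2 * R) * ε * (‖y‖ ^ (-(3 / 2) : ℝ) *
        Real.exp (-(ε * ‖y‖))) := by positivity
      rw [hK₂]
      linarith
    · rw [indicator_of_notMem hy, zero_sub, norm_neg]
      have hy' : ‖y‖ ≤ 2 * R := not_lt.1 hy
      have hq : ‖y‖ ^ (-(1 / 2) : ℝ) ≤ 2 * R * ‖y‖ ^ (-(3 / 2) : ℝ) := by
        -- At the origin both negative powers are `0` by convention; elsewhere the bound is `‖y‖ ≤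
        -- 2R`.
        by_cases h0 : y = 0
        · rw [h0, norm_zero, Real.zero_rpow (by norm_num), Real.zero_rpow (by norm_num), mul_zero]
        · rw [hstep y h0]
          exact mul_le_mul_of_nonneg_right hy' hq3
      have m1 : ‖L ε y‖ ≤ C' * (2 * R * ‖y‖ ^ (-(3 / 2) : ℝ)) *
          (2 * |lam| * ε * Real.exp (-(ε * ‖y‖))) := by
        rw [norm_mul]
        exact mul_le_mul ((hlead y).trans (mul_le_mul_of_nonneg_left hq hC'))
          (norm_dampedKernel_le hθ hε) (norm_nonneg _) (by positivity)
      refine m1.trans ?_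
      have m4 : 0 ≤ K₁ * ε ^ 2 * (‖y‖ ^ (-(1 / 2) : ℝ) * Real.exp (-(ε * ‖y‖))) := by positivity
      have m5 : 0 ≤ (K₁ + 2 * |lam| * C) * ε * (‖y‖ ^ (-(3 / 2) : ℝ) *
        Real.exp (-(ε * ‖y‖))) := by positivity
      rw [hK₂]
      linarith
  set V := 2 * volume.real (Metric.ball (0 : Plane) 1) with hV
  have hint : ∀ ε, 0 < ε → ‖(∫ y in S, F ε y) - ∫ y, L ε y‖ ≤
      K₁ * ε ^ 2 * (V * ((1 / ε) ^ (-(1 / 2) + 2 : ℝ) * Real.Gamma (-(1 / 2) + 2))) +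
        K₂ * ε * (V * ((1 / ε) ^ (-(3 / 2) + 2 : ℝ) * Real.Gamma (-(3 / 2) + 2))) := by
    intro ε hε
    obtain ⟨i1, j1⟩ := integrable_norm_rpow_mul_exp (s := -(1 / 2)) (by norm_num) hε
    obtain ⟨i3, j3⟩ := integrable_norm_rpow_mul_exp (s := -(3 / 2)) (by norm_num) hε
    have hLi : Integrable (L ε) := integrable_outgoingLeadingTerm_mul_dampedKernel hb hθ hε
    have hbd := (i1.const_mul (K₁ * ε ^ 2)).add (i3.const_mul (K₂ * ε))
    have hFm : AEStronglyMeasurable (S.indicator (F ε)) volume :=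
      (aestronglyMeasurable_indicator_iff hSm).2 ((hFcont ε).aestronglyMeasurable hSm)
    have hd : Integrable (fun y => S.indicator (F ε) y - L ε y) :=
      hbd.mono' (hFm.sub hLi.1) (ae_of_all _ (hdiff ε hε))
    have hFi : Integrable (S.indicator (F ε)) := by
      refine (hd.add hLi).congr (ae_of_all _ fun y => ?_)
      simp
    rw [← integral_indicator hSm, ← integral_sub hFi hLi]
    refine (norm_integral_le_of_norm_le hbd (ae_of_all _ (hdiff ε hε))).trans (le_of_eq ?_)
    rw [← j1, ← j3, ← integral_const_mul, ← integral_const_mul]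
    exact integral_add (i1.const_mul _) (i3.const_mul _)
  -- Both errors are of order `√ε`: `ε² ε^(-3/2)` from the weight `‖y‖^(-1/2)`, and `ε ε^(-1/2)`
  -- from the weight `‖y‖^(-3/2)`.
  have hzero : Tendsto (fun ε : ℝ =>
      K₁ * ε ^ 2 * (V * ((1 / ε) ^ (-(1 / 2) + 2 : ℝ) * Real.Gamma (-(1 / 2) + 2))) +
        K₂ * ε * (V * ((1 / ε) ^ (-(3 / 2) + 2 : ℝ) * Real.Gamma (-(3 / 2) + 2))))
      (𝓝[>] 0) (𝓝 0) := by
    have h1 : Tendsto (fun ε : ℝ => (K₁ * V * Real.Gamma (-(1 / 2) + 2) +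
        K₂ * V * Real.Gamma (-(3 / 2) + 2)) * √ε) (𝓝[>] 0) (𝓝 0) := by
      have : Continuous fun ε : ℝ => (K₁ * V * Real.Gamma (-(1 / 2) + 2) +
        K₂ * V * Real.Gamma (-(3 / 2) + 2)) * √ε := by fun_prop
      simpa using (this.tendsto 0).mono_left (nhdsWithin_le_nhds (s := Ioi 0))
    refine h1.congr' ?_
    filter_upwards [self_mem_nhdsWithin] with ε hε
    have hε' : (0 : ℝ) < ε := hε
    have a1 : ε ^ 2 * (1 / ε) ^ (-(1 / 2) + 2 : ℝ) = √ε := by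
      rw [one_div, Real.inv_rpow hε'.le, ← Real.rpow_neg hε'.le, ← Real.rpow_natCast,
        ← Real.rpow_add hε', Real.sqrt_eq_rpow]
      norm_num
    have a2 : ε * (1 / ε) ^ (-(3 / 2) + 2 : ℝ) = √ε := by
      rw [one_div, Real.inv_rpow hε'.le, ← Real.rpow_neg hε'.le]
      nth_rewrite 1 [← Real.rpow_one ε]
      rw [← Real.rpow_add hε', Real.sqrt_eq_rpow]
      norm_num
    calc _ = K₁ * √ε * (V * Real.Gamma (-(1 / 2) + 2)) +
          K₂ * √ε * (V * Real.Gamma (-(3 / 2) + 2)) := by ring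
      _ = K₁ * (ε ^ 2 * (1 / ε) ^ (-(1 / 2) + 2 : ℝ)) * (V * Real.Gamma (-(1 / 2) + 2)) +
          K₂ * (ε * (1 / ε) ^ (-(3 / 2) + 2 : ℝ)) * (V * Real.Gamma (-(3 / 2) + 2)) := by
        rw [a1, a2]
      _ = _ := by ring
  have hd0 : Tendsto (fun ε => (∫ y in S, F ε y) - ∫ y, L ε y) (𝓝[>] 0) (𝓝 0) :=
    squeeze_zero_norm' (by
      filter_upwards [self_mem_nhdsWithin] with ε hε using hint ε hε) hzero
  have hF' : Tendsto (fun ε => ∫ y in S, F ε y) (𝓝[>] 0) (𝓝 _) := hlim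
  have := hF'.sub hd0
  simp only [sub_sub_cancel, sub_zero] at this
  exact this

end LeadingTerm


/-! ### A Fresnel type integral. -/

section FresnelIntegral

theorem ofReal_mul_cpow {r : ℝ} (hr : 0 < r) {x : ℂ} (hx : x ≠ 0) (s : ℝ) :
    ((r : ℂ) * x) ^ (s : ℂ) = ((r ^ s : ℝ) : ℂ) * x ^ (s : ℂ) := by
  have hr' : (r : ℂ) ≠ 0 := ofReal_ne_zero.2 hr.ne'
  rw [cpow_def_of_ne_zero (mul_ne_zero hr' hx), log_ofReal_mul hr hx, add_mul, exp_add,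
    cpow_def_of_ne_zero hx, Real.rpow_def_of_pos hr]
  push_cast
  rfl

/-- The complex number `1 - i κ x`, which has real part `1`. -/
noncomputable def phaseDenominator (κ x : ℝ) : ℂ := 1 - I * κ * x

variable {κ x : ℝ}

theorem phaseDenominator_re : (phaseDenominator κ x).re = 1 := by simp [phaseDenominator]

theorem phaseDenominator_im : (phaseDenominator κ x).im = -(κ * x) := by simp [phaseDenominator]

theorem phaseDenominator_ne_zero : phaseDenominator κ x ≠ 0 := fun h => by
  have := phaseDenominator_re (κ := κ) (x := x)
  rw [h] at this
  simp at this

theorem phaseDenominator_mem_slitPlane : phaseDenominator κ x ∈ slitPlane :=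
  Or.inl (by rw [phaseDenominator_re]; exact one_pos)

theorem continuous_phaseDenominator : Continuous (phaseDenominator κ) := by
  unfold phaseDenominator
  fun_prop

theorem continuous_phaseDenominator_cpow (s : ℂ) :
    Continuous fun x => phaseDenominator κ x ^ s :=
  continuous_phaseDenominator.cpow continuous_const fun _ => phaseDenominator_mem_slitPlane

/-- The modulus of `1 - iκx` is at least `1` and at least `|κ|x`, hence at least a multiple of `1 +
y²`; the exponent `3/2` is weakened to `1`, which still gives an integrable majorant. -/
theorem norm_phaseDenominator_cpow_le {y : ℝ} (hκ : κ ≠ 0) (hx : y ^ 2 ≤ x) :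
    ‖phaseDenominator κ x ^ ((-(3 / 2) : ℝ) : ℂ)‖ ≤ 2 / min 1 |κ| * (1 + y ^ 2)⁻¹ := by
  have hm : 0 < min 1 |κ| := lt_min one_pos (abs_pos.2 hκ)
  have h1 : 1 ≤ ‖phaseDenominator κ x‖ := by
    simpa [phaseDenominator_re] using abs_re_le_norm (phaseDenominator κ x)
  have h2 : |κ| * x ≤ ‖phaseDenominator κ x‖ := by
    refine le_trans ?_ (abs_im_le_norm (phaseDenominator κ x))
    rw [phaseDenominator_im, abs_neg, abs_mul]
    exact mul_le_mul_of_nonneg_left (le_abs_self x) (abs_nonneg κ)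
  have h3 : min 1 |κ| * (1 + y ^ 2) ≤ 2 * ‖phaseDenominator κ x‖ := by
    have h4 : min 1 |κ| ≤ 1 := min_le_left _ _
    have h5 : min 1 |κ| * y ^ 2 ≤ |κ| * x :=
      mul_le_mul (min_le_right _ _) hx (sq_nonneg y) (abs_nonneg κ)
    linarith
  rw [norm_cpow_real]
  calc ‖phaseDenominator κ x‖ ^ (-(3 / 2) : ℝ) ≤ ‖phaseDenominator κ x‖ ^ (-1 : ℝ) :=
        Real.rpow_le_rpow_of_exponent_le h1 (by norm_num)
    _ = ‖phaseDenominator κ x‖⁻¹ := Real.rpow_neg_one _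
    _ ≤ (min 1 |κ| * (1 + y ^ 2) / 2)⁻¹ := inv_anti₀ (by positivity) (by linarith)
    _ = _ := by
      have : (1 + y ^ 2) ≠ 0 := by positivity
      field_simp

/-- `∫ (1 - i κ s²)^(-3/2) ds = 2 (-i κ)^(-1/2)`. -/
theorem integral_phaseDenominator_sq (hκ : κ ≠ 0) :
    ∫ s : ℝ, phaseDenominator κ (s ^ 2) ^ ((-(3 / 2) : ℝ) : ℂ) =
      2 * (-(I * κ)) ^ ((-(1 / 2) : ℝ) : ℂ) := by
  -- The function `s (1 - iκs²)^(-1/2)` is an odd antiderivative of the integrand, so the integral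
  -- is twice its limit at `+∞`.
  set F : ℝ → ℂ := fun s => s * phaseDenominator κ (s ^ 2) ^ ((-(1 / 2) : ℝ) : ℂ) with hF
  have hderiv : ∀ s : ℝ, HasDerivAt F (phaseDenominator κ (s ^ 2) ^ ((-(3 / 2) : ℝ) : ℂ)) s := by
    intro s
    have h1 : HasDerivAt (fun s : ℝ => ((s ^ 2 : ℝ) : ℂ)) ((2 * s : ℝ) : ℂ) s := by
      have : HasDerivAt (fun s : ℝ => s ^ 2) (2 * s) s := by simpa using hasDerivAt_pow 2 s
      exact this.ofReal_comp
    have h2 : HasDerivAt (fun s : ℝ => phaseDenominator κ (s ^ 2)) (-(I * κ * (2 * s : ℝ))) s := by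
      unfold phaseDenominator
      exact (h1.const_mul (I * κ)).const_sub 1
    have h3 : HasDerivAt (fun z : ℂ => z ^ ((-(1 / 2) : ℝ) : ℂ)) _ (phaseDenominator κ (s ^ 2)) :=
      (hasDerivAt_id _).cpow_const phaseDenominator_mem_slitPlane
    have h4 := h3.comp s h2
    have h5 : HasDerivAt (fun s : ℝ => (s : ℂ)) 1 s := (hasDerivAt_id s).ofReal_comp
    refine (h5.mul h4).congr_deriv ?_
    have e1 : ((-(1 / 2) : ℝ) : ℂ) - 1 = ((-(3 / 2) : ℝ) : ℂ) := by push_cast; ring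
    have e2 : ((-(1 / 2) : ℝ) : ℂ) = 1 + ((-(3 / 2) : ℝ) : ℂ) := by push_cast; ring
    simp only [Function.comp_apply, id, e1]
    rw [e2, cpow_add _ _ phaseDenominator_ne_zero, cpow_one, phaseDenominator]
    push_cast
    ring
  have hint : Integrable fun s : ℝ => phaseDenominator κ (s ^ 2) ^ ((-(3 / 2) : ℝ) : ℂ) := by
    refine (integrable_inv_one_add_sq.const_mul (2 / min 1 |κ|)).mono'
      ((continuous_phaseDenominator_cpow _).comp (continuous_pow 2)).aestronglyMeasurable
      (ae_of_all _ fun s => norm_phaseDenominator_cpow_le hκ le_rfl)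
  have hIκ : -(I * κ) ∈ slitPlane := Or.inr (by simpa using hκ)
  have htop : Tendsto F atTop (𝓝 ((-(I * κ)) ^ ((-(1 / 2) : ℝ) : ℂ))) := by
    have h1 : Tendsto (fun s : ℝ => ((((s ^ 2)⁻¹ : ℝ) : ℂ) - I * κ) ^ ((-(1 / 2) : ℝ) : ℂ)) atTop
        (𝓝 ((-(I * κ)) ^ ((-(1 / 2) : ℝ) : ℂ))) := by
      have h2 : Tendsto (fun s : ℝ => (s ^ 2)⁻¹) atTop (𝓝 0) :=
        (tendsto_pow_atTop two_ne_zero).inv_tendsto_atTop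
      have h3 : Tendsto (fun s : ℝ => (((s ^ 2)⁻¹ : ℝ) : ℂ) - I * κ) atTop (𝓝 (-(I * κ))) := by
        have := ((continuous_ofReal.tendsto 0).comp h2).sub_const (I * κ)
        simpa using this
      exact (continuousAt_cpow_const hIκ).tendsto.comp h3
    refine h1.congr' ?_
    filter_upwards [eventually_gt_atTop 0] with s hs
    have e1 : phaseDenominator κ (s ^ 2) =
        ((s ^ 2 : ℝ) : ℂ) * ((((s ^ 2)⁻¹ : ℝ) : ℂ) - I * κ) := by
      have hs' : (s : ℂ) ≠ 0 := ofReal_ne_zero.2 hs.ne'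
      rw [phaseDenominator]
      push_cast
      field_simp
    have e2 : ((((s ^ 2)⁻¹ : ℝ) : ℂ) - I * κ) ≠ 0 := fun h => by
      rw [h, mul_zero] at e1
      exact phaseDenominator_ne_zero e1
    have e3 : (s ^ 2) ^ (-(1 / 2) : ℝ) = s⁻¹ := by
      rw [← Real.rpow_natCast, ← Real.rpow_mul hs.le]
      norm_num [Real.rpow_neg_one]
    simp only [hF]
    rw [e1, ofReal_mul_cpow (by positivity) e2, e3, ← mul_assoc, ← ofReal_mul,
      mul_inv_cancel₀ hs.ne', ofReal_one, one_mul]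
  have hbot : Tendsto F atBot (𝓝 (-((-(I * κ)) ^ ((-(1 / 2) : ℝ) : ℂ)))) := by
    have := (htop.comp tendsto_neg_atBot_atTop).neg
    refine this.congr fun s => ?_
    simp [hF]
  rw [integral_of_hasDerivAt_of_tendsto hderiv hint hbot htop]
  ring

end FresnelIntegral

/-! ### Concentration of the angular integral and the constant `4πi`. -/

section LaplaceMethod

variable {g : ℝ → ℂ} {lam : ℝ}

/-- Laplace's method for the angular integral which occurs in the far field. -/
theorem tendsto_angular_integral (hlam : lam ≠ 0) (hg : Continuous g) {B : ℝ}
    (hB : ∀ α, ‖g α‖ ≤ B) :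
    Tendsto (fun ε : ℝ => ε * ∫ α in Ioo (-Real.pi) Real.pi,
      g α * (1 / (ε - I * lam * (1 - Real.cos α : ℝ))) ^ ((3 / 2 : ℝ) : ℂ)) (𝓝[>] 0)
      (𝓝 (g 0 * (2 * (-(I * (lam / 2 : ℝ))) ^ ((-(1 / 2) : ℝ) : ℂ)))) := by
  -- The constant comes from `1 - cos x ≥ 2x²/π²` on `[-π, π]`: with this `κ` the rescaled
  -- denominator is `1 - iκx` with `x ≥ s²`, which provides the majorant.
  set κ : ℝ := lam * 2 / Real.pi ^ 2 with hκ
  have hκ0 : κ ≠ 0 := by positivity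
  have hB0 : 0 ≤ B := (norm_nonneg _).trans (hB 0)
  set W : ℝ → ℝ → ℂ := fun ε s => phaseDenominator lam ((1 - Real.cos (√ε * s)) / ε) with hW
  set A : Set ℝ := Ioo (-Real.pi) Real.pi with hA
  set h : ℝ → ℝ → ℂ := fun ε α =>
    g α * (1 / (ε - I * lam * (1 - Real.cos α : ℝ))) ^ ((3 / 2 : ℝ) : ℂ) with hh
  -- Substitute `α = √ε s`. The powers `ε` (prefactor), `ε^(1/2)` (Jacobian) and `ε^(-3/2)`
  -- (integrand) cancel.
  have hscale : ∀ ε : ℝ, 0 < ε → (ε : ℂ) * ∫ α in A, h ε α =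
      ∫ s : ℝ, ((√ε * ·) ⁻¹' A).indicator
        (fun s => g (√ε * s) * W ε s ^ ((-(3 / 2) : ℝ) : ℂ)) s := by
    intro ε hε
    have hsq : 0 < √ε := Real.sqrt_pos.2 hε
    have h1 := Measure.integral_comp_mul_left (A.indicator (h ε)) √ε
    rw [abs_of_pos (inv_pos.2 hsq)] at h1
    have h2 : ∫ α in A, h ε α = √ε • ∫ s : ℝ, A.indicator (h ε) (√ε * s) := by
      rw [h1, smul_inv_smul₀ hsq.ne', integral_indicator measurableSet_Ioo]
    rw [h2, real_smul, ← mul_assoc, ← integral_const_mul]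
    refine integral_congr_ae (ae_of_all _ fun s => ?_)
    have h3 : A.indicator (h ε) (√ε * s) =
        ((√ε * ·) ⁻¹' A).indicator (fun s => h ε (√ε * s)) s := rfl
    simp only [h3]
    rw [← indicator_const_mul]
    refine congrFun (congrArg _ (funext fun s => ?_)) s
    have e1 : (ε : ℂ) - I * lam * (1 - Real.cos (√ε * s) : ℝ) = ε * W ε s := by
      have : (ε : ℂ) ≠ 0 := ofReal_ne_zero.2 hε.ne'
      simp only [hW, phaseDenominator]
      push_cast
      field_simp
    have e2 : (1 : ℂ) / (ε * W ε s) = ((ε⁻¹ : ℝ) : ℂ) * (W ε s)⁻¹ := by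
      push_cast
      rw [one_div, mul_inv]
    have e3 : (W ε s)⁻¹ ^ ((3 / 2 : ℝ) : ℂ) = W ε s ^ ((-(3 / 2) : ℝ) : ℂ) := by
      rw [inv_cpow _ _ (slitPlane_arg_ne_pi phaseDenominator_mem_slitPlane), ofReal_neg, cpow_neg]
    have e4 : ε * √ε * ε⁻¹ ^ (3 / 2 : ℝ) = 1 := by
      rw [Real.inv_rpow hε.le, Real.sqrt_eq_rpow]
      nth_rewrite 1 [← Real.rpow_one ε]
      rw [← Real.rpow_add hε]
      norm_num
      exact mul_inv_cancel₀ (Real.rpow_pos_of_pos hε _).ne'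
    simp only [hh]
    rw [e1, e2, ofReal_mul_cpow (inv_pos.2 hε) (inv_ne_zero phaseDenominator_ne_zero), e3]
    calc _ = ((ε * √ε * ε⁻¹ ^ (3 / 2 : ℝ) : ℝ) : ℂ) *
          (g (√ε * s) * W ε s ^ ((-(3 / 2) : ℝ) : ℂ)) := by push_cast; ring
      _ = _ := by rw [e4, ofReal_one, one_mul]
  have hlim : Tendsto (fun ε : ℝ => ∫ s : ℝ, ((√ε * ·) ⁻¹' A).indicator
        (fun s => g (√ε * s) * W ε s ^ ((-(3 / 2) : ℝ) : ℂ)) s) (𝓝[>] 0)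
      (𝓝 (∫ s : ℝ, g 0 * phaseDenominator (lam / 2) (s ^ 2) ^ ((-(3 / 2) : ℝ) : ℂ))) := by
    refine tendsto_integral_filter_of_dominated_convergence
      (fun s => B * (2 / min 1 |κ| * (1 + s ^ 2)⁻¹)) ?_ ?_
      ((integrable_inv_one_add_sq.const_mul _).const_mul _) (ae_of_all _ fun s => ?_)
    · filter_upwards [self_mem_nhdsWithin] with ε hε
      refine AEStronglyMeasurable.indicator ?_
        ((isOpen_Ioo.preimage (continuous_const_mul √ε)).measurableSet)
      refine (Continuous.mul (by fun_prop) ?_).aestronglyMeasurable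
      exact (continuous_phaseDenominator_cpow _).comp (by fun_prop)
    · filter_upwards [self_mem_nhdsWithin] with ε hε
      refine ae_of_all _ fun s => ?_
      have hε' : (0 : ℝ) < ε := hε
      by_cases hs : s ∈ (√ε * ·) ⁻¹' A
      · rw [indicator_of_mem hs, norm_mul]
        refine mul_le_mul (hB _) ?_ (norm_nonneg _) hB0
        have h1 : |√ε * s| ≤ Real.pi := abs_le.2 ⟨hs.1.le, hs.2.le⟩
        have h2 := Real.cos_le_one_sub_mul_cos_sq h1
        have e : W ε s = phaseDenominator κ
            (Real.pi ^ 2 / 2 * ((1 - Real.cos (√ε * s)) / ε)) := by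
          simp only [hW, phaseDenominator, hκ]
          have : (Real.pi : ℂ) ≠ 0 := ofReal_ne_zero.2 Real.pi_ne_zero
          push_cast
          field_simp
        rw [e]
        refine norm_phaseDenominator_cpow_le hκ0 ?_
        rw [mul_pow, Real.sq_sqrt hε'.le] at h2
        rw [← mul_div_assoc, le_div_iff₀ hε']
        have hpi := Real.pi_pos
        have h3 : 2 / Real.pi ^ 2 * (ε * s ^ 2) ≤ 1 - Real.cos (√ε * s) := by linarith
        rw [div_mul_eq_mul_div, div_le_iff₀ (by positivity)] at h3
        linarith
      · rw [indicator_of_notMem hs, norm_zero]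
        positivity
    · have hsq : Tendsto (fun ε : ℝ => √ε * s) (𝓝[>] 0) (𝓝 0) := by
        have : Continuous fun ε : ℝ => √ε * s := by fun_prop
        simpa using (this.tendsto 0).mono_left (nhdsWithin_le_nhds (s := Ioi 0))
      have h1 : Tendsto (fun ε : ℝ => (1 - Real.cos (√ε * s)) / ε) (𝓝[>] 0) (𝓝 (s ^ 2 / 2)) := by
        have h2 : Tendsto (fun ε : ℝ => ε * s ^ 4) (𝓝[>] 0) (𝓝 0) := by
          have : Continuous fun ε : ℝ => ε * s ^ 4 := by fun_prop
          simpa using (this.tendsto 0).mono_left (nhdsWithin_le_nhds (s := Ioi 0))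
        rw [tendsto_iff_norm_sub_tendsto_zero]
        refine squeeze_zero' (Eventually.of_forall fun _ => norm_nonneg _) ?_ h2
        have h3 : ∀ᶠ ε in 𝓝[>] (0 : ℝ), |√ε * s| < 1 :=
          hsq.abs.eventually_lt_const (by simp)
        filter_upwards [h3, self_mem_nhdsWithin] with ε h4 hε
        have hε' : (0 : ℝ) < ε := hε
        have h5 := Real.cos_bound h4.le
        have e1 : (√ε * s) ^ 2 = ε * s ^ 2 := by rw [mul_pow, Real.sq_sqrt hε'.le]
        have e2 : |√ε * s| ^ 4 = ε ^ 2 * s ^ 4 := by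
          rw [show 4 = 2 * 2 from rfl, pow_mul, sq_abs, e1]
          ring
        rw [e1, e2] at h5
        have e3 : (1 - Real.cos (√ε * s)) / ε - s ^ 2 / 2 =
            -(Real.cos (√ε * s) - (1 - ε * s ^ 2 / 2)) / ε := by
          field_simp
          ring
        rw [e3, Real.norm_eq_abs, abs_div, abs_neg, abs_of_pos hε', div_le_iff₀ hε']
        refine h5.trans ?_
        have : 0 ≤ ε ^ 2 * s ^ 4 := by positivity
        linarith
      have h6 : Tendsto (fun ε => g (√ε * s) * W ε s ^ ((-(3 / 2) : ℝ) : ℂ)) (𝓝[>] 0)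
          (𝓝 (g 0 * phaseDenominator lam (s ^ 2 / 2) ^ ((-(3 / 2) : ℝ) : ℂ))) :=
        ((hg.tendsto 0).comp hsq).mul (((continuous_phaseDenominator_cpow _).tendsto _).comp h1)
      have e : phaseDenominator lam (s ^ 2 / 2) = phaseDenominator (lam / 2) (s ^ 2) := by
        simp only [phaseDenominator]
        push_cast
        ring
      rw [e] at h6
      refine h6.congr' ?_
      filter_upwards [hsq (Ioo_mem_nhds (neg_lt_zero.2 Real.pi_pos) Real.pi_pos)] with ε hε
      rw [indicator_of_mem (show s ∈ (√ε * ·) ⁻¹' A from hε)]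
  rw [integral_const_mul, integral_phaseDenominator_sq (by positivity)] at hlim
  refine hlim.congr' ?_
  filter_upwards [self_mem_nhdsWithin] with ε hε using (hscale ε hε).symm

theorem Gamma_three_halves : Gamma ((3 / 2 : ℝ) : ℂ) = ((√Real.pi / 2 : ℝ) : ℂ) := by
  rw [Gamma_ofReal]
  congr 1
  have : (3 / 2 : ℝ) = 1 / 2 + 1 := by norm_num
  rw [this, Real.Gamma_add_one (by norm_num), Real.Gamma_one_half_eq]
  ring

/-- The constants in the far field combine to `4πi`. -/
theorem farField_constant (hlam : lam ≠ 0) :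
    exp (-(Real.pi * I / 4)) * ((Real.sqrt (2 * Real.pi) : ℝ) / (lam : ℂ) ^ (1 / 2 : ℂ)) *
      (2 * I * lam) * Gamma ((3 / 2 : ℝ) : ℂ) *
        (2 * (-(I * (lam / 2 : ℝ))) ^ ((-(1 / 2) : ℝ) : ℂ)) = 4 * Real.pi * I := by
  have hlamC : (lam : ℂ) ^ (1 / 2 : ℂ) ≠ 0 := by
    rw [Ne, cpow_eq_zero_iff]
    simp [hlam]
  have key : exp (-(Real.pi * I / 4)) * lam * (-(I * (lam / 2 : ℝ))) ^ ((-(1 / 2) : ℝ) : ℂ) =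
      (√2 : ℝ) * (lam : ℂ) ^ (1 / 2 : ℂ) := by
    have hhalf : (1 / 2 : ℂ) = ((1 / 2 : ℝ) : ℂ) := by push_cast; ring
    have hpow : ∀ μ : ℝ, 0 < μ → μ * (μ / 2) ^ (-(1 / 2) : ℝ) = √2 * μ ^ (1 / 2 : ℝ) := by
      intro μ hμ
      rw [Real.div_rpow hμ.le (by norm_num), Real.rpow_neg (by norm_num : (0 : ℝ) ≤ 2),
        Real.sqrt_eq_rpow, div_inv_eq_mul, ← mul_assoc]
      nth_rewrite 1 [← Real.rpow_one μ]
      rw [← Real.rpow_add hμ]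
      norm_num
      ring
    -- The branch of `√λ` matters here. For `λ > 0`, `(-i)^(-1/2) = exp(πi/4)` cancels the prefactor
    -- `exp(-πi/4)`. For `λ < 0`, `i^(-1/2)` doubles it to `-i`, and the sign of `λ` turns this into
    -- `i = (-1)^(1/2)`.
    rcases hlam.lt_or_gt with hneg | hpos
    · obtain ⟨μ, rfl⟩ : ∃ μ, lam = -μ := ⟨-lam, by ring⟩
      have hμ : 0 < μ := by linarith
      have e1 : -(I * ((-μ / 2 : ℝ) : ℂ)) = ((μ / 2 : ℝ) : ℂ) * I := by push_cast; ring
      have e2 : ((-μ : ℝ) : ℂ) = ((μ : ℝ) : ℂ) * (-1) := by push_cast; ring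
      have e3 : I ^ ((-(1 / 2) : ℝ) : ℂ) = exp (-(Real.pi * I / 4)) := by
        rw [cpow_def_of_ne_zero I_ne_zero, log_I]
        congr 1
        push_cast
        ring
      have e4 : (-1 : ℂ) ^ ((1 / 2 : ℝ) : ℂ) = I := by
        rw [cpow_def_of_ne_zero (by norm_num), log_neg_one]
        rw [show (Real.pi : ℂ) * I * ((1 / 2 : ℝ) : ℂ) = Real.pi / 2 * I by push_cast; ring]
        exact exp_pi_div_two_mul_I
      have e5 : exp (-(Real.pi * I / 4)) * exp (-(Real.pi * I / 4)) = -I := by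
        rw [← exp_add, show -(Real.pi * I / 4) + -(Real.pi * I / 4) = -Real.pi / 2 * I by ring]
        rw [show (-Real.pi / 2 * I : ℂ) = -(Real.pi / 2 * I) by ring, exp_neg,
          exp_pi_div_two_mul_I, inv_I]
      rw [e1, hhalf, ofReal_mul_cpow (half_pos hμ) I_ne_zero, e2, ofReal_mul_cpow hμ
        (by norm_num), e3, e4]
      have h1 := hpow μ hμ
      have h2 : ((μ * (μ / 2) ^ (-(1 / 2) : ℝ) : ℝ) : ℂ) = ((√2 * μ ^ (1 / 2 : ℝ) : ℝ) : ℂ) := by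
        rw [h1]
      rw [ofReal_mul, ofReal_mul] at h2
      linear_combination (-(μ * (((μ / 2) ^ (-(1 / 2) : ℝ) : ℝ) : ℂ))) * e5 + I * h2
    · have e1 : -(I * ((lam / 2 : ℝ) : ℂ)) = ((lam / 2 : ℝ) : ℂ) * (-I) := by push_cast; ring
      have e3 : (-I) ^ ((-(1 / 2) : ℝ) : ℂ) = exp (Real.pi * I / 4) := by
        rw [cpow_def_of_ne_zero (neg_ne_zero.2 I_ne_zero), log_neg_I]
        congr 1
        push_cast
        ring
      have e5 : exp (-(Real.pi * I / 4)) * exp (Real.pi * I / 4) = 1 := by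
        rw [← exp_add, neg_add_cancel, exp_zero]
      rw [e1, hhalf, ofReal_mul_cpow (half_pos hpos) (neg_ne_zero.2 I_ne_zero), e3,
        ← ofReal_cpow hpos.le]
      have h2 : ((lam * (lam / 2) ^ (-(1 / 2) : ℝ) : ℝ) : ℂ) =
          ((√2 * lam ^ (1 / 2 : ℝ) : ℝ) : ℂ) := by rw [hpow lam hpos]
      rw [ofReal_mul, ofReal_mul] at h2
      linear_combination (lam * (((lam / 2) ^ (-(1 / 2) : ℝ) : ℝ) : ℂ)) * e5 + h2
  have hs : ((√(2 * Real.pi) : ℝ) : ℂ) * ((√Real.pi / 2 : ℝ) : ℂ) * ((√2 : ℝ) : ℂ) =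
      (Real.pi : ℂ) := by
    rw [← ofReal_mul, ← ofReal_mul]
    congr 1
    rw [Real.sqrt_mul (by norm_num)]
    have h1 := Real.mul_self_sqrt Real.pi_pos.le
    have h2 := Real.mul_self_sqrt (zero_le_two (α := ℝ))
    linear_combination (√2 * √2 / 2) * h1 + Real.pi / 2 * h2
  rw [Gamma_three_halves]
  field_simp
  linear_combination (4 * ((√(2 * Real.pi) : ℝ) : ℂ) * ((√Real.pi / 2 : ℝ) : ℂ)) * key +
    4 * (lam : ℂ) ^ (1 / 2 : ℂ) * hs

end LaplaceMethod


/-! ### The radial integral as a Laplace transform. -/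

section RadialIntegral

variable {z : ℂ}

/-- Integrate the derivative of `x exp(-zx²)`, which vanishes at both ends, to reduce to the
Gaussian integral on the half line. -/
theorem integral_sq_mul_cexp_neg_mul_sq (hz : 0 < z.re) :
    ∫ x : ℝ in Ioi 0, (x : ℂ) ^ 2 * cexp (-z * x ^ 2) =
      (2 * z)⁻¹ * ((Real.pi / z) ^ (1 / 2 : ℂ) / 2) := by
  have hz0 : z ≠ 0 := fun h => by simp [h] at hz
  have hi0 : Integrable fun x : ℝ => cexp (-z * x ^ 2) := integrable_cexp_neg_mul_sq hz
  have hi1 : Integrable fun x : ℝ => (x : ℂ) * cexp (-z * x ^ 2) := integrable_mul_cexp_neg_mul_sq hz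
  have hi2 : Integrable fun x : ℝ => (x : ℂ) ^ 2 * cexp (-z * x ^ 2) := by
    have h := integrable_rpow_mul_exp_neg_mul_sq hz (s := 2) (by norm_num)
    refine h.mono' (by fun_prop) (ae_of_all _ fun x => ?_)
    rw [norm_mul, norm_pow, norm_real, norm_cexp_neg_mul_sq, Real.norm_eq_abs, sq_abs]
    norm_num
  have hderiv : ∀ x : ℝ, HasDerivAt (fun x : ℝ => (x : ℂ) * cexp (-z * x ^ 2))
      (cexp (-z * x ^ 2) - 2 * z * ((x : ℂ) ^ 2 * cexp (-z * x ^ 2))) x := by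
    intro x
    have h1 : HasDerivAt (fun x : ℝ => (x : ℂ)) 1 x := (hasDerivAt_id x).ofReal_comp
    have h2 := h1.fun_mul (((h1.fun_pow 2).const_mul (-z)).cexp)
    refine h2.congr_deriv ?_
    push_cast
    ring
  have hd : Integrable fun x : ℝ =>
      cexp (-z * x ^ 2) - 2 * z * ((x : ℂ) ^ 2 * cexp (-z * x ^ 2)) := hi0.sub (hi2.const_mul _)
  have hlim := tendsto_zero_of_hasDerivAt_of_integrableOn_Ioi (a := 0) (fun x _ => hderiv x)
    hd.integrableOn hi1.integrableOn
  have h := integral_Ioi_of_hasDerivAt_of_tendsto' (a := 0) (fun x _ => hderiv x)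
    hd.integrableOn hlim
  rw [integral_sub hi0.integrableOn (hi2.const_mul _).integrableOn, integral_const_mul,
    integral_gaussian_complex_Ioi hz] at h
  simp only [ofReal_zero, zero_mul, sub_zero] at h
  rw [sub_eq_zero.1 h, inv_mul_cancel_left₀ (mul_ne_zero two_ne_zero hz0)]

/-- The Laplace transform of the square root. -/
theorem integral_sqrt_mul_cexp_neg_mul (hz : 0 < z.re) :
    ∫ t : ℝ in Ioi 0, (√t : ℂ) * cexp (-(z * t)) =
      (1 / z) ^ ((3 / 2 : ℝ) : ℂ) * Gamma ((3 / 2 : ℝ) : ℂ) := by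
  have hz0 : z ≠ 0 := fun h => by simp [h] at hz
  -- The substitution `t = x²` turns the Laplace transform into a second Gaussian moment with
  -- complex parameter.
  rw [← integral_comp_rpow_Ioi (fun t : ℝ => (√t : ℂ) * cexp (-(z * t))) two_ne_zero]
  have e : EqOn (fun x : ℝ => (|(2 : ℝ)| * x ^ ((2 : ℝ) - 1)) •
      ((√(x ^ (2 : ℝ)) : ℂ) * cexp (-(z * ((x ^ (2 : ℝ) : ℝ) : ℂ)))))
      (fun x : ℝ => 2 * ((x : ℂ) ^ 2 * cexp (-z * x ^ 2))) (Ioi 0) := by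
    intro x hx
    have hx' : (0 : ℝ) < x := hx
    have e1 : (2 : ℝ) - 1 = 1 := by norm_num
    simp only [real_smul, e1, Real.rpow_one, Real.rpow_two, Real.sqrt_sq hx'.le, abs_two]
    push_cast
    ring_nf
  rw [setIntegral_congr_fun measurableSet_Ioi e, integral_const_mul,
    integral_sq_mul_cexp_neg_mul_sq hz, Gamma_three_halves]
  have e1 : ((3 / 2 : ℝ) : ℂ) = 1 + ((1 / 2 : ℝ) : ℂ) := by push_cast; ring
  have e2 : (1 / 2 : ℂ) = ((1 / 2 : ℝ) : ℂ) := by push_cast; ring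
  rw [e1, cpow_add _ _ (one_div_ne_zero hz0), cpow_one, e2, div_eq_mul_one_div (Real.pi : ℂ) z,
    ofReal_mul_cpow Real.pi_pos (one_div_ne_zero hz0), Real.sqrt_eq_rpow]
  push_cast
  field_simp

end RadialIntegral

/-! ### The far field in polar coordinates around `θ`. -/

section PolarCoordinates

variable {lam ε : ℝ} {θ : Plane} {b : UnitCircle → ℂ}

theorem exists_orthonormalBasis_zero_eq (hθ : ‖θ‖ = 1) :
    ∃ c : OrthonormalBasis (Fin 2) ℝ Plane, c 0 = θ := by
  obtain ⟨c, hc⟩ := Orthonormal.exists_orthonormalBasis_extension_of_card_eq (𝕜 := ℝ)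
    (E := Plane) (ι := Fin 2) (by simp) (v := fun _ => θ) (s := {0}) (by
      refine ⟨fun i => hθ, fun i j hij => (hij (Subsingleton.elim i j)).elim⟩)
  exact ⟨c, hc 0 rfl⟩

/-- The point of the unit circle at angle `α` from `c 0`. -/
noncomputable def circlePoint (c : OrthonormalBasis (Fin 2) ℝ Plane) (α : ℝ) : UnitCircle :=
  ⟨Real.cos α • c 0 + Real.sin α • c 1, by
    rw [mem_sphere_zero_iff_norm, ← sq_eq_sq₀ (norm_nonneg _) zero_le_one,
      ← c.sum_sq_norm_inner_right, Fin.sum_univ_two]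
    simp [inner_add_right, inner_smul_right, c.inner_eq_ite]⟩

variable {c : OrthonormalBasis (Fin 2) ℝ Plane}

theorem continuous_circlePoint : Continuous (circlePoint c) := by
  unfold circlePoint
  fun_prop

theorem norm_coe_unitCircle (x : UnitCircle) : ‖(x : Plane)‖ = 1 := by simp

theorem direction_smul {r : ℝ} (hr : 0 < r) (x : UnitCircle) : direction (r • (x : Plane)) = x := by
  have hx := norm_coe_unitCircle x
  have h0 : r • (x : Plane) ≠ 0 := by
    rw [← norm_ne_zero_iff, norm_smul, hx, mul_one, norm_ne_zero_iff]
    exact hr.ne'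
  ext1
  rw [coe_direction h0, norm_smul, hx, mul_one, Real.norm_of_nonneg hr.le, inv_smul_smul₀ hr.ne']

theorem inner_circlePoint (α : ℝ) : ⟪(circlePoint c α : Plane), c 0⟫ = Real.cos α := by
  simp [circlePoint, inner_add_left, inner_smul_left, c.inner_eq_ite]

theorem graphMap_polarCoord_symm (p : ℝ × ℝ) :
    graphMap c 0 (fun _ => 0) (polarCoord.symm p) = p.1 • (circlePoint c p.2 : Plane) := by
  simp [graphMap, frameMap, circlePoint, polarCoord_symm_apply, smul_add, smul_smul]

/-- The outgoing phase `exp(iλr)`, the plane wave `exp(-iλr cos α)` and the damping combine to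
`exp(-zr)` with `z = ε - iλ(1 - cos α)`, which is small only near the direction `θ`; the polar
Jacobian and the decay `r^(-1/2)` leave `√r`. -/
theorem leadingTerm_mul_dampedKernel_polar {r : ℝ} (hr : 0 < r) (α : ℝ) :
    r • (outgoingLeadingTerm lam b (r • (circlePoint c α : Plane)) *
      dampedKernel lam (c 0) ε (r • (circlePoint c α : Plane))) =
    exp (-(Real.pi * I / 4)) * ((Real.sqrt (2 * Real.pi) : ℝ) / (lam : ℂ) ^ (1 / 2 : ℂ)) *
      (2 * I * lam) * ε * (b (circlePoint c α) * Real.cos α) *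
      ((√r : ℂ) * cexp (-((ε - I * lam * (1 - Real.cos α : ℝ)) * r))) := by
  have hn : ‖r • (circlePoint c α : Plane)‖ = r := by
    rw [norm_smul, norm_coe_unitCircle, mul_one, Real.norm_of_nonneg hr.le]
  have hi : ⟪r • (circlePoint c α : Plane), c 0⟫ = r * Real.cos α := by
    rw [real_inner_smul_left, inner_circlePoint]
  have hs : (r : ℂ) * ((Real.sqrt (2 * Real.pi / r) : ℝ) : ℂ) =
      ((Real.sqrt (2 * Real.pi) : ℝ) : ℂ) * (√r : ℂ) := by
    rw [← ofReal_mul, ← ofReal_mul, Real.sqrt_div' _ hr.le]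
    congr 1
    have h1 := Real.mul_self_sqrt hr.le
    have h2 : √r ≠ 0 := (Real.sqrt_pos.2 hr).ne'
    field_simp
    linear_combination -h1
  have he : cexp (I * lam * r) * (cexp (I * (-lam : ℝ) * (r * Real.cos α : ℝ)) *
      (Real.exp (-(ε * r)) : ℝ)) = cexp (-((ε - I * lam * (1 - Real.cos α : ℝ)) * r)) := by
    rw [ofReal_exp, ← exp_add, ← exp_add]
    congr 1
    push_cast
    ring
  rw [outgoingLeadingTerm, dampedKernel, planeWave, hn, hi, direction_smul hr,
    mul_div_cancel_left₀ _ hr.ne', real_smul, ← he]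
  calc _ = exp (-(Real.pi * I / 4)) * ((r : ℂ) * ((Real.sqrt (2 * Real.pi / r) : ℝ) : ℂ) /
        (lam : ℂ) ^ (1 / 2 : ℂ)) * (2 * I * lam) * ε * (b (circlePoint c α) * Real.cos α) *
        (cexp (I * lam * r) * (cexp (I * (-lam : ℝ) * (r * Real.cos α : ℝ)) *
      (Real.exp (-(ε * r)) : ℝ))) := by ring
    _ = _ := by rw [hs]; ring

theorem integral_leadingTerm_mul_dampedKernel (hb : Continuous b) (hε : 0 < ε) :
    ∫ y, outgoingLeadingTerm lam b y * dampedKernel lam (c 0) ε y =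
      exp (-(Real.pi * I / 4)) * ((Real.sqrt (2 * Real.pi) : ℝ) / (lam : ℂ) ^ (1 / 2 : ℂ)) *
      (2 * I * lam) * Gamma ((3 / 2 : ℝ) : ℂ) * (ε * ∫ α in Ioo (-Real.pi) Real.pi,
        b (circlePoint c α) * Real.cos α *
          (1 / (ε - I * lam * (1 - Real.cos α : ℝ))) ^ ((3 / 2 : ℝ) : ℂ)) := by
  have hh : ContDiff ℝ 2 fun _ : ℝ => (0 : ℝ) := contDiff_const
  set K := exp (-(Real.pi * I / 4)) * ((Real.sqrt (2 * Real.pi) : ℝ) / (lam : ℂ) ^ (1 / 2 : ℂ)) *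
      (2 * I * lam)
  set H : ℝ × ℝ → ℂ := fun p => (b (circlePoint c p.2) * Real.cos p.2) *
      ((√p.1 : ℂ) * cexp (-((ε - I * lam * (1 - Real.cos p.2 : ℝ)) * p.1))) with hH
  have hre : ∀ α : ℝ, ((ε : ℂ) - I * lam * (1 - Real.cos α : ℝ)).re = ε := by
    intro α
    simp
  obtain ⟨B, hB⟩ := isCompact_univ.exists_bound_of_continuousOn (hb.continuousOn (s := univ))
  have hB0 : 0 ≤ B := (norm_nonneg _).trans (hB (direction 0) (mem_univ _))
  have hsqrt : IntegrableOn (fun r : ℝ => √r * Real.exp (-(ε * r))) (Ioi 0) := by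
    have := integrableOn_rpow_mul_exp_neg_mul_rpow (p := 1) (s := 1 / 2) (b := ε)
      (by norm_num) one_pos hε
    refine this.congr_fun (fun r _ => ?_) measurableSet_Ioi
    simp [Real.sqrt_eq_rpow]
  -- For fixed `ε > 0` the integrand is bounded by `B √r exp(-εr)`, so Fubini's theorem allows the
  -- radial integration to be done first.
  have hHi : Integrable H ((volume.restrict (Ioi 0)).prod
      (volume.restrict (Ioo (-Real.pi) Real.pi))) := by
    have h1 : Integrable (fun _ : ℝ => B) (volume.restrict (Ioo (-Real.pi) Real.pi)) :=
      integrable_const B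
    refine (Integrable.mul_prod hsqrt h1).mono' ?_ (ae_of_all _ fun p => ?_)
    · have h2 : Continuous H := by
        have := (hb.comp (continuous_circlePoint (c := c)))
        have h3 : Continuous fun p : ℝ × ℝ => b (circlePoint c p.2) := this.comp continuous_snd
        exact (h3.mul (by fun_prop)).mul (by fun_prop)
      exact h2.aestronglyMeasurable
    · simp only [hH]
      rw [norm_mul, norm_mul, norm_mul, norm_real, norm_real, norm_exp,
        Real.norm_of_nonneg (Real.sqrt_nonneg _)]
      have h3 : (-(((ε : ℂ) - I * lam * (1 - Real.cos p.2 : ℝ)) * p.1)).re = -(ε * p.1) := by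
        rw [neg_re, re_mul_ofReal, hre]
      rw [h3, mul_comm]
      refine mul_le_mul_of_nonneg_left ?_ (by positivity)
      exact (mul_le_of_le_one_right (norm_nonneg _) (Real.abs_cos_le_one _)).trans
        (hB _ (mem_univ _))
  rw [← (measurePreserving_graphMap (b := c) (p := 0) (h := fun _ => 0) continuous_const).integral_comp
    (graphHomeomorph c 0 hh).measurableEmbedding, ← integral_comp_polarCoord_symm]
  have e1 : EqOn (fun p : ℝ × ℝ => p.1 •
      (outgoingLeadingTerm lam b (graphMap c 0 (fun _ => 0) (polarCoord.symm p)) *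
        dampedKernel lam (c 0) ε (graphMap c 0 (fun _ => 0) (polarCoord.symm p))))
      (fun p => K * ε * H p) polarCoord.target := by
    intro p hp
    rw [polarCoord_target] at hp
    simp only [graphMap_polarCoord_symm]
    rw [leadingTerm_mul_dampedKernel_polar hp.1]
    simp only [hH, K]
    ring
  rw [setIntegral_congr_fun polarCoord.open_target.measurableSet e1, integral_const_mul,
    polarCoord_target, Measure.volume_eq_prod, ← Measure.prod_restrict, integral_prod_symm _ hHi]
  have e2 : ∀ α : ℝ, ∫ r : ℝ in Ioi 0, H (r, α) = Gamma ((3 / 2 : ℝ) : ℂ) *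
      (b (circlePoint c α) * Real.cos α *
        (1 / (ε - I * lam * (1 - Real.cos α : ℝ))) ^ ((3 / 2 : ℝ) : ℂ)) := by
    intro α
    simp only [hH]
    rw [integral_const_mul, integral_sqrt_mul_cexp_neg_mul (by rw [hre]; exact hε)]
    ring
  simp only [e2]
  rw [integral_const_mul]
  ring

/-- The far field is recovered from the leading term of an outgoing wave. -/
theorem tendsto_integral_leadingTerm_mul_dampedKernel (hlam : lam ≠ 0) (hb : Continuous b)
    (θ : UnitCircle) :
    Tendsto (fun ε : ℝ => ∫ y, outgoingLeadingTerm lam b y * dampedKernel lam θ ε y)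
      (𝓝[>] 0) (𝓝 (4 * Real.pi * I * b θ)) := by
  obtain ⟨c, hc⟩ := exists_orthonormalBasis_zero_eq (norm_coe_unitCircle θ)
  have hg : Continuous fun α => b (circlePoint c α) * Real.cos α := by
    have := hb.comp (continuous_circlePoint (c := c))
    exact this.mul (by fun_prop)
  obtain ⟨B, hB⟩ := isCompact_univ.exists_bound_of_continuousOn (hb.continuousOn (s := univ))
  have h := (tendsto_angular_integral hlam hg (B := B) fun α => by
    rw [norm_mul, norm_real]
    exact (mul_le_of_le_one_right (norm_nonneg _) (Real.abs_cos_le_one _)).trans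
      (hB _ (mem_univ _))).const_mul
    (exp (-(Real.pi * I / 4)) * ((Real.sqrt (2 * Real.pi) : ℝ) / (lam : ℂ) ^ (1 / 2 : ℂ)) *
      (2 * I * lam) * Gamma ((3 / 2 : ℝ) : ℂ))
  have h0 : circlePoint c 0 = θ := by
    ext1
    simp [circlePoint, hc]
  have e : exp (-(Real.pi * I / 4)) * ((Real.sqrt (2 * Real.pi) : ℝ) / (lam : ℂ) ^ (1 / 2 : ℂ)) *
      (2 * I * lam) * Gamma ((3 / 2 : ℝ) : ℂ) * (b (circlePoint c 0) * Real.cos 0 *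
        (2 * (-(I * (lam / 2 : ℝ))) ^ ((-(1 / 2) : ℝ) : ℂ))) = 4 * Real.pi * I * b θ := by
    rw [← farField_constant hlam, h0, Real.cos_zero, ofReal_one]
    ring
  rw [e] at h
  refine h.congr' ?_
  filter_upwards [self_mem_nhdsWithin] with ε hε
  rw [← hc, integral_leadingTerm_mul_dampedKernel hb hε]

end PolarCoordinates


/-! ### The formula for the amplitude. -/

theorem planeWave_neg_eq (lam : ℝ) (θ x : Plane) :
    planeWave (-lam) θ x = exp (-(I * lam * (⟪x, θ⟫ : ℝ))) := by
  rw [planeWave, ofReal_neg, mul_neg, neg_mul]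

theorem integrableOn_planeWave_mul_exteriorNormalDeriv {𝒪 : Set Plane} (hO : IsOpen 𝒪)
    (hbdd : Bornology.IsBounded 𝒪) (hcorners : (corners 𝒪).Finite) {ν : Plane → Plane}
    (hν : ∀ x ∈ frontier 𝒪 \ corners 𝒪, IsOutwardUnitNormal 𝒪 x (ν x))
    {lam : ℝ} {ω : UnitCircle} {u : Plane → ℂ} {b : UnitCircle → ℂ}
    (hu : IsOutgoingSolution 𝒪 lam ω u b) {θ : Plane} (hθ : ‖θ‖ = 1) :
    IntegrableOn (fun y => planeWave (-lam) θ y *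
      exteriorNormalDeriv 𝒪 (perturbedPlaneWave lam ω u) y (ν y)) (frontier 𝒪)
      (Measure.hausdorffMeasure 1) := by
  obtain ⟨R, hR, hOR⟩ := hbdd.closure.subset_ball_lt 0 0
  let m : ContDiffBump (0 : Plane) := ⟨R, R + 1, hR, by linarith⟩
  exact (green_transport hO hcorners hν hu hθ m.contDiff m.hasCompactSupport fun y hy =>
    m.eventuallyEq_one_of_mem_ball (hOR hy)).1

/-- `A θ ω` is the amplitude of the outgoing solution `u ω`, and `S(λ) = I + A(λ)` where `A(λ)` is
the integral operator with kernel `A`. -/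
theorem mainTheorem1 (𝒪 : Set Plane) (h𝒪 : IsObstacle 𝒪) (lam : ℝ) (hlam : lam ≠ 0)
    (ν : Plane → Plane)
    (hν : ∀ x ∈ frontier 𝒪 \ corners 𝒪, IsOutwardUnitNormal 𝒪 x (ν x))
    (u : UnitCircle → Plane → ℂ) (A : UnitCircle → UnitCircle → ℂ)
    (hu : ∀ ω, IsOutgoingSolution 𝒪 lam ω (u ω) (fun θ => A θ ω)) :
    (∀ θ ω,
      IntegrableOn (boundaryIntegrand 𝒪 ν lam u θ ω) (frontier 𝒪) (Measure.hausdorffMeasure 1) ∧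
      A θ ω = 1 / (4 * Real.pi * Complex.I) *
        ∫ x in frontier 𝒪, Complex.exp (-(Complex.I * lam * (⟪x, (θ : Plane)⟫ : ℝ))) *
          exteriorNormalDeriv 𝒪 (perturbedPlaneWave lam ω (u ω)) x (ν x)
            ∂(Measure.hausdorffMeasure 1)) ∧
    ∀ S : Lp ℂ 2 circleMeasure →L[ℂ] Lp ℂ 2 circleMeasure,
      HasIntegralKernel (S - ContinuousLinearMap.id ℂ _) A →
        HasIntegralKernel (S - ContinuousLinearMap.id ℂ _) (boundaryKernel 𝒪 ν lam u) := by
  have hint : ∀ θ ω, boundaryIntegrand 𝒪 ν lam u θ ω = fun y => planeWave (-lam) θ y *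
      exteriorNormalDeriv 𝒪 (perturbedPlaneWave lam ω (u ω)) y (ν y) := by
    intro θ ω
    funext y
    rw [boundaryIntegrand, planeWave_neg_eq]
  have hA : ∀ θ ω, A θ ω = boundaryKernel 𝒪 ν lam u θ ω := by
    intro θ ω
    -- The same damped integrals tend to the boundary integral, by Green's formula, and to `4πi A(θ,
    -- ω)`, by the concentration at `θ`.
    have h1 := tendsto_nhds_unique
      (tendsto_integral_leadingTerm h𝒪.isOpen h𝒪.isBounded h𝒪.finite_corners hν (hu ω)
        (norm_coe_unitCircle θ))
      (tendsto_integral_leadingTerm_mul_dampedKernel hlam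
        (hu ω).amplitude_smooth.continuous θ)
    have hπ : (Real.pi : ℂ) ≠ 0 := ofReal_ne_zero.2 Real.pi_ne_zero
    have h4 : 4 * (Real.pi : ℂ) * I ≠ 0 := mul_ne_zero (mul_ne_zero (by norm_num) hπ) I_ne_zero
    rw [boundaryKernel, hint, h1, one_div, inv_mul_cancel_left₀ h4]
  refine ⟨fun θ ω => ⟨?_, hA θ ω⟩, fun S hS => ?_⟩
  · rw [hint]
    exact integrableOn_planeWave_mul_exteriorNormalDeriv h𝒪.isOpen h𝒪.isBounded
      h𝒪.finite_corners hν (hu ω) (norm_coe_unitCircle θ)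
  · have hK : A = boundaryKernel 𝒪 ν lam u := funext fun θ => funext fun ω => hA θ ω
    rwa [← hK]
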